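/- **Setting.** Write $z=x+iy\in\mathbb C$, $\langle z\rangle=(1+|z|^2)^{1/2}$, $\langle t\rangle=(1+t^2)^{1/2}$ for $t\in\mathbb R$, $\partial_z=\tfrac12(\partial_x-i\partial_y)$, $\partial_{\bar z}=\tfrac12(\partial_x+i\partial_y)$ and $H=-4\partial_z\partial_{\bar z}+|z|^2$. Let $\mathcal E$ be the Bargmann–Fock space of all $u\in L^2(\mathbb C)$ of the form $u(z)=e^{-|z|^2/2}f(z)$ with $f$ entire, let $\Pi$ be the orthogonal projector of $L^2(\mathbb C)$ onto $\mathcal E$, and for $s\ge 0$ let $L^{2,s}_{\mathcal E}=\{u\in\mathcal E:\langle z\rangle^s u\in L^2(\mathbb C)\}$. A *potential* is a bounded function $W:\mathbb R\times\mathbb C\to\mathbb R$ such that $t\mapsto W(t,z)$ is continuous for every $z$ and $W(t,\cdot)$ is $C^\infty$ in $(x,y)$ for every $t$. For $\delta\in\mathbb R$ and $u_0\in\mathcal E$, a *solution* is a function $u\in C(\mathbb R,\mathcal E)$ with $$i\partial_t u-\delta Hu=\Pi(W(t,\cdot)u),\qquad u(0)=u_0,$$ where the equation is understood in the sense of distributions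 in $z$: for every $\varphi\in C_c^\infty(\mathbb C)$ the function $t\mapsto\int_{\mathbb C} u(t)\varphi$ is differentiable and $i\frac{d}{dt}\int_{\mathbb C} u(t)\varphi=\delta\int_{\mathbb C} u(t)\,H\varphi+\int_{\mathbb C}\Pi(W(t,\cdot)u(t))\,\varphi$ for every $t\in\mathbb R$. **Theorem 2.4.** Let $s\ge 0$. (i) There is a constant $C>0$, depending only on $s$, such that the following holds for every $\delta\in\mathbb R$, every potential $W$ and every $C_1\ge 0$. If $$\|z^{2k-j}\,\partial_z^jW(t,\cdot)\|_{L^\infty(\mathbb C)}\le C_1\qquad\text{for all integers } 1\le j\le k\le\lceil s\rceil\text{ and all } t\in\mathbb R,$$ then every solution $u$ with initial condition $u_0\in L^{2,s}_{\mathcal E}$ satisfies, for all $t\in\mathbb R$, $$\|\langle z\rangle^s u(t)\|_{L^2(\mathbb C)}\le C\,\langle C_1t\rangle^{1/2}\,\|\langle z\rangle^s u_0\|_{L^2(\mathbb C)}.$$ (ii) Let $\epsilon>0$ and let $W$ be a potential such that for every integer $k\ge 1$ there is a constant $C_k$ with $$\|\langle z\rangle^{2k}\,\partial_z^kW(t,\cdot)\|_{L^\infty(\mathbb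 C)}\le C_k\qquad\text{for all } t\in\mathbb R.$$ Then there is a constant $C>0$, depending only on $W$, $s$ and $\epsilon$, such that for every $\delta\in\mathbb R$, every solution $u$ with initial condition $u_0\in L^{2,s}_{\mathcal E}$ satisfies, for all $t\in\mathbb R$, $$\|\langle z\rangle^s u(t)\|_{L^2(\mathbb C)}\le C\,\langle t\rangle^{\epsilon}\,\|\langle z\rangle^s u_0\|_{L^2(\mathbb C)}.$$ -/

import Mathlib

open MeasureTheory Filter Topology
open scoped ENNReal NNReal ContDiff

noncomputable section

namespace LLL

/-- The Gaussian weight `exp (-|z|^2 / 2)`. -/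
def gauss (z : ℂ) : ℂ := (Real.exp (-‖z‖ ^ 2 / 2) : ℝ)

/-- The Japanese bracket `⟨z⟩ = (1 + |z|^2)^(1/2)`, for complex `z` and (below) for real `t`. -/
def bracket {E : Type*} [NormedAddCommGroup E] (z : E) : ℝ := Real.sqrt (1 + ‖z‖ ^ 2)

/-- The Bargmann-Fock space: the classes of `L^2(ℂ)` that are represented by
`f(z) exp (-|z|^2 / 2)` with `f` entire. -/
def fock : Submodule ℂ (Lp ℂ 2 (volume : Measure ℂ)) where
  carrier := {u | ∃ f : ℂ → ℂ, Differentiable ℂ f ∧ u =ᵐ[volume] fun z => f z * gauss z}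
  add_mem' := by
    rintro u v ⟨f, hf, hu⟩ ⟨g, hg, hv⟩
    refine ⟨fun z => f z + g z, hf.add hg, ?_⟩
    filter_upwards [hu, hv, Lp.coeFn_add u v] with z h1 h2 h3
    simp only [h3, Pi.add_apply, h1, h2]; ring
  zero_mem' := by
    refine ⟨fun _ => 0, differentiable_const 0, ?_⟩
    filter_upwards [Lp.coeFn_zero ℂ 2 (volume : Measure ℂ)] with z _
    simp
  smul_mem' := by
    rintro c u ⟨f, hf, hu⟩
    refine ⟨fun z => c * f z, hf.const_mul c, ?_⟩
    filter_upwards [hu, Lp.coeFn_smul c u] with z h1 h2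
    simp only [h2, Pi.smul_apply, h1, smul_eq_mul]; ring

/-! The Bargmann-Fock space is closed in `L^2(ℂ)`, so that the orthogonal projector exists. -/

lemma lintegral_circle_ge (h : ℂ → ℂ) (hh : Differentiable ℂ h) (r : ℝ) :
    ENNReal.ofReal (2 * Real.pi) * ‖h 0‖ₑ ≤
      ∫⁻ θ in Set.Ioo (-Real.pi) Real.pi, ‖h (Complex.polarCoord.symm (r, θ))‖ₑ := by
  have h1 : Real.circleAverage h 0 r = h 0 :=
    (hh.diffContOnCl (s := Metric.ball 0 |r|)).circleAverage
  have hper : Function.Periodic (fun θ : ℝ => h (circleMap 0 r θ)) (2 * Real.pi) :=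
    fun θ => by simp only [periodic_circleMap 0 r θ]
  have h2 : ∫ θ in Set.Ioo (-Real.pi) Real.pi, h (Complex.polarCoord.symm (r, θ))
      = (2 * Real.pi : ℝ) • h 0 := by
    have h3 := hper.intervalIntegral_add_eq (-Real.pi) 0
    rw [show -Real.pi + 2 * Real.pi = Real.pi by ring, zero_add] at h3
    rw [← h1, Real.circleAverage_def, smul_smul, mul_inv_cancel₀ (by positivity), one_smul, ← h3,
      intervalIntegral.integral_of_le (by linarith [Real.pi_pos]),
      ← integral_Ioc_eq_integral_Ioo]
    refine integral_congr_ae (Eventually.of_forall fun θ => ?_)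
    simp only [Complex.polarCoord_symm_apply, circleMap, zero_add]
    congr 1
    rw [Complex.exp_mul_I]
    push_cast
    ring
  calc _ = ‖(2 * Real.pi : ℝ) • h 0‖ₑ := by
        rw [enorm_smul, Real.enorm_of_nonneg (by positivity)]
    _ = _ := by rw [← h2]
    _ ≤ _ := enorm_integral_le_lintegral_enorm _

lemma lintegral_ball_ge (f : ℂ → ℂ) (hf : Differentiable ℂ f) (c : ℂ) :
    ‖f c‖ₑ ≤ ∫⁻ w in Metric.ball c 1, ‖f w‖ₑ := by
  set h : ℂ → ℂ := fun w => f (w + c) with hh_def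
  have hh : Differentiable ℂ h := by
    intro w; exact (hf _).comp w ((differentiable_id.add_const c) w)
  have e1 : ∫⁻ w in Metric.ball c 1, ‖f w‖ₑ = ∫⁻ w, (Metric.ball (0:ℂ) 1).indicator (fun w => ‖h w‖ₑ) w := by
    rw [← lintegral_indicator Metric.isOpen_ball.measurableSet,
      ← lintegral_add_right_eq_self _ c]
    refine lintegral_congr fun w => ?_
    simp [Set.indicator, hh_def, dist_eq_norm]
  have hmeas : Measurable fun p : ℝ × ℝ => ‖h (Complex.polarCoord.symm p)‖ₑ := by
    have : Continuous fun p : ℝ × ℝ => h (Complex.polarCoord.symm p) := by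
      simp only [Complex.polarCoord_symm_apply]
      exact hh.continuous.comp (by fun_prop)
    exact this.measurable.enorm
  have hC : ENNReal.ofReal 1 ≤ ENNReal.ofReal (2 * Real.pi) * ENNReal.ofReal (1 / 2) := by
    rw [← ENNReal.ofReal_mul (by positivity)]
    refine ENNReal.ofReal_le_ofReal ?_
    nlinarith [Real.pi_gt_three]
  have hI : ∫⁻ r in Set.Ioo (0:ℝ) 1, ENNReal.ofReal r = ENNReal.ofReal (1 / 2) := by
    rw [← ofReal_integral_eq_lintegral_ofReal]
    · rw [← integral_Ioc_eq_integral_Ioo, ← intervalIntegral.integral_of_le zero_le_one]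
      norm_num
    · exact (continuous_id.integrableOn_Icc (a := (0:ℝ)) (b := 1)).mono_set Set.Ioo_subset_Icc_self
    · exact (ae_restrict_mem measurableSet_Ioo).mono fun r hr => hr.1.le
  rw [e1, ← Complex.lintegral_comp_polarCoord_symm, polarCoord_target]
  calc ‖f c‖ₑ = ENNReal.ofReal 1 * ‖h 0‖ₑ := by simp [hh_def]
    _ ≤ (ENNReal.ofReal (2 * Real.pi) * ENNReal.ofReal (1 / 2)) * ‖h 0‖ₑ := by gcongr
    _ = ∫⁻ r in Set.Ioo (0:ℝ) 1, ENNReal.ofReal r * (ENNReal.ofReal (2 * Real.pi) * ‖h 0‖ₑ) := by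
        rw [lintegral_mul_const _ (by fun_prop), hI]; ring
    _ ≤ ∫⁻ r in Set.Ioo (0:ℝ) 1, ENNReal.ofReal r *
          ∫⁻ θ in Set.Ioo (-Real.pi) Real.pi, ‖h (Complex.polarCoord.symm (r, θ))‖ₑ := by
        gcongr with r
        exact lintegral_circle_ge h hh r
    _ = ∫⁻ p in Set.Ioo (0:ℝ) 1 ×ˢ Set.Ioo (-Real.pi) Real.pi,
          ENNReal.ofReal p.1 * ‖h (Complex.polarCoord.symm p)‖ₑ := by
        rw [Measure.volume_eq_prod, setLIntegral_prod _ (by fun_prop)]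
        refine lintegral_congr fun r => ?_
        exact (lintegral_const_mul _ (hmeas.comp (measurable_const.prodMk measurable_id))).symm
    _ ≤ _ := by
        have hs : MeasurableSet (Set.Ioo (0:ℝ) 1 ×ˢ Set.Ioo (-Real.pi) Real.pi) :=
          measurableSet_Ioo.prod measurableSet_Ioo
        refine le_trans (le_of_eq ?_) (lintegral_mono_set
          (Set.prod_mono_left (fun x (hx : x ∈ Set.Ioo (0:ℝ) 1) => (hx.1 : x ∈ Set.Ioi (0:ℝ)))))
        refine setLIntegral_congr_fun hs fun p hp => ?_
        have hb : Complex.polarCoord.symm p ∈ Metric.ball (0:ℂ) 1 := by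
          rw [mem_ball_zero_iff, Complex.norm_polarCoord_symm, abs_of_pos hp.1.1]
          exact hp.1.2
        simp only [Set.indicator_of_mem hb, smul_eq_mul]

lemma norm_gauss (z : ℂ) : ‖gauss z‖ = Real.exp (-‖z‖ ^ 2 / 2) := by
  rw [gauss, Complex.norm_real, Real.norm_of_nonneg (Real.exp_pos _).le]

lemma continuous_gauss : Continuous gauss := by
  unfold gauss; fun_prop

lemma enorm_le_of_entire (R : ℝ) : ∃ K : ℝ≥0, ∀ f : ℂ → ℂ, Differentiable ℂ f →
    ∀ z ∈ Metric.closedBall (0:ℂ) R,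
      ‖f z‖ₑ ≤ K * eLpNorm (fun w => f w * gauss w) 2 volume := by
  have hvol : volume (Metric.ball (0:ℂ) 1) ≠ ⊤ := measure_ball_lt_top.ne
  refine ⟨Real.toNNReal (Real.exp ((R + 1) ^ 2 / 2)) *
    (volume (Metric.ball (0:ℂ) 1) ^ (1 / 2 : ℝ)).toNNReal, fun f hf z hz => ?_⟩
  have hz' : ‖z‖ ≤ R := by simpa using hz
  have hR : 0 ≤ R := (norm_nonneg z).trans hz'
  have hm : AEStronglyMeasurable (fun w => f w * gauss w) (volume.restrict (Metric.ball z 1)) :=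
    (hf.continuous.mul continuous_gauss).aestronglyMeasurable
  calc ‖f z‖ₑ ≤ ∫⁻ w in Metric.ball z 1, ‖f w‖ₑ := lintegral_ball_ge f hf z
    _ ≤ ∫⁻ w in Metric.ball z 1,
          (Real.toNNReal (Real.exp ((R + 1) ^ 2 / 2)) : ℝ≥0∞) * ‖f w * gauss w‖ₑ := by
        refine setLIntegral_mono' Metric.isOpen_ball.measurableSet fun w hw => ?_
        have hw' : ‖w‖ ≤ R + 1 := by
          have : ‖w - z‖ < 1 := by simpa [dist_eq_norm] using hw
          have := norm_le_norm_add_norm_sub' w z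
          linarith
        have h1 : (1:ℝ) ≤ Real.exp ((R + 1) ^ 2 / 2) * ‖gauss w‖ := by
          rw [norm_gauss, ← Real.exp_add]
          refine Real.one_le_exp ?_
          nlinarith [norm_nonneg w]
        have h2 : ‖f w‖ ≤ Real.exp ((R + 1) ^ 2 / 2) * ‖f w * gauss w‖ := by
          rw [norm_mul]
          nlinarith [norm_nonneg (f w)]
        rw [← ofReal_norm, ← ofReal_norm, ← ENNReal.ofReal.eq_1,
          ← ENNReal.ofReal_mul (Real.exp_pos _).le]
        exact ENNReal.ofReal_le_ofReal h2
    _ = Real.toNNReal (Real.exp ((R + 1) ^ 2 / 2)) *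
          eLpNorm (fun w => f w * gauss w) 1 (volume.restrict (Metric.ball z 1)) := by
        rw [lintegral_const_mul' _ _ ENNReal.coe_ne_top, eLpNorm_one_eq_lintegral_enorm]
    _ ≤ Real.toNNReal (Real.exp ((R + 1) ^ 2 / 2)) *
          (eLpNorm (fun w => f w * gauss w) 2 volume *
            volume (Metric.ball (0:ℂ) 1) ^ (1 / 2 : ℝ)) := by
        refine mul_le_mul_right ((eLpNorm_le_eLpNorm_mul_rpow_measure_univ (p := 1) (q := 2)
          (by norm_num) hm).trans ?_) _
        rw [Measure.restrict_apply_univ, Measure.addHaar_ball_center,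
          show 1 / ENNReal.toReal 1 - 1 / ENNReal.toReal 2 = (1 / 2 : ℝ) by norm_num]
        exact mul_le_mul_left (eLpNorm_mono_measure _ Measure.restrict_le_self) _
    _ = _ := by
        push_cast
        rw [ENNReal.coe_toNNReal (ENNReal.rpow_ne_top_of_nonneg (by norm_num) hvol)]
        ring

lemma isClosed_fock : IsClosed (fock : Set (Lp ℂ 2 (volume : Measure ℂ))) := by
  refine IsSeqClosed.isClosed fun v u hv hu => ?_
  choose f hf hfv using hv
  have hC : CauchySeq v := hu.cauchySeq
  have hloc : ∀ R : ℝ, UniformCauchySeqOn f atTop (Metric.closedBall (0:ℂ) R) := by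
    intro R
    obtain ⟨K, hK⟩ := enorm_le_of_entire R
    rw [Metric.uniformCauchySeqOn_iff]
    intro ε hε
    obtain ⟨N, hN⟩ := Metric.cauchySeq_iff.1 hC (ε / (K + 1)) (by positivity)
    refine ⟨N, fun m hm n hn z hz => ?_⟩
    have h1 := hK (fun w => f m w - f n w) ((hf m).sub (hf n)) z hz
    have h2 : eLpNorm (fun w => (f m w - f n w) * gauss w) 2 volume = ‖v m - v n‖ₑ := by
      rw [Lp.enorm_def]
      refine eLpNorm_congr_ae ?_
      filter_upwards [hfv m, hfv n, Lp.coeFn_sub (v m) (v n)] with w a b c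
      simp only [c, Pi.sub_apply, a, b]; ring
    rw [h2] at h1
    have h3 : ‖f m z - f n z‖ ≤ K * ‖v m - v n‖ := by
      rw [← ofReal_norm, ← ofReal_norm, ← ENNReal.ofReal_coe_nnreal,
        ← ENNReal.ofReal_mul K.coe_nonneg] at h1
      exact (ENNReal.ofReal_le_ofReal_iff (by positivity)).1 h1
    have h4 := hN m hm n hn
    rw [dist_eq_norm] at h4 ⊢
    have h5 : (K : ℝ) * ‖v m - v n‖ ≤ K * (ε / (K + 1)) := by gcongr
    have h6 : (K : ℝ) * (ε / (K + 1)) < ε := by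
      rw [mul_div_assoc', div_lt_iff₀ (by positivity)]
      nlinarith [K.2]
    linarith
  have hpt : ∀ z, ∃ l, Tendsto (fun n => f n z) atTop (𝓝 l) := fun z =>
    cauchySeq_tendsto_of_complete ((hloc ‖z‖).cauchySeq (by simp))
  choose F hF using hpt
  have hFd : Differentiable ℂ F := by
    have hunif : TendstoLocallyUniformlyOn f F atTop Set.univ := by
      rw [tendstoLocallyUniformlyOn_univ]
      rw [tendstoLocallyUniformly_iff_forall_isCompact]
      intro s hs
      obtain ⟨R, hR⟩ := hs.isBounded.subset_closedBall (0:ℂ)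
      exact ((hloc R).tendstoUniformlyOn_of_tendsto fun z _ => hF z).mono hR
    exact differentiableOn_univ.1 (hunif.differentiableOn
      (Eventually.of_forall fun n => (hf n).differentiableOn) isOpen_univ)
  refine ⟨F, hFd, ?_⟩
  obtain ⟨ns, hns, hae⟩ :=
    (tendstoInMeasure_of_tendsto_Lp hu).exists_seq_tendsto_ae
  have hall : ∀ᵐ z, ∀ n, v n z = f n z * gauss z := ae_all_iff.2 hfv
  filter_upwards [hae, hall] with z h1 h2
  refine tendsto_nhds_unique h1 ?_
  simp only [h2]
  exact ((hF z).comp hns.tendsto_atTop).mul_const _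

instance : CompleteSpace fock := isClosed_fock.completeSpace_coe

/-- The orthogonal projector of `L^2(ℂ)` onto the Bargmann-Fock space, applied to a function `g`
that is square integrable (and `0` for other `g`, a case that does not occur below). -/
def proj (g : ℂ → ℂ) : Lp ℂ 2 (volume : Measure ℂ) :=
  open Classical in
  if h : MemLp g 2 (volume : Measure ℂ) then fock.starProjection h.toLp else 0

/-- `∂_z = (∂_x - i ∂_y) / 2` -/
def dz (f : ℂ → ℂ) (z : ℂ) : ℂ :=
  (1 / 2) * (fderiv ℝ f z 1 - Complex.I * fderiv ℝ f z Complex.I)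

/-- `∂_{\bar z} = (∂_x + i ∂_y) / 2` -/
def dzbar (f : ℂ → ℂ) (z : ℂ) : ℂ :=
  (1 / 2) * (fderiv ℝ f z 1 + Complex.I * fderiv ℝ f z Complex.I)

/-- `∂_z^j V` for a real-valued function `V`. -/
def dzIter (j : ℕ) (V : ℂ → ℝ) : ℂ → ℂ := dz^[j] fun z => (V z : ℂ)

/-- The harmonic oscillator `H = -4 ∂_z ∂_{\bar z} + |z|^2`, on smooth functions. -/
def harm (φ : ℂ → ℂ) (z : ℂ) : ℂ := -4 * dz (dzbar φ) z + (‖z‖ ^ 2 : ℝ) * φ z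

/-- The weighted norm `‖⟨z⟩^s u‖_{L^2(ℂ)}`, with value `∞` when `⟨z⟩^s u` is not in `L^2`. -/
def wnorm (s : ℝ) (u : Lp ℂ 2 (volume : Measure ℂ)) : ℝ≥0∞ :=
  eLpNorm (fun z => ((bracket z ^ s : ℝ) : ℂ) * u z) 2 volume

/-- The potentials: bounded real-valued functions of `(t, z)`, continuous in `t` and smooth in
`z = x + i y` in the real sense. -/
structure IsPotential (W : ℝ → ℂ → ℝ) : Prop where
  bounded : ∃ M : ℝ, ∀ t z, |W t z| ≤ M
  continuous_time : ∀ z, Continuous fun t => W t z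
  smooth_space : ∀ t, ContDiff ℝ ∞ (W t)

/-- `u ∈ C(ℝ, fock)` solves `i ∂_t u - δ H u = Π (W(t, z) u)`, `u(0) = u₀`. The term `H u` is
taken in the sense of distributions: `⟨H u, φ⟩ = ∫ u H φ` for test functions `φ ∈ C_c^∞(ℂ)`. -/
structure IsSolution (δ : ℝ) (W : ℝ → ℂ → ℝ) (u₀ : fock) (u : ℝ → fock) : Prop where
  continuous : Continuous u
  initial : u 0 = u₀
  equation : ∀ φ : ℂ → ℂ, ContDiff ℝ ∞ φ → HasCompactSupport φ → ∀ t : ℝ,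
    HasDerivAt (fun τ : ℝ => ∫ z, (u τ : Lp ℂ 2 (volume : Measure ℂ)) z * φ z)
      (-Complex.I *
        (δ * (∫ z, (u t : Lp ℂ 2 (volume : Measure ℂ)) z * harm φ z)
          + ∫ z, proj (fun w => (W t w : ℂ) * (u t : Lp ℂ 2 (volume : Measure ℂ)) w) z * φ z)) t

/-- The product `W(t, ·) u` to which the projector is applied is in `L^2`. -/
lemma IsPotential.memLp {W : ℝ → ℂ → ℝ} (hW : IsPotential W) (t : ℝ)
    (u : Lp ℂ 2 (volume : Measure ℂ)) : MemLp (fun w => (W t w : ℂ) * u w) 2 volume := by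
  obtain ⟨M, hM⟩ := hW.bounded
  refine (Lp.memLp u).of_le_mul (c := M) ?_ (Eventually.of_forall fun w => ?_)
  · exact (Complex.continuous_ofReal.comp
      (hW.smooth_space t).continuous).aestronglyMeasurable.mul (Lp.aestronglyMeasurable u)
  · rw [norm_mul, Complex.norm_real, Real.norm_eq_abs]
    gcongr
    exact hM t w

end LLL

end

noncomputable section

namespace LLL

open ComplexConjugate

/-! ### Wirtinger derivatives -/

/-! The problem becomes one about sequences. The functions $e_n=(\pi n!)^{-1/2}z^ne^{-|z|^2/2}$ form
an orthonormal basis of the Bargmann–Fock space (`fockBasis`). Rotation invariance makes both $H$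
and every radial weight diagonal in it. Hence $\|\langle z\rangle^su\|^2$ is comparable to
$\sum_n(n+1)^s|u_n|^2$ (`exists_wgt_le`, `rpow_le_mul_wgt`), and the coefficients of a solution
satisfy $iu_n'=\delta\kappa_nu_n+(Tu)_n$ with $\kappa_n$ real and $T=\Pi W\Pi$ bounded and
self-adjoint (`exists_hasDerivAt_coef`). The term in $\delta$ drops out of every
$\frac{d}{dt}|u_n|^2$, which is why all bounds are uniform in $\delta$.

Let $a_n=(n+1)\cdots(n+k)$, which is comparable to $(n+1)^k$, and suppose that the commutator of $T$
with $\mathrm{diag}(a_n)$ is bounded by $K$ as a form (`CommBound`). For the bounded weights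
$a_n/(a_n+\mu)$ the energy $\sum_n\frac{a_n}{a_n+\mu}|u_n|^2$ then has derivative at most
$2(K/\mu)\|u_0\|^2$, and it never exceeds $\|u_0\|^2$ (`tsum_resolvent_le`). Integrating against
$\mu^{\theta-1}d\mu$ turns this into growth of order $(K|t|)^\theta$ for $\sum_na_n^\theta|u_n|^2$
(`tsum_rpow_coef_le`). With $\theta=s/k\le1$ the weighted norm itself grows at most like
$(K|t|)^{s/(2k)}$.

For (i), $k=\lceil s\rceil$ gives an exponent at most $1/2$. The commutator bound comes from $k$
integrations by parts: $a_n\langle e_m,Te_n\rangle$ becomes a combination of integrals of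
$\partial_z^jW\,\bar z^{k-j}z^k$; the term $j=0$ contributes a real quantity to the quadratic form,
and the terms $j\ge1$ are bounded by hypothesis (`commBound_ascFactorial`).

For (ii), $k$ is taken so large that $s/(2k)\le\epsilon$. The hypotheses do not bound
$z^{2k-j}\partial_z^jW$ for $j<k$, so the commutator is estimated through its matrix. The entries of
$\partial_z^jW$ decay like $n^{-j}$, and undoing one derivative costs only half a power above the
diagonal (`norm_mat_le_of_dz`). The off-diagonal entries of $T$ therefore decay faster than any
power, and every polynomial weight has a bounded commutator with $T$ (`exists_commBound_of_decay`).
-/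

/-- `f` is real-differentiable at `z` with `∂_z f = a` and `∂_{\bar z} f = b`. -/
def HasWirt (f : ℂ → ℂ) (a b z : ℂ) : Prop :=
  HasFDerivAt f (a • (1 : ℂ →L[ℝ] ℂ) + b • (Complex.conjCLE : ℂ →L[ℝ] ℂ)) z

lemma HasWirt.dz {f : ℂ → ℂ} {a b z : ℂ} (h : HasWirt f a b z) : dz f z = a := by
  unfold LLL.dz
  rw [HasFDerivAt.fderiv h]
  simp
  linear_combination (-(1/2) * a + 1/2 * b) * Complex.I_sq

lemma HasWirt.dzbar {f : ℂ → ℂ} {a b z : ℂ} (h : HasWirt f a b z) : dzbar f z = b := by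
  unfold LLL.dzbar
  rw [HasFDerivAt.fderiv h]
  simp
  linear_combination ((1/2) * a - 1/2 * b) * Complex.I_sq

lemma hasWirt_of_differentiableAt {f : ℂ → ℂ} {z : ℂ} (h : DifferentiableAt ℝ f z) :
    HasWirt f (dz f z) (dzbar f z) z := by
  unfold HasWirt
  convert h.hasFDerivAt using 1
  ext v
  have hv : fderiv ℝ f z v = v.re * fderiv ℝ f z 1 + v.im * fderiv ℝ f z Complex.I := by
    conv_lhs => rw [show v = v.re • (1 : ℂ) + v.im • Complex.I by
      simp [Complex.re_add_im]]
    rw [map_add, map_smul, map_smul]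
    simp
  have hc : v = v.re + v.im * Complex.I := (Complex.re_add_im v).symm
  have hc' : conj v = v.re - v.im * Complex.I := by
    apply Complex.ext <;> simp
  rw [hv]
  change (1 / 2) * (fderiv ℝ f z 1 - Complex.I * fderiv ℝ f z Complex.I) * v +
    (1 / 2) * (fderiv ℝ f z 1 + Complex.I * fderiv ℝ f z Complex.I) * conj v = _
  rw [hc']
  linear_combination (1 / 2) * (fderiv ℝ f z 1 - Complex.I * fderiv ℝ f z Complex.I) * hc
    - (v.im : ℂ) * (fderiv ℝ f z) Complex.I * Complex.I_sq

lemma HasWirt.mul {f g : ℂ → ℂ} {a b c d z : ℂ} (hf : HasWirt f a b z) (hg : HasWirt g c d z) :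
    HasWirt (fun w => f w * g w) (a * g z + f z * c) (b * g z + f z * d) z := by
  refine (HasFDerivAt.mul hf hg).congr_fderiv ?_
  ext v
  simp
  ring

lemma HasWirt.add {f g : ℂ → ℂ} {a b c d z : ℂ} (hf : HasWirt f a b z) (hg : HasWirt g c d z) :
    HasWirt (fun w => f w + g w) (a + c) (b + d) z := by
  refine (HasFDerivAt.add hf hg).congr_fderiv ?_
  ext v
  simp
  ring

lemma hasWirt_const (c z : ℂ) : HasWirt (fun _ => c) 0 0 z := by
  refine (hasFDerivAt_const (𝕜 := ℝ) c z).congr_fderiv ?_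
  ext v
  simp

lemma hasWirt_id (z : ℂ) : HasWirt (fun w => w) 1 0 z := by
  refine (hasFDerivAt_id (𝕜 := ℝ) z).congr_fderiv ?_
  ext v
  simp

lemma hasWirt_conj (z : ℂ) : HasWirt (fun w => conj w) 0 1 z := by
  refine ((Complex.conjCLE : ℂ →L[ℝ] ℂ).hasFDerivAt).congr_fderiv ?_
  ext v
  simp

lemma HasWirt.comp {f F : ℂ → ℂ} {a b F' z : ℂ} (hf : HasWirt f a b z)
    (hF : HasDerivAt F F' (f z)) : HasWirt (fun w => F (f w)) (F' * a) (F' * b) z := by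
  refine ((hF.complexToReal_fderiv).comp z hf).congr_fderiv ?_
  ext v
  simp
  ring

lemma HasWirt.pow {f : ℂ → ℂ} {a b z : ℂ} (hf : HasWirt f a b z) (n : ℕ) :
    HasWirt (fun w => f w ^ n) (n * f z ^ (n - 1) * a) (n * f z ^ (n - 1) * b) z :=
  hf.comp (F := fun w => w ^ n) (hasDerivAt_pow n (f z))

/-- Chain rule for $|z|^2=z\bar z$, whose Wirtinger derivatives are $\bar z$ and $z$. -/
lemma hasWirt_of_hasDerivAt_radial {h : ℝ → ℝ} {h' : ℝ} {z : ℂ}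
    (hh : HasDerivAt h h' (‖z‖ ^ 2)) :
    HasWirt (fun w => ((h (‖w‖ ^ 2) : ℝ) : ℂ)) (h' * conj z) (h' * z) z := by
  have h1 : HasFDerivAt (fun w : ℂ => ‖w‖ ^ 2) (2 • innerSL ℝ z) z :=
    (hasStrictFDerivAt_norm_sq z).hasFDerivAt
  have h2 := (hh.comp_hasFDerivAt z h1)
  have h3 := (Complex.ofRealCLM.hasFDerivAt).comp z h2
  unfold HasWirt
  refine HasFDerivAt.congr_fderiv h3 ?_
  ext v
  apply Complex.ext
  · simp
    ring
  · simp
    ring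

/-! ### Smooth functions -/

lemma contDiff_dz {f : ℂ → ℂ} (hf : ContDiff ℝ ∞ f) : ContDiff ℝ ∞ (dz f) := by
  have h : ContDiff ℝ ∞ (fderiv ℝ f) := hf.fderiv_right (by simp)
  unfold dz
  fun_prop

lemma contDiff_dzIter {V : ℂ → ℝ} (hV : ContDiff ℝ ∞ V) (j : ℕ) : ContDiff ℝ ∞ (dzIter j V) := by
  unfold dzIter
  induction j with
  | zero => exact Complex.ofRealCLM.contDiff.comp hV
  | succ j ih => rw [Function.iterate_succ_apply']; exact contDiff_dz ih

lemma dzIter_succ (V : ℂ → ℝ) (j : ℕ) : dzIter (j + 1) V = dz (dzIter j V) := by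
  unfold dzIter; rw [Function.iterate_succ_apply']

lemma dzIter_zero (V : ℂ → ℝ) : dzIter 0 V = fun z => (V z : ℂ) := rfl

lemma contDiff_hasWirt {f : ℂ → ℂ} (hf : ContDiff ℝ ∞ f) (z : ℂ) :
    HasWirt f (dz f z) (dzbar f z) z :=
  hasWirt_of_differentiableAt (hf.differentiable (by simp) z)

/-! ### Integration by parts -/

lemma integral_dz_eq_zero_of_hasCompactSupport {g : ℂ → ℂ} (hg : ContDiff ℝ ∞ g)
    (hc : HasCompactSupport g) : ∫ z, dz g z = 0 := by
  have hd : Continuous (fderiv ℝ g) := (hg.continuous_fderiv (by simp))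
  have hi (v : ℂ) : Integrable (fun z => fderiv ℝ g z v) :=
    (hd.clm_apply continuous_const).integrable_of_hasCompactSupport (hc.fderiv_apply ℝ v)
  have h0 (v : ℂ) : ∫ z, fderiv ℝ g z v = 0 := by
    -- Integration by parts against the constant function $1$.
    have h := integral_mul_fderiv_eq_neg_fderiv_mul_of_integrable (𝕜 := ℂ) (μ := volume)
      (f := fun _ : ℂ => (1:ℂ)) (g := g) (v := v) (by simp) (by simpa using hi v)
      (by simpa using hg.continuous.integrable_of_hasCompactSupport hc)
      (fun _ _ => differentiableAt_const _) (fun x _ => hg.differentiable (by simp) x)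
    simpa using h
  unfold dz
  rw [integral_const_mul, integral_sub (hi 1) ((hi Complex.I).const_mul _), integral_const_mul,
    h0, h0]
  simp

/-- A smooth cutoff, equal to `1` near the origin. -/
def bump : ContDiffBump (0 : ℂ) := ⟨1, 2, by norm_num, by norm_num⟩

lemma contDiff_bump : ContDiff ℝ ∞ (bump : ℂ → ℝ) := bump.contDiff

lemma exists_norm_dz_bump_le : ∃ C : ℝ, ∀ z, ‖dz (fun w => (bump w : ℂ)) z‖ ≤ C := by
  have h1 : ContDiff ℝ ∞ (fun w => (bump w : ℂ)) := Complex.ofRealCLM.contDiff.comp contDiff_bump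
  have h2 : HasCompactSupport (fun w => (bump w : ℂ)) :=
    bump.hasCompactSupport.comp_left (g := fun x : ℝ => (x : ℂ)) (by simp)
  have h3 : HasCompactSupport (dz (fun w => (bump w : ℂ))) := by
    have := h2.fderiv (𝕜 := ℝ)
    exact this.comp_left (g := fun L : ℂ →L[ℝ] ℂ => (1 / 2) * (L 1 - Complex.I * L Complex.I))
      (by simp)
  exact h3.exists_bound_of_continuous (contDiff_dz h1).continuous

/-- Integration by parts: `∫ ∂_z g = 0` as soon as both `g` and `∂_z g` are integrable. -/
lemma integral_dz_eq_zero {g : ℂ → ℂ} (hg : ContDiff ℝ ∞ g) (hi : Integrable g)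
    (hi' : Integrable (dz g)) : ∫ z, dz g z = 0 := by
  obtain ⟨C, hC⟩ := exists_norm_dz_bump_le
  have hb : ContDiff ℝ ∞ (fun w => (bump w : ℂ)) := Complex.ofRealCLM.contDiff.comp contDiff_bump
  -- The cutoff is dilated to scale $N+1$. Its derivative then carries a factor $r_N\to0$, so the
  -- commutator term is dominated by a multiple of $|g|$ and vanishes in the limit.
  set r : ℕ → ℝ := fun N => 1 / ((N : ℝ) + 1) with hr
  have hr0 : Tendsto r atTop (𝓝 0) := tendsto_one_div_add_atTop_nhds_zero_nat
  have hrpos (N) : 0 < r N := by simp only [hr]; positivity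
  set χ : ℕ → ℂ → ℂ := fun N z => (bump (r N * z) : ℂ) with hχ
  have hχs (N) : ContDiff ℝ ∞ (χ N) :=
    hb.comp (contDiff_const.mul contDiff_id)
  have hχw (N z) : HasWirt (χ N) (dz (fun w => (bump w : ℂ)) (r N * z) * r N)
      (dzbar (fun w => (bump w : ℂ)) (r N * z) * r N) z := by
    have h1 := contDiff_hasWirt hb (r N * z)
    have h2 : HasFDerivAt (fun w : ℂ => (r N : ℂ) * w) ((r N : ℂ) • (1 : ℂ →L[ℝ] ℂ)) z := by
      exact (hasFDerivAt_id (𝕜 := ℝ) z).const_mul (r N : ℂ)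
    have h3 := HasFDerivAt.comp z h1 h2
    refine HasFDerivAt.congr_fderiv h3 ?_
    ext v
    simp
    ring
  have hprod (N z) : dz (fun w => χ N w * g w) z
      = dz (fun w => (bump w : ℂ)) (r N * z) * r N * g z + χ N z * dz g z :=
    ((hχw N z).mul (contDiff_hasWirt hg z)).dz
  have hzero (N) : ∫ z, dz (fun w => χ N w * g w) z = 0 := by
    refine integral_dz_eq_zero_of_hasCompactSupport ((hχs N).mul hg) ?_
    refine HasCompactSupport.mul_right ?_
    have h1 : HasCompactSupport (fun w => (bump w : ℂ)) :=
      bump.hasCompactSupport.comp_left (g := fun x : ℝ => (x : ℂ)) (by simp)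
    exact h1.comp_homeomorph (Homeomorph.mulLeft₀ (r N : ℂ) (by exact_mod_cast (hrpos N).ne'))
  have hlim : Tendsto (fun N => ∫ z, dz (fun w => χ N w * g w) z) atTop (𝓝 (∫ z, dz g z)) := by
    refine tendsto_integral_of_dominated_convergence (fun z => |C| * ‖g z‖ + ‖dz g z‖) ?_ ?_ ?_ ?_
    · exact fun N => (contDiff_dz ((hχs N).mul hg)).continuous.aestronglyMeasurable
    · exact (hi.norm.const_mul _).add hi'.norm
    · refine fun N => Eventually.of_forall fun z => ?_
      rw [hprod]
      refine (norm_add_le _ _).trans (add_le_add ?_ ?_)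
      · rw [norm_mul, norm_mul, Complex.norm_real, Real.norm_of_nonneg (hrpos N).le]
        have h1 : r N ≤ 1 := by
          simp only [hr]; rw [div_le_one (by positivity)]; linarith [N.cast_nonneg (α := ℝ)]
        have h2 := (hC (r N * z)).trans (le_abs_self C)
        gcongr
        calc _ ≤ |C| * 1 := by gcongr
          _ = _ := mul_one _
      · rw [norm_mul, Complex.norm_real, Real.norm_of_nonneg bump.nonneg]
        exact mul_le_of_le_one_left (norm_nonneg _) bump.le_one
    · refine Eventually.of_forall fun z => ?_
      simp only [hprod]
      have h1 : Tendsto (fun N => (r N : ℂ)) atTop (𝓝 0) := by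
        have := (Complex.continuous_ofReal.tendsto 0).comp hr0
        rwa [Complex.ofReal_zero] at this
      have h1' : Tendsto (fun N => (r N : ℂ) * z) atTop (𝓝 0) := by simpa using h1.mul_const z
      have h2 : Tendsto (fun N => χ N z) atTop (𝓝 1) := by
        have := (hb.continuous.tendsto 0).comp h1'
        have h0 : bump (0 : ℂ) = 1 := bump.one_of_mem_closedBall (by simp [bump])
        simp only [h0, Complex.ofReal_one] at this
        exact this
      have h3 : Tendsto (fun N => dz (fun w => (bump w : ℂ)) (r N * z)) atTop
          (𝓝 (dz (fun w => (bump w : ℂ)) 0)) :=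
        ((contDiff_dz hb).continuous.tendsto 0).comp h1'
      simpa using ((h3.mul h1).mul_const (g z)).add (h2.mul_const (dz g z))
  simp only [hzero] at hlim
  exact (tendsto_nhds_unique hlim tendsto_const_nhds)

/-! ### Gaussian moments -/

/-- The squared weight `exp (-|z|^2)`. -/
def gw (z : ℂ) : ℝ := Real.exp (-‖z‖ ^ 2)

lemma gw_pos (z : ℂ) : 0 < gw z := Real.exp_pos _

lemma continuous_gw : Continuous gw := by unfold gw; fun_prop

lemma norm_gauss_sq (z : ℂ) : ‖gauss z‖ ^ 2 = gw z := by
  rw [norm_gauss, gw, ← Real.exp_nat_mul]; congr 1; push_cast; ring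

lemma gauss_mul_gauss (z : ℂ) : gauss z * gauss z = gw z := by
  unfold gauss gw
  rw [← Complex.ofReal_mul, ← Real.exp_add]; congr 2; ring

lemma contDiff_gw : ContDiff ℝ ∞ fun z => (gw z : ℂ) := by
  unfold gw
  have : ContDiff ℝ ∞ fun z : ℂ => ‖z‖ ^ 2 := contDiff_norm_sq ℝ
  exact Complex.ofRealCLM.contDiff.comp (Real.contDiff_exp.comp this.neg)

lemma hasWirt_gw (z : ℂ) : HasWirt (fun w => (gw w : ℂ)) (-gw z * conj z) (-gw z * z) z := by
  have h : HasDerivAt (fun x : ℝ => Real.exp (-x)) (-gw z) (‖z‖ ^ 2) := by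
    simpa [gw] using (hasDerivAt_neg (‖z‖ ^ 2)).exp
  have h2 := hasWirt_of_hasDerivAt_radial h
  rwa [Complex.ofReal_neg] at h2

lemma integral_pow_mul_gw' (p : ℕ) :
    ∫ z : ℂ, ‖z‖ ^ p * gw z = Real.pi * Real.Gamma ((p : ℝ) / 2 + 1) := by
  have h := Complex.integral_rpow_mul_exp_neg_mul_rpow (p := 2) (q := p) (b := 1) (by norm_num)
    (by have := p.cast_nonneg (α := ℝ); linarith) one_pos
  simp only [Real.one_rpow, Real.rpow_natCast, Real.rpow_ofNat] at h
  unfold gw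
  rw [show (p : ℝ) / 2 + 1 = (p + 2) / 2 by ring]
  simpa using h

lemma integrable_pow_mul_gw (p : ℕ) : Integrable fun z : ℂ => ‖z‖ ^ p * gw z := by
  -- A non-integrable function has integral $0$ by convention, so the explicit positive value of the
  -- integral already gives integrability.
  refine Integrable.of_integral_ne_zero ?_
  rw [integral_pow_mul_gw']
  have := Real.Gamma_pos_of_pos (show (0:ℝ) < p / 2 + 1 by positivity)
  positivity

lemma integral_pow_mul_gw (q : ℕ) :
    ∫ z : ℂ, ‖z‖ ^ (2 * q) * gw z = Real.pi * q.factorial := by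
  rw [integral_pow_mul_gw', ← Real.Gamma_nat_eq_factorial]; push_cast; congr 2; ring

/-- The monomial moments `∫ V \bar z^m z^n exp(-|z|^2)`. -/
def mom (V : ℂ → ℂ) (m n : ℕ) : ℂ := ∫ z, V z * (conj z ^ m * z ^ n * gw z)

lemma integrable_mom {V : ℂ → ℂ} (hV : Continuous V) {M : ℝ} (hM : ∀ z, ‖V z‖ ≤ M) (m n : ℕ) :
    Integrable fun z => V z * (conj z ^ m * z ^ n * gw z) := by
  refine ((integrable_pow_mul_gw (m + n)).const_mul M).mono' ?_ (Eventually.of_forall fun z => ?_)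
  · have h2 : Continuous fun z => (gw z : ℂ) := Complex.continuous_ofReal.comp continuous_gw
    have h1 : Continuous fun z : ℂ => conj z := Complex.continuous_conj
    exact (hV.mul (((h1.pow m).mul (continuous_id.pow n)).mul h2)).aestronglyMeasurable
  · simp only [norm_mul, norm_pow, RCLike.norm_conj, Complex.norm_real,
      Real.norm_of_nonneg (gw_pos z).le, ← pow_add]
    exact mul_le_mul_of_nonneg_right (hM z) (mul_nonneg (by positivity) (gw_pos z).le)

/-- The basic recursion: integration by parts in `∂_z`. -/
lemma mom_dz {V : ℂ → ℂ} (hV : ContDiff ℝ ∞ V) {M M' : ℝ} (hM : ∀ z, ‖V z‖ ≤ M)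
    (hM' : ∀ z, ‖dz V z‖ ≤ M') (m n : ℕ) :
    mom (dz V) m n + n * mom V m (n - 1) = mom V (m + 1) n := by
  have hc : ContDiff ℝ ∞ fun z : ℂ => conj z := Complex.conjCLE.contDiff
  have hs : ContDiff ℝ ∞ fun z : ℂ => V z * (conj z ^ m * z ^ n * gw z) :=
    hV.mul (((hc.pow m).mul (contDiff_id.pow n)).mul contDiff_gw)
  have hw (z : ℂ) : dz (fun z : ℂ => V z * (conj z ^ m * z ^ n * gw z)) z
      = dz V z * (conj z ^ m * z ^ n * gw z) + n * (V z * (conj z ^ m * z ^ (n - 1) * gw z))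
        - V z * (conj z ^ (m + 1) * z ^ n * gw z) := by
    rw [((contDiff_hasWirt hV z).mul
      ((((hasWirt_conj z).pow m).mul ((hasWirt_id z).pow n)).mul (hasWirt_gw z))).dz]
    simp only [mul_zero, zero_mul, zero_add, mul_one]
    ring
  have i1 := integrable_mom (contDiff_dz hV).continuous hM' m n
  have i2 := (integrable_mom hV.continuous hM m (n - 1)).const_mul (n : ℂ)
  have i3 := integrable_mom hV.continuous hM (m + 1) n
  have h0 := integral_dz_eq_zero hs (integrable_mom hV.continuous hM m n)
    (by
      rw [show dz (fun z : ℂ => V z * (conj z ^ m * z ^ n * gw z)) = _ from funext hw]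
      exact (i1.add i2).sub i3)
  simp only [hw] at h0
  rw [integral_sub (by exact i1.add i2) i3, integral_add i1 i2, integral_const_mul] at h0
  exact sub_eq_zero.1 h0

/-! ### Radial weights -/

/-- The rotation by the angle $\pi/(n-m)$ preserves the measure and the radial factor but multiplies
$\bar z^mz^n$ by $-1$, so the integral equals its own opposite. No integrability is needed. -/
lemma integral_radial_mul_monomial_eq_zero (ρ : ℝ → ℝ) {m n : ℕ} (hmn : m ≠ n) :
    ∫ z : ℂ, (ρ ‖z‖ : ℂ) * (conj z ^ m * z ^ n) = 0 := by
  set α : ℝ := Real.pi / ((n : ℝ) - m) with hα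
  have hne : ((n : ℝ) - m) ≠ 0 := sub_ne_zero.2 (by exact_mod_cast hmn.symm)
  set c : Circle := Circle.exp α with hc
  have h1 : (conj (c : ℂ)) ^ m * (c : ℂ) ^ n = -1 := by
    rw [hc, Circle.coe_exp, ← Complex.exp_conj, ← Complex.exp_nat_mul, ← Complex.exp_nat_mul,
      ← Complex.exp_add, ← Complex.exp_pi_mul_I]
    congr 1
    simp only [map_mul, Complex.conj_ofReal, Complex.conj_I]
    have : ((n : ℂ) - m) * (α : ℂ) = Real.pi := by
      rw [hα]; push_cast
      have : ((n : ℂ) - m) ≠ 0 := by exact_mod_cast hne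
      field_simp
    linear_combination Complex.I * this
  have h2 := ((rotation c).measurePreserving).integral_comp
    (rotation c).toHomeomorph.measurableEmbedding
    (fun z : ℂ => (ρ ‖z‖ : ℂ) * (conj z ^ m * z ^ n))
  have h3 : ∀ z : ℂ, (ρ ‖rotation c z‖ : ℂ) * (conj (rotation c z) ^ m * (rotation c z) ^ n)
      = -((ρ ‖z‖ : ℂ) * (conj z ^ m * z ^ n)) := by
    intro z
    rw [LinearIsometryEquiv.norm_map, rotation_apply, map_mul, mul_pow, mul_pow]
    linear_combination (ρ ‖z‖ : ℂ) * (conj z ^ m * z ^ n) * h1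
  simp only [h3] at h2
  rw [integral_neg] at h2
  linear_combination (-1 / 2 : ℂ) * h2

lemma conj_pow_mul_pow_self (z : ℂ) (n : ℕ) : conj z ^ n * z ^ n = ((‖z‖ ^ (2 * n) : ℝ) : ℂ) := by
  rw [← mul_pow, mul_comm, Complex.mul_conj, Complex.normSq_eq_norm_sq, pow_mul]; push_cast; rfl

lemma integrable_of_bound_of_eq_zero {g : ℂ → ℂ} (hg : AEStronglyMeasurable g volume) {B R : ℝ}
    (hB : ∀ z, ‖g z‖ ≤ B) (h0 : ∀ z, R ≤ ‖z‖ → g z = 0) : Integrable g := by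
  have h : Integrable ((Metric.ball (0 : ℂ) R).indicator fun _ => B) :=
    (integrable_indicator_iff Metric.isOpen_ball.measurableSet).2
      (integrableOn_const (by exact measure_ball_lt_top.ne))
  refine h.mono' hg (Eventually.of_forall fun z => ?_)
  by_cases hz : z ∈ Metric.ball (0 : ℂ) R
  · rw [Set.indicator_of_mem hz]; exact hB z
  · rw [Set.indicator_of_notMem hz, h0 z (by simpa using hz), norm_zero]

/-! ### Taylor expansions and radial integrals -/

/-- The Taylor coefficients at the origin. -/
def tc (f : ℂ → ℂ) (n : ℕ) : ℂ := (n.factorial : ℂ)⁻¹ * iteratedDeriv n f 0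

lemma hasSum_tc {f : ℂ → ℂ} (hf : Differentiable ℂ f) (z : ℂ) :
    HasSum (fun n => tc f n * z ^ n) (f z) := by
  have h := Complex.hasSum_taylorSeries_of_entire hf 0 z
  have h2 : (fun n => tc f n * z ^ n)
      = fun n : ℕ => (n.factorial : ℂ)⁻¹ • (z - 0) ^ n • iteratedDeriv n f 0 := by
    funext n
    simp only [tc, sub_zero, smul_eq_mul]
    ring
  rwa [h2]

lemma norm_partial_le {f : ℂ → ℂ} (hf : Differentiable ℂ f) {R : ℝ} (hR : 0 ≤ R) :
    ∃ S, 0 ≤ S ∧ ∀ N : ℕ, ∀ z : ℂ, ‖z‖ ≤ R → ‖∑ n ∈ Finset.range N, tc f n * z ^ n‖ ≤ S := by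
  have h : Summable fun n => ‖tc f n * (R : ℂ) ^ n‖ := (hasSum_tc hf R).summable.norm
  refine ⟨∑' n, ‖tc f n * (R : ℂ) ^ n‖, tsum_nonneg fun _ => norm_nonneg _, fun N z hz => ?_⟩
  refine (norm_sum_le _ _).trans (le_trans (Finset.sum_le_sum fun n _ => ?_)
    (h.sum_le_tsum _ (fun _ _ => norm_nonneg _)))
  rw [norm_mul, norm_mul, norm_pow, norm_pow, Complex.norm_real, Real.norm_of_nonneg hR]
  gcongr

/-- Pairing an entire function with a radial multiple of `\bar z^n` isolates the `n`-th
Taylor coefficient. -/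
lemma integral_radial_conj_pow_mul {f : ℂ → ℂ} (hf : Differentiable ℂ f) {ρ : ℝ → ℝ}
    (hρ : Measurable ρ) {B R : ℝ} (hB : ∀ r, |ρ r| ≤ B) (h0 : ∀ r, R ≤ r → ρ r = 0) (n : ℕ) :
    ∫ z : ℂ, (ρ ‖z‖ : ℂ) * (conj z ^ n * f z)
      = tc f n * ((∫ z : ℂ, ρ ‖z‖ * ‖z‖ ^ (2 * n) : ℝ) : ℂ) := by
  wlog hR : 0 ≤ R generalizing R
  · exact this (R := |R|) (fun r hr => h0 r ((le_abs_self R).trans hr)) (abs_nonneg R)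
  have hB0 : 0 ≤ B := (abs_nonneg _).trans (hB 0)
  have hm : Measurable fun z : ℂ => (ρ ‖z‖ : ℂ) :=
    Complex.measurable_ofReal.comp (hρ.comp measurable_norm)
  have hcm : Measurable fun z : ℂ => conj z := Complex.continuous_conj.measurable
  obtain ⟨S, hS0, hS⟩ := norm_partial_le hf hR
  have hi (j : ℕ) : Integrable fun z : ℂ => (ρ ‖z‖ : ℂ) * (conj z ^ n * z ^ j) := by
    refine integrable_of_bound_of_eq_zero (B := B * (R ^ n * R ^ j)) (R := R)
      (hm.mul ((hcm.pow_const n).mul (measurable_id.pow_const j))).aestronglyMeasurable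
      (fun z => ?_) (fun z hz => by simp [h0 _ hz])
    by_cases hz : R ≤ ‖z‖
    · simp only [h0 _ hz, Complex.ofReal_zero, zero_mul, norm_zero]; positivity
    · rw [norm_mul, Complex.norm_real, norm_mul, norm_pow, norm_pow, RCLike.norm_conj]
      push Not at hz
      have := hB ‖z‖
      gcongr
      exact this
  have hlim : Tendsto (fun N => ∫ z : ℂ, (ρ ‖z‖ : ℂ) *
      (conj z ^ n * ∑ j ∈ Finset.range N, tc f j * z ^ j)) atTop
      (𝓝 (∫ z : ℂ, (ρ ‖z‖ : ℂ) * (conj z ^ n * f z))) := by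
    refine tendsto_integral_of_dominated_convergence
      ((Metric.ball (0 : ℂ) R).indicator fun _ => B * (R ^ n * S)) ?_ ?_ ?_ ?_
    · intro N
      refine (hm.mul ((hcm.pow_const n).mul ?_)).aestronglyMeasurable
      fun_prop
    · exact (integrable_indicator_iff Metric.isOpen_ball.measurableSet).2
        (integrableOn_const (by exact measure_ball_lt_top.ne))
    · refine fun N => Eventually.of_forall fun z => ?_
      by_cases hz : z ∈ Metric.ball (0 : ℂ) R
      · rw [Set.indicator_of_mem hz, norm_mul, Complex.norm_real, norm_mul, norm_pow,
          RCLike.norm_conj]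
        have hz' : ‖z‖ ≤ R := by simpa using (Metric.mem_ball.1 hz).le
        have := hB ‖z‖
        have := hS N z hz'
        gcongr
        assumption
      · rw [Set.indicator_of_notMem hz, h0 _ (by simpa using hz)]; simp
    · refine Eventually.of_forall fun z => ?_
      exact ((hasSum_tc hf z).tendsto_sum_nat.const_mul _).const_mul _
  refine tendsto_nhds_unique hlim (tendsto_const_nhds.congr' ?_)
  filter_upwards [eventually_gt_atTop n] with N hN
  have h1 : ∀ z : ℂ, (ρ ‖z‖ : ℂ) * (conj z ^ n * ∑ j ∈ Finset.range N, tc f j * z ^ j)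
      = ∑ j ∈ Finset.range N, tc f j * ((ρ ‖z‖ : ℂ) * (conj z ^ n * z ^ j)) := by
    intro z
    rw [Finset.mul_sum, Finset.mul_sum]
    exact Finset.sum_congr rfl fun j _ => by ring
  simp only [h1]
  rw [integral_finsetSum _ fun j _ => (hi j).const_mul _]
  simp only [integral_const_mul]
  rw [Finset.sum_eq_single_of_mem n (Finset.mem_range.2 hN)
    (fun j _ hj => by rw [integral_radial_mul_monomial_eq_zero ρ hj.symm, mul_zero])]
  congr 1
  rw [← integral_complex_ofReal]
  refine integral_congr_ae (Eventually.of_forall fun z => ?_)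
  simp only [conj_pow_mul_pow_self]
  push_cast; rfl

/-- For a weight of bounded support, dominated convergence allows $f$ to be replaced by its Taylor
polynomials. Only the factor $\bar f$ is truncated: $\int\rho\,\overline{S_N}f$ is then computed
exactly by pairing $f$ with each monomial. -/
lemma hasSum_radial_of_support {f : ℂ → ℂ} (hf : Differentiable ℂ f) {ρ : ℝ → ℝ}
    (hρ : Measurable ρ) {B R : ℝ} (hB : ∀ r, |ρ r| ≤ B) (h0 : ∀ r, R ≤ r → ρ r = 0)
    (hneg : ∀ r, 0 ≤ ρ r) :
    HasSum (fun n => ‖tc f n‖ ^ 2 * ∫ z : ℂ, ρ ‖z‖ * ‖z‖ ^ (2 * n))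
      (∫ z : ℂ, ρ ‖z‖ * ‖f z‖ ^ 2) := by
  wlog hR : 0 ≤ R generalizing R
  · exact this (R := |R|) (fun r hr => h0 r ((le_abs_self R).trans hr)) (abs_nonneg R)
  have hB0 : 0 ≤ B := (abs_nonneg _).trans (hB 0)
  have hm : Measurable fun z : ℂ => (ρ ‖z‖ : ℂ) :=
    Complex.measurable_ofReal.comp (hρ.comp measurable_norm)
  have hcm : Measurable fun z : ℂ => conj z := Complex.continuous_conj.measurable
  obtain ⟨S, hS0, hS⟩ := norm_partial_le hf hR
  obtain ⟨D, hD⟩ := (isCompact_closedBall (0 : ℂ) R).exists_bound_of_continuousOn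
    hf.continuous.continuousOn
  have hD0 : 0 ≤ D := (norm_nonneg _).trans (hD 0 (by simp [hR]))
  rw [hasSum_iff_tendsto_nat_of_nonneg (fun n => mul_nonneg (sq_nonneg _)
    (integral_nonneg fun z => mul_nonneg (hneg _) (by positivity)))]
  have hlim : Tendsto (fun N => ∫ z : ℂ, (ρ ‖z‖ : ℂ) *
      (conj (∑ j ∈ Finset.range N, tc f j * z ^ j) * f z)) atTop
      (𝓝 (∫ z : ℂ, (ρ ‖z‖ : ℂ) * (conj (f z) * f z))) := by
    refine tendsto_integral_of_dominated_convergence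
      ((Metric.ball (0 : ℂ) R).indicator fun _ => B * (S * D)) ?_ ?_ ?_ ?_
    · intro N
      refine (hm.mul ((Complex.continuous_conj.measurable.comp ?_).mul
        hf.continuous.measurable)).aestronglyMeasurable
      fun_prop
    · exact (integrable_indicator_iff Metric.isOpen_ball.measurableSet).2
        (integrableOn_const (by exact measure_ball_lt_top.ne))
    · refine fun N => Eventually.of_forall fun z => ?_
      by_cases hz : z ∈ Metric.ball (0 : ℂ) R
      · rw [Set.indicator_of_mem hz, norm_mul, Complex.norm_real, norm_mul, RCLike.norm_conj]
        have hz' : ‖z‖ ≤ R := by simpa using (Metric.mem_ball.1 hz).le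
        have h1 := hB ‖z‖
        have h2 := hS N z hz'
        have h3 := hD z (by simpa using hz')
        gcongr
        assumption
      · rw [Set.indicator_of_notMem hz, h0 _ (by simpa using hz)]; simp
    · refine Eventually.of_forall fun z => ?_
      exact (((Complex.continuous_conj.tendsto _).comp
        (hasSum_tc hf z).tendsto_sum_nat).mul_const _).const_mul _
  have hi (j : ℕ) : Integrable fun z : ℂ => (ρ ‖z‖ : ℂ) * (conj z ^ j * f z) := by
    refine integrable_of_bound_of_eq_zero (B := B * (R ^ j * D)) (R := R)
      (hm.mul ((hcm.pow_const j).mul hf.continuous.measurable)).aestronglyMeasurable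
      (fun z => ?_) (fun z hz => by simp [h0 _ hz])
    by_cases hz : R ≤ ‖z‖
    · simp only [h0 _ hz, Complex.ofReal_zero, zero_mul, norm_zero]; positivity
    · rw [norm_mul, Complex.norm_real, norm_mul, norm_pow, RCLike.norm_conj]
      push Not at hz
      have h1 := hB ‖z‖
      have h3 := hD z (by simpa using hz.le)
      gcongr
      exact h1
  have hfin (N : ℕ) : ∫ z : ℂ, (ρ ‖z‖ : ℂ) *
      (conj (∑ j ∈ Finset.range N, tc f j * z ^ j) * f z)
      = ((∑ n ∈ Finset.range N, ‖tc f n‖ ^ 2 * ∫ z : ℂ, ρ ‖z‖ * ‖z‖ ^ (2 * n) : ℝ) : ℂ) := by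
    have h1 : ∀ z : ℂ, (ρ ‖z‖ : ℂ) * (conj (∑ j ∈ Finset.range N, tc f j * z ^ j) * f z)
        = ∑ j ∈ Finset.range N, conj (tc f j) * ((ρ ‖z‖ : ℂ) * (conj z ^ j * f z)) := by
      intro z
      rw [map_sum, Finset.sum_mul, Finset.mul_sum]
      exact Finset.sum_congr rfl fun j _ => by simp; ring
    simp only [h1]
    rw [integral_finsetSum _ fun j _ => (hi j).const_mul _]
    simp only [integral_const_mul]
    push_cast
    refine Finset.sum_congr rfl fun j _ => ?_
    rw [integral_radial_conj_pow_mul hf hρ hB h0, ← mul_assoc, mul_comm (conj _),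
      Complex.mul_conj, Complex.normSq_eq_norm_sq]
    push_cast; rfl
  simp only [hfin] at hlim
  have hval : ∫ z : ℂ, (ρ ‖z‖ : ℂ) * (conj (f z) * f z)
      = ((∫ z : ℂ, ρ ‖z‖ * ‖f z‖ ^ 2 : ℝ) : ℂ) := by
    rw [← integral_complex_ofReal]
    refine integral_congr_ae (Eventually.of_forall fun z => ?_)
    simp only [mul_comm (conj (f z)), Complex.mul_conj, Complex.normSq_eq_norm_sq]
    push_cast; rfl
  rw [hval] at hlim
  have := (Complex.continuous_re.tendsto _).comp hlim
  exact this

/-- Parseval's identity for entire functions and radial weights. -/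
lemma lintegral_radial {f : ℂ → ℂ} (hf : Differentiable ℂ f) {ρ : ℝ → ℝ}
    (hρ : Continuous ρ) (hpos : ∀ r, 0 ≤ ρ r) :
    ∫⁻ z : ℂ, ENNReal.ofReal (ρ ‖z‖ * ‖f z‖ ^ 2)
      = ∑' n, ENNReal.ofReal (‖tc f n‖ ^ 2) * ∫⁻ z : ℂ, ENNReal.ofReal (ρ ‖z‖ * ‖z‖ ^ (2 * n)) := by
  -- The weight is cut off to bounded intervals and recovered by monotone convergence in
  -- $[0,\infty]$, so the identity also holds when both sides are infinite.
  set σ : ℕ → ℝ → ℝ := fun N => (Set.Ioo (-(N : ℝ)) N).indicator ρ with hσ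
  have hσm (N) : Measurable (σ N) := hρ.measurable.indicator measurableSet_Ioo
  have hσ0 (N) (r) : 0 ≤ σ N r := Set.indicator_nonneg (fun r _ => hpos r) r
  have hσB (N) : ∃ B, ∀ r, |σ N r| ≤ B := by
    obtain ⟨B, hB⟩ := (isCompact_Icc (a := -(N : ℝ)) (b := N)).exists_bound_of_continuousOn
      hρ.continuousOn
    refine ⟨|B|, fun r => ?_⟩
    by_cases hr : r ∈ Set.Ioo (-(N : ℝ)) N
    · simp only [hσ, Set.indicator_of_mem hr]
      exact (hB r (Set.Ioo_subset_Icc_self hr)).trans (le_abs_self B)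
    · simp [hσ, Set.indicator_of_notMem hr]
  have hσR (N : ℕ) (r : ℝ) (hr : (N : ℝ) ≤ r) : σ N r = 0 :=
    Set.indicator_of_notMem (fun h => absurd h.2 (not_lt.2 hr)) _
  have hmono (r) : Monotone fun N => σ N r := by
    intro N N' h
    have h' : (N : ℝ) ≤ N' := by exact_mod_cast h
    exact Set.indicator_le_indicator_of_subset (Set.Ioo_subset_Ioo (by linarith) h')
      (fun r => hpos r) r
  have hlim (r) : Tendsto (fun N => σ N r) atTop (𝓝 (ρ r)) := by
    obtain ⟨N, hN⟩ := exists_nat_gt |r|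
    refine tendsto_const_nhds.congr' ?_
    filter_upwards [eventually_ge_atTop N] with k hk
    have h' : (N : ℝ) ≤ k := by exact_mod_cast hk
    have := abs_lt.1 (hN.trans_le h')
    simp only [hσ]
    rw [Set.indicator_of_mem (show r ∈ Set.Ioo (-(k : ℝ)) k from this)]
  have key (g : ℂ → ℝ) (hg : Continuous g) (hg0 : ∀ z, 0 ≤ g z) :
      Tendsto (fun N => ∫⁻ z : ℂ, ENNReal.ofReal (σ N ‖z‖ * g z)) atTop
        (𝓝 (∫⁻ z : ℂ, ENNReal.ofReal (ρ ‖z‖ * g z))) := by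
    refine lintegral_tendsto_of_tendsto_of_monotone (fun N => ?_) ?_ ?_
    · exact (((hσm N).comp measurable_norm).mul hg.measurable).ennreal_ofReal.aemeasurable
    · refine Eventually.of_forall fun z N N' h => ENNReal.ofReal_le_ofReal ?_
      exact mul_le_mul_of_nonneg_right (hmono _ h) (hg0 z)
    · refine Eventually.of_forall fun z => ?_
      exact ENNReal.tendsto_ofReal ((hlim _).mul_const _)
  have hint (N) (g : ℂ → ℝ) (hg : Continuous g) (hg0 : ∀ z, 0 ≤ g z) :
      ENNReal.ofReal (∫ z : ℂ, σ N ‖z‖ * g z) = ∫⁻ z : ℂ, ENNReal.ofReal (σ N ‖z‖ * g z) := by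
    obtain ⟨B, hB⟩ := hσB N
    obtain ⟨D, hD⟩ := (isCompact_closedBall (0 : ℂ) N).exists_bound_of_continuousOn
      hg.continuousOn
    have hm := (((hσm N).comp measurable_norm).mul hg.measurable).aestronglyMeasurable (μ := volume)
    refine ofReal_integral_eq_lintegral_ofReal ?_
      (Eventually.of_forall fun z => mul_nonneg (hσ0 _ _) (hg0 z))
    have h2 : Integrable fun z : ℂ => ((σ N ‖z‖ * g z : ℝ) : ℂ) := by
      refine integrable_of_bound_of_eq_zero (B := |B| * |D|) (R := N)
        (Complex.continuous_ofReal.comp_aestronglyMeasurable hm) (fun z => ?_)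
        (fun z hz => by simp [hσR _ _ hz])
      by_cases hz : (N : ℝ) ≤ ‖z‖
      · simp only [hσR _ _ hz, Complex.ofReal_zero, zero_mul, norm_zero]; positivity
      · push Not at hz
        rw [Complex.norm_real, norm_mul]
        have h1 := (hB ‖z‖).trans (le_abs_self B)
        have h2 := (hD z (by simpa using hz.le)).trans (le_abs_self D)
        gcongr
        exact h1
    simpa using h2.re
  have hN (N) : ∫⁻ z : ℂ, ENNReal.ofReal (σ N ‖z‖ * ‖f z‖ ^ 2)
      = ∑' n, ENNReal.ofReal (‖tc f n‖ ^ 2) *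
        ∫⁻ z : ℂ, ENNReal.ofReal (σ N ‖z‖ * ‖z‖ ^ (2 * n)) := by
    obtain ⟨B, hB⟩ := hσB N
    have h := hasSum_radial_of_support hf (hσm N) hB (hσR N) (hσ0 N)
    rw [← hint N (fun z => ‖f z‖ ^ 2) (by have := hf.continuous; fun_prop) (fun z => sq_nonneg _),
      ← h.tsum_eq, ENNReal.ofReal_tsum_of_nonneg (fun n => mul_nonneg (sq_nonneg _)
        (integral_nonneg fun z => mul_nonneg (hσ0 _ _) (by positivity))) h.summable]
    refine tsum_congr fun n => ?_
    rw [ENNReal.ofReal_mul (sq_nonneg _), hint N (fun z => ‖z‖ ^ (2 * n)) (by fun_prop)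
      (fun z => by positivity)]
  have hL := key (fun z => ‖f z‖ ^ 2) (by have := hf.continuous; fun_prop) (fun z => sq_nonneg _)
  -- Writing the series as an integral for counting measure makes monotone convergence available for
  -- it as well.
  simp only [hN, ← lintegral_count] at hL
  rw [← lintegral_count]
  refine tendsto_nhds_unique hL ?_
  refine lintegral_tendsto_of_tendsto_of_monotone (fun N => measurable_from_top.aemeasurable) ?_ ?_
  · refine Eventually.of_forall fun n N N' h => ?_
    simp only
    gcongr with z
    exact hmono _ h
  · refine Eventually.of_forall fun n => ?_
    exact ENNReal.Tendsto.const_mul (key (fun z => ‖z‖ ^ (2 * n)) (by fun_prop)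
      (fun z => by positivity)) (Or.inr ENNReal.ofReal_ne_top)

/-! ### The monomial basis -/

/-- The normalized monomials. -/
def basisFun (n : ℕ) (z : ℂ) : ℂ :=
  (((Real.sqrt (Real.pi * n.factorial))⁻¹ : ℝ) : ℂ) * z ^ n * gauss z

/-- The normalization constants `π n!`. -/
def nrm (n : ℕ) : ℝ := Real.pi * n.factorial

lemma nrm_pos (n : ℕ) : 0 < nrm n := by unfold nrm; positivity

lemma continuous_basisFun (n : ℕ) : Continuous (basisFun n) := by
  have := continuous_gauss
  unfold basisFun; fun_prop

lemma norm_basisFun_sq (n : ℕ) (z : ℂ) :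
    ‖basisFun n z‖ ^ 2 = (nrm n)⁻¹ * (‖z‖ ^ (2 * n) * gw z) := by
  unfold basisFun
  rw [norm_mul, norm_mul, mul_pow, mul_pow, norm_gauss_sq, Complex.norm_real, norm_inv, inv_pow,
    Real.norm_eq_abs, sq_abs, Real.sq_sqrt (by positivity), norm_pow, ← pow_mul, mul_comm n 2, nrm,
    mul_assoc]

lemma memLp_basisFun (n : ℕ) : MemLp (basisFun n) 2 volume := by
  rw [memLp_two_iff_integrable_sq_norm (continuous_basisFun n).aestronglyMeasurable]
  simp only [norm_basisFun_sq]
  exact (integrable_pow_mul_gw _).const_mul _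

/-- The normalized monomials as elements of the Bargmann-Fock space. -/
def basisVec (n : ℕ) : fock :=
  ⟨(memLp_basisFun n).toLp, fun z => (((Real.sqrt (Real.pi * n.factorial))⁻¹ : ℝ) : ℂ) * z ^ n,
    by fun_prop, (memLp_basisFun n).coeFn_toLp⟩

lemma coe_basisVec (n : ℕ) :
    ((basisVec n : Lp ℂ 2 (volume : Measure ℂ)) : ℂ → ℂ) =ᵐ[volume] basisFun n :=
  (memLp_basisFun n).coeFn_toLp

lemma inner_basisVec (n : ℕ) (v : Lp ℂ 2 (volume : Measure ℂ)) :
    inner ℂ (basisVec n : Lp ℂ 2 (volume : Measure ℂ)) v = ∫ z, conj (basisFun n z) * v z := by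
  rw [L2.inner_def]
  refine integral_congr_ae ?_
  filter_upwards [coe_basisVec n] with z hz
  rw [hz]
  simp [mul_comm]

lemma conj_basisFun_mul (n : ℕ) (z w : ℂ) : conj (basisFun n z) * (w * gauss z)
    = (((Real.sqrt (nrm n))⁻¹ : ℝ) : ℂ) * (gw z * (conj z ^ n * w)) := by
  have : conj (gauss z) = gauss z := by unfold gauss; exact Complex.conj_ofReal _
  rw [← gauss_mul_gauss]
  unfold basisFun nrm
  simp only [map_mul, map_pow, Complex.conj_ofReal, this]
  ring

/-- The coefficient of `f(z) exp (-|z|^2/2)` on the normalized monomials. -/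
lemma inner_basisVec_eq_tc {f : ℂ → ℂ} (hf : Differentiable ℂ f) (u : Lp ℂ 2 (volume : Measure ℂ))
    (hu : u =ᵐ[volume] fun z => f z * gauss z) (n : ℕ) :
    inner ℂ (basisVec n : Lp ℂ 2 (volume : Measure ℂ)) u = Real.sqrt (nrm n) * tc f n := by
  have hmem : MemLp (fun z => f z * gauss z) 2 volume := (memLp_congr_ae hu).1 (Lp.memLp u)
  have hint : Integrable fun z => (gw z : ℂ) * (conj z ^ n * f z) := by
    have h1 : Integrable fun z => conj (basisFun n z) * (f z * gauss z) :=
      MemLp.integrable_mul (p := 2) (q := 2) (memLp_basisFun n).star hmem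
    simp only [conj_basisFun_mul] at h1
    have h2 := h1.const_mul ((Real.sqrt (nrm n) : ℝ) : ℂ)
    refine h2.congr (Eventually.of_forall fun z => ?_)
    have h3 : ((Real.sqrt (nrm n) : ℝ) : ℂ) ≠ 0 := by
      exact_mod_cast (Real.sqrt_pos.2 (nrm_pos n)).ne'
    simp only [Complex.ofReal_inv]
    rw [mul_inv_cancel_left₀ h3]
  -- The Gaussian does not have bounded support, so it is truncated to apply
  -- `integral_radial_conj_pow_mul`; the truncation is removed by dominated convergence.
  set ρ : ℕ → ℝ → ℝ := fun N => (Set.Ioo (-(N : ℝ)) N).indicator fun r => Real.exp (-r ^ 2) with hρ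
  have hρm (N) : Measurable (ρ N) := by
    refine Measurable.indicator ?_ measurableSet_Ioo
    fun_prop
  have hρ1 (N r) : |ρ N r| ≤ Real.exp (-r ^ 2) := by
    by_cases hr : r ∈ Set.Ioo (-(N : ℝ)) N
    · simp [hρ, Set.indicator_of_mem hr]
    · simp only [hρ, Set.indicator_of_notMem hr, abs_zero]; positivity
  have hρB (N r) : |ρ N r| ≤ 1 := (hρ1 N r).trans (Real.exp_le_one_iff.2 (by nlinarith))
  have hρR (N : ℕ) (r : ℝ) (hr : (N : ℝ) ≤ r) : ρ N r = 0 :=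
    Set.indicator_of_notMem (fun h => absurd h.2 (not_lt.2 hr)) _
  have hlim (r) : Tendsto (fun N => ρ N r) atTop (𝓝 (Real.exp (-r ^ 2))) := by
    obtain ⟨N, hN⟩ := exists_nat_gt |r|
    refine tendsto_const_nhds.congr' ?_
    filter_upwards [eventually_ge_atTop N] with k hk
    have h' : (N : ℝ) ≤ k := by exact_mod_cast hk
    have := abs_lt.1 (hN.trans_le h')
    simp only [hρ]
    rw [Set.indicator_of_mem (show r ∈ Set.Ioo (-(k : ℝ)) k from this)]
  have key (g : ℂ → ℂ) (hg : Continuous g) (hgi : Integrable fun z => (gw z : ℂ) * g z) :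
      Tendsto (fun N => ∫ z : ℂ, (ρ N ‖z‖ : ℂ) * g z) atTop (𝓝 (∫ z, (gw z : ℂ) * g z)) := by
    refine tendsto_integral_of_dominated_convergence (fun z => ‖(gw z : ℂ) * g z‖) ?_ hgi.norm ?_ ?_
    · exact fun N => ((Complex.measurable_ofReal.comp ((hρm N).comp measurable_norm)).mul
        hg.measurable).aestronglyMeasurable
    · refine fun N => Eventually.of_forall fun z => ?_
      rw [norm_mul, norm_mul, Complex.norm_real, Complex.norm_real,
        Real.norm_of_nonneg (gw_pos z).le]
      exact mul_le_mul_of_nonneg_right (hρ1 N _) (norm_nonneg _)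
    · exact Eventually.of_forall fun z =>
        ((Complex.continuous_ofReal.tendsto _).comp (hlim ‖z‖)).mul_const _
  have h1 := key (fun z => conj z ^ n * f z)
    ((Complex.continuous_conj.pow n).mul hf.continuous) hint
  have h2 := key (fun z => ((‖z‖ ^ (2 * n) : ℝ) : ℂ)) (by fun_prop) (by
    have := (integrable_pow_mul_gw (2 * n)).ofReal (𝕜 := ℂ)
    refine this.congr (Eventually.of_forall fun z => ?_)
    exact (Complex.ofReal_mul _ _).trans (mul_comm _ _))
  have h3 : ∀ N, ∫ z : ℂ, (ρ N ‖z‖ : ℂ) * (conj z ^ n * f z)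
      = tc f n * ∫ z : ℂ, (ρ N ‖z‖ : ℂ) * ((‖z‖ ^ (2 * n) : ℝ) : ℂ) := by
    intro N
    rw [integral_radial_conj_pow_mul hf (hρm N) (hρB N) (hρR N), ← integral_complex_ofReal]
    simp only [Complex.ofReal_mul]
  simp only [h3] at h1
  have h4 := tendsto_nhds_unique h1 (h2.const_mul (tc f n))
  have h5 : ∫ z : ℂ, (gw z : ℂ) * ((‖z‖ ^ (2 * n) : ℝ) : ℂ) = (nrm n : ℂ) := by
    rw [nrm, ← integral_pow_mul_gw, ← integral_complex_ofReal]
    refine integral_congr_ae (Eventually.of_forall fun z => ?_)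
    push_cast; ring
  rw [inner_basisVec]
  have h6 : ∫ z, conj (basisFun n z) * u z
      = ∫ z, (((Real.sqrt (nrm n))⁻¹ : ℝ) : ℂ) * (gw z * (conj z ^ n * f z)) := by
    refine integral_congr_ae ?_
    filter_upwards [hu] with z hz
    rw [hz, conj_basisFun_mul]
  rw [h6, integral_const_mul, h4, h5]
  have h7 : ((Real.sqrt (nrm n) : ℝ) : ℂ) ≠ 0 := by
    exact_mod_cast (Real.sqrt_pos.2 (nrm_pos n)).ne'
  have h8 : (nrm n : ℂ) = (Real.sqrt (nrm n) : ℂ) * (Real.sqrt (nrm n) : ℂ) := by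
    rw [← Complex.ofReal_mul, Real.mul_self_sqrt (nrm_pos n).le]
  rw [h8]
  push_cast
  field_simp

lemma inner_basisVec_basisVec (m n : ℕ) :
    inner ℂ (basisVec m : Lp ℂ 2 (volume : Measure ℂ)) (basisVec n : Lp ℂ 2 (volume : Measure ℂ))
      = if m = n then 1 else 0 := by
  rw [inner_basisVec]
  have h1 : ∫ z, conj (basisFun m z) * (basisVec n : Lp ℂ 2 (volume : Measure ℂ)) z
      = ∫ z, (((Real.sqrt (nrm m))⁻¹ * (Real.sqrt (nrm n))⁻¹ : ℝ) : ℂ) *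
        (((fun r : ℝ => Real.exp (-r ^ 2)) ‖z‖ : ℝ) * (conj z ^ m * z ^ n)) := by
    refine integral_congr_ae ?_
    filter_upwards [coe_basisVec n] with z hz
    rw [hz, show basisFun n z = ((((Real.sqrt (nrm n))⁻¹ : ℝ) : ℂ) * z ^ n) * gauss z from rfl,
      conj_basisFun_mul]
    simp only [gw]
    push_cast; ring
  rw [h1, integral_const_mul]
  split_ifs with h
  · subst h
    have h2 : ∫ z : ℂ, ((((fun r : ℝ => Real.exp (-r ^ 2)) ‖z‖ : ℝ) : ℂ) * (conj z ^ m * z ^ m))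
        = (nrm m : ℂ) := by
      rw [nrm, ← integral_pow_mul_gw, ← integral_complex_ofReal]
      refine integral_congr_ae (Eventually.of_forall fun z => ?_)
      simp only [conj_pow_mul_pow_self, gw]
      push_cast; ring
    rw [h2, ← mul_inv, Real.mul_self_sqrt (nrm_pos m).le, ← Complex.ofReal_mul,
      inv_mul_cancel₀ (nrm_pos m).ne', Complex.ofReal_one]
  · rw [integral_radial_mul_monomial_eq_zero (fun r : ℝ => Real.exp (-r ^ 2)) h, mul_zero]

lemma orthonormal_basisVec : Orthonormal ℂ basisVec := by
  rw [orthonormal_iff_ite]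
  intro m n
  rw [Submodule.coe_inner, inner_basisVec_basisVec]

/-- The Hilbert basis of normalized monomials. -/
def fockBasis : HilbertBasis ℕ ℂ fock :=
  HilbertBasis.mkOfOrthogonalEqBot orthonormal_basisVec (by
    rw [Submodule.eq_bot_iff]
    rintro ⟨u, f, hf, hu⟩ hperp
    rw [Submodule.mem_orthogonal] at hperp
    have h0 (n : ℕ) : tc f n = 0 := by
      have h1 := hperp (basisVec n) (Submodule.subset_span ⟨n, rfl⟩)
      rw [Submodule.coe_inner] at h1
      have h2 := (inner_basisVec_eq_tc hf u hu n).symm.trans h1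
      refine (mul_eq_zero.1 h2).resolve_left ?_
      exact_mod_cast (Real.sqrt_pos.2 (nrm_pos n)).ne'
    have hf0 : ∀ z, f z = 0 := fun z =>
      (hasSum_tc hf z).unique (by simp [h0])
    refine Subtype.ext (Lp.ext ?_)
    filter_upwards [hu, Lp.coeFn_zero ℂ 2 (volume : Measure ℂ)] with z hz hz'
    exact (hz.trans (by rw [hf0 z, zero_mul]; rfl)).trans hz'.symm)

lemma fockBasis_apply (n : ℕ) : fockBasis n = basisVec n := by
  simp [fockBasis]

/-- The coefficients of an element of the Bargmann-Fock space. -/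
def coef (n : ℕ) (u : fock) : ℂ := inner ℂ (basisVec n) u

lemma coef_eq_tc {f : ℂ → ℂ} (hf : Differentiable ℂ f) (u : fock)
    (hu : (u : Lp ℂ 2 (volume : Measure ℂ)) =ᵐ[volume] fun z => f z * gauss z) (n : ℕ) :
    coef n u = Real.sqrt (nrm n) * tc f n := by
  unfold coef
  rw [Submodule.coe_inner, inner_basisVec_eq_tc hf _ hu]

lemma hasSum_coef_sq (u : fock) : HasSum (fun n => ‖coef n u‖ ^ 2) (‖u‖ ^ 2) := by
  have h := fockBasis.hasSum_inner_mul_inner u u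
  have h2 := (Complex.hasSum_re h)
  rw [inner_self_eq_norm_sq_to_K] at h2
  convert h2 using 1
  · ext n
    rw [fockBasis_apply, ← inner_conj_symm, mul_comm, ← coef, Complex.mul_conj,
      Complex.normSq_eq_norm_sq, Complex.ofReal_re]
  · simp [← Complex.ofReal_pow]

/-- The weighted norms in terms of the coefficients. -/
lemma wnorm_sq (s : ℝ) (u : fock) :
    wnorm s u ^ 2 = ∑' n, ENNReal.ofReal (‖coef n u‖ ^ 2) *
      ∫⁻ z : ℂ, ENNReal.ofReal ((1 + ‖z‖ ^ 2) ^ s * ‖basisFun n z‖ ^ 2) := by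
  obtain ⟨f, hf, hu⟩ := u.2
  have h1 : wnorm s u ^ 2 = ∫⁻ z : ℂ, ENNReal.ofReal
      (((fun r : ℝ => (1 + r ^ 2) ^ s * Real.exp (-r ^ 2)) ‖z‖) * ‖f z‖ ^ 2) := by
    have h := eLpNorm_nnreal_pow_eq_lintegral (μ := volume) (p := 2)
      (f := fun z : ℂ => ((bracket z ^ s : ℝ) : ℂ) * (u : Lp ℂ 2 (volume : Measure ℂ)) z)
      (by norm_num)
    simp only [NNReal.coe_ofNat, ENNReal.rpow_ofNat] at h
    change (eLpNorm _ ((2 : ℝ≥0) : ℝ≥0∞) volume) ^ 2 = _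
    rw [h]
    refine lintegral_congr_ae ?_
    filter_upwards [hu] with z hz
    rw [hz, ← ofReal_norm, ← ENNReal.ofReal_pow (norm_nonneg _), norm_mul, norm_mul, mul_pow,
      mul_pow, norm_gauss_sq, Complex.norm_real, Real.norm_eq_abs, sq_abs, bracket]
    congr 1
    have : ((1 + ‖z‖ ^ 2) ^ s : ℝ) = (Real.sqrt (1 + ‖z‖ ^ 2) ^ s) ^ 2 := by
      rw [← Real.rpow_natCast (Real.sqrt (1 + ‖z‖ ^ 2) ^ s) 2, ← Real.rpow_mul (Real.sqrt_nonneg _),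
        mul_comm s, Real.rpow_mul (Real.sqrt_nonneg _), Real.rpow_natCast,
        Real.sq_sqrt (by positivity)]
    simp only [this, gw]
    ring
  rw [h1, lintegral_radial (ρ := fun r : ℝ => (1 + r ^ 2) ^ s * Real.exp (-r ^ 2)) hf (by
      refine Continuous.mul (Continuous.rpow_const (by fun_prop) fun r => ?_) (by fun_prop)
      left; positivity) (fun r => by positivity)]
  refine tsum_congr fun n => ?_
  rw [coef_eq_tc hf u hu, norm_mul, mul_pow, Complex.norm_real, Real.norm_eq_abs, sq_abs,
    Real.sq_sqrt (nrm_pos n).le, mul_comm (nrm n), ENNReal.ofReal_mul (by positivity), mul_assoc,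
    ← lintegral_const_mul' (ENNReal.ofReal (nrm n)) _ ENNReal.ofReal_ne_top]
  congr 1
  refine lintegral_congr fun z => ?_
  rw [← ENNReal.ofReal_mul (nrm_pos n).le, norm_basisFun_sq]
  congr 1
  have := (nrm_pos n).ne'
  simp only [gw]
  field_simp

/-! ### Toeplitz operators -/

lemma exists_mulCLM {V : ℂ → ℝ} (hV : Continuous V) {M : ℝ} (hM : ∀ z, |V z| ≤ M) :
    ∃ A : Lp ℂ 2 (volume : Measure ℂ) →L[ℂ] Lp ℂ 2 (volume : Measure ℂ),
      (∀ u, ‖A u‖ ≤ M * ‖u‖) ∧ ∀ u, A u =ᵐ[volume] fun z => (V z : ℂ) * u z := by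
  have hmem (u : Lp ℂ 2 (volume : Measure ℂ)) : MemLp (fun w => (V w : ℂ) * u w) 2 volume := by
    refine (Lp.memLp u).of_le_mul (c := M) ?_ (Eventually.of_forall fun w => ?_)
    · exact (Complex.continuous_ofReal.comp hV).aestronglyMeasurable.mul (Lp.aestronglyMeasurable u)
    · rw [norm_mul, Complex.norm_real]
      exact mul_le_mul_of_nonneg_right (hM w) (norm_nonneg _)
  have hAc (u : Lp ℂ 2 (volume : Measure ℂ)) :
      (hmem u).toLp =ᵐ[volume] fun z => (V z : ℂ) * u z := (hmem u).coeFn_toLp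
  have hAn (u : Lp ℂ 2 (volume : Measure ℂ)) : ‖(hmem u).toLp‖ ≤ M * ‖u‖ := by
    refine Lp.norm_le_mul_norm_of_ae_le_mul ?_
    filter_upwards [hAc u] with z hz
    rw [hz, norm_mul, Complex.norm_real]
    exact mul_le_mul_of_nonneg_right (hM z) (norm_nonneg _)
  let L : Lp ℂ 2 (volume : Measure ℂ) →ₗ[ℂ] Lp ℂ 2 (volume : Measure ℂ) :=
    { toFun := fun u => (hmem u).toLp
      map_add' := fun u v => by
        refine Lp.ext ?_
        filter_upwards [hAc u, hAc v, hAc (u + v), Lp.coeFn_add ((hmem u).toLp) ((hmem v).toLp),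
          Lp.coeFn_add u v] with z h1 h2 h3 h4 h5
        rw [h3, h4, Pi.add_apply, h1, h2, h5, Pi.add_apply, mul_add]
      map_smul' := fun c u => by
        refine Lp.ext ?_
        filter_upwards [hAc u, hAc (c • u), Lp.coeFn_smul c ((hmem u).toLp),
          Lp.coeFn_smul c u] with z h1 h2 h3 h4
        rw [h2, RingHom.id_apply, h3, Pi.smul_apply, h1, h4, Pi.smul_apply, smul_eq_mul,
          smul_eq_mul]
        ring }
  exact ⟨L.mkContinuous M hAn, hAn, hAc⟩

lemma exists_toeplitz {W : ℝ → ℂ → ℝ} (hW : IsPotential W) {M : ℝ} (hM : ∀ t z, |W t z| ≤ M)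
    (t : ℝ) : ∃ T : fock →L[ℂ] fock, (∀ u, ‖T u‖ ≤ M * ‖u‖) ∧
      (∀ u : fock, (T u : Lp ℂ 2 (volume : Measure ℂ)) =
        proj (fun w => (W t w : ℂ) * (u : Lp ℂ 2 (volume : Measure ℂ)) w)) ∧
      (∀ v w : fock, inner ℂ v (T w) = ∫ z, (W t z : ℂ) *
        (conj ((v : Lp ℂ 2 (volume : Measure ℂ)) z) * (w : Lp ℂ 2 (volume : Measure ℂ)) z)) := by
  obtain ⟨A, hAn, hAc⟩ := exists_mulCLM (hW.smooth_space t).continuous (hM t)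
  refine ⟨fock.orthogonalProjectionOnto ∘L A ∘L fock.subtypeL, fun u => ?_, fun u => ?_,
    fun v w => ?_⟩
  · have h1 := Submodule.norm_orthogonalProjectionOnto_apply_le (K := fock)
      (A (u : Lp ℂ 2 (volume : Measure ℂ)))
    have h2 := hAn (u : Lp ℂ 2 (volume : Measure ℂ))
    rw [Submodule.norm_coe] at h2
    rw [ContinuousLinearMap.comp_apply, ContinuousLinearMap.comp_apply, Submodule.subtypeL_apply]
    exact h1.trans h2
  · rw [proj, dif_pos (hW.memLp t u)]
    have : (hW.memLp t u).toLp = A u :=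
      Lp.ext ((hW.memLp t u).coeFn_toLp.trans (hAc u).symm)
    rw [this]
    rfl
  · have h1 : inner ℂ v ((fock.orthogonalProjectionOnto ∘L A ∘L fock.subtypeL) w)
        = inner ℂ (v : Lp ℂ 2 (volume : Measure ℂ)) (A w) :=
      Submodule.inner_orthogonalProjectionOnto_eq_of_mem_left v (A w)
    rw [h1, L2.inner_def]
    refine integral_congr_ae ?_
    filter_upwards [hAc w] with z hz
    rw [hz]
    simp only [RCLike.inner_apply]
    ring

lemma toeplitz_symm {V : ℂ → ℝ} {T : fock →L[ℂ] fock} (hT : ∀ v w : fock, inner ℂ v (T w) =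
      ∫ z, (V z : ℂ) * (conj ((v : Lp ℂ 2 (volume : Measure ℂ)) z) *
        (w : Lp ℂ 2 (volume : Measure ℂ)) z)) (v w : fock) :
    inner ℂ v (T w) = conj (inner ℂ w (T v)) := by
  rw [hT, hT, ← integral_conj]
  refine integral_congr_ae (Eventually.of_forall fun z => ?_)
  simp only [map_mul, Complex.conj_ofReal, Complex.conj_conj]
  ring

lemma toeplitz_basisVec {V : ℂ → ℝ} {T : fock →L[ℂ] fock} (hT : ∀ v w : fock, inner ℂ v (T w) =
      ∫ z, (V z : ℂ) * (conj ((v : Lp ℂ 2 (volume : Measure ℂ)) z) *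
        (w : Lp ℂ 2 (volume : Measure ℂ)) z)) (m n : ℕ) :
    inner ℂ (basisVec m) (T (basisVec n)) =
      (((Real.sqrt (nrm m))⁻¹ * (Real.sqrt (nrm n))⁻¹ : ℝ) : ℂ) * mom (fun z => V z) m n := by
  rw [hT, mom, ← integral_const_mul]
  refine integral_congr_ae ?_
  filter_upwards [coe_basisVec m, coe_basisVec n] with z h1 h2
  rw [h1, h2, show basisFun n z = ((((Real.sqrt (nrm n))⁻¹ : ℝ) : ℂ) * z ^ n) * gauss z from rfl,
    conj_basisFun_mul]
  push_cast; ring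

/-! ### The evolution of the coefficients -/

/-- A test function of the form $\rho(|z|)\bar z^n$ sees only the $n$-th coefficient of an element
of the Fock space. The distributional equation can thus be read coefficient by coefficient. -/
lemma integral_mul_radial {ρ : ℝ → ℝ} (hρ : Measurable ρ) {B R : ℝ} (hB : ∀ r, |ρ r| ≤ B)
    (h0 : ∀ r, R ≤ r → ρ r = 0) (n : ℕ) (v : fock) :
    ∫ z, (v : Lp ℂ 2 (volume : Measure ℂ)) z * ((ρ ‖z‖ : ℂ) * conj z ^ n)
      = (((Real.sqrt (nrm n))⁻¹ *
          ∫ z : ℂ, ρ ‖z‖ * Real.exp (-‖z‖ ^ 2 / 2) * ‖z‖ ^ (2 * n) : ℝ) : ℂ) * coef n v := by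
  obtain ⟨f, hf, hv⟩ := v.2
  have h1 : ∫ z, (v : Lp ℂ 2 (volume : Measure ℂ)) z * ((ρ ‖z‖ : ℂ) * conj z ^ n)
      = ∫ z : ℂ, ((fun r : ℝ => ρ r * Real.exp (-r ^ 2 / 2)) ‖z‖ : ℝ) * (conj z ^ n * f z) := by
    refine integral_congr_ae ?_
    filter_upwards [hv] with z hz
    rw [hz, gauss]
    push_cast; ring
  have hB' : ∀ r, |ρ r * Real.exp (-r ^ 2 / 2)| ≤ B := fun r => by
    rw [abs_mul, abs_of_pos (Real.exp_pos _)]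
    exact (mul_le_of_le_one_right (abs_nonneg _) (Real.exp_le_one_iff.2 (by nlinarith))).trans (hB r)
  rw [h1, integral_radial_conj_pow_mul hf (R := R) (by fun_prop) hB'
    (fun r hr => by rw [h0 r hr, zero_mul]), coef_eq_tc hf v hv]
  have h7 : ((Real.sqrt (nrm n) : ℝ) : ℂ) ≠ 0 := by
    exact_mod_cast (Real.sqrt_pos.2 (nrm_pos n)).ne'
  push_cast
  field_simp

/-- A smooth cutoff on the real line. -/
def cut : ContDiffBump (0 : ℝ) := ⟨1, 2, by norm_num, by norm_num⟩

/-- The radial profile of `H (h(|z|^2) \bar z^n)`, divided by `\bar z^n`. -/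
def harmProfile (n : ℕ) (r : ℝ) : ℝ :=
  -4 * (deriv (deriv cut) (r ^ 2) * r ^ 2 + (n + 1) * deriv cut (r ^ 2)) + r ^ 2 * cut (r ^ 2)

/-- $H$ commutes with rotations, so it preserves the form (radial function) times $\bar z^n$. Hence
the term $\int u\,H\varphi$ also involves the $n$-th coefficient only. -/
lemma harm_cut (n : ℕ) (z : ℂ) :
    harm (fun z => ((cut (‖z‖ ^ 2) : ℝ) : ℂ) * conj z ^ n) z
      = (harmProfile n ‖z‖ : ℂ) * conj z ^ n := by
  have hs : ContDiff ℝ ∞ (cut : ℝ → ℝ) := cut.contDiff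
  have hs' : ContDiff ℝ ∞ (deriv (cut : ℝ → ℝ)) := hs.deriv'
  have e1 : dzbar (fun z => ((cut (‖z‖ ^ 2) : ℝ) : ℂ) * conj z ^ n) =
      fun z => ((deriv cut (‖z‖ ^ 2) : ℝ) : ℂ) * (z * conj z ^ n)
        + ((cut (‖z‖ ^ 2) : ℝ) : ℂ) * (n * conj z ^ (n - 1)) := by
    funext z
    have hd : HasDerivAt cut (deriv cut (‖z‖ ^ 2)) (‖z‖ ^ 2) :=
      (hs.differentiable (by simp) _).hasDerivAt
    rw [((hasWirt_of_hasDerivAt_radial hd).mul ((hasWirt_conj z).pow n)).dzbar]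
    ring
  unfold harm
  rw [e1]
  have hd : HasDerivAt cut (deriv cut (‖z‖ ^ 2)) (‖z‖ ^ 2) :=
    (hs.differentiable (by simp) _).hasDerivAt
  have hd' : HasDerivAt (deriv cut) (deriv (deriv cut) (‖z‖ ^ 2)) (‖z‖ ^ 2) :=
    (hs'.differentiable (by simp) _).hasDerivAt
  rw [(((hasWirt_of_hasDerivAt_radial hd').mul ((hasWirt_id z).mul ((hasWirt_conj z).pow n))).add
    ((hasWirt_of_hasDerivAt_radial hd).mul
      ((hasWirt_const (n : ℂ) z).mul ((hasWirt_conj z).pow (n - 1))))).dz]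
  have hz : conj z * z = ((‖z‖ : ℝ) : ℂ) ^ 2 := by
    rw [mul_comm, Complex.mul_conj, Complex.normSq_eq_norm_sq]; push_cast; rfl
  -- The truncated exponent $n-1$ at $n=0$ is harmless because of the factor $n$.
  have hn : conj z * ((n : ℂ) * conj z ^ (n - 1)) = n * conj z ^ n := by
    cases n with
    | zero => simp
    | succ n => rw [Nat.add_sub_cancel, pow_succ]; ring
  unfold harmProfile
  push_cast
  linear_combination (-4 * ((deriv (deriv cut) (‖z‖ ^ 2) : ℝ) : ℂ) * conj z ^ n) * hz
    - 4 * ((deriv cut (‖z‖ ^ 2) : ℝ) : ℂ) * hn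

lemma cut_eq_zero {r : ℝ} (hr : 2 ≤ r) : cut (r ^ 2) = 0 :=
  cut.zero_of_le_dist (by simp [cut]; nlinarith)

lemma deriv_cut_eq_zero {x : ℝ} (hx : 2 < x) : deriv cut x = 0 := by
  have h : (cut : ℝ → ℝ) =ᶠ[𝓝 x] fun _ => 0 := by
    filter_upwards [lt_mem_nhds hx] with y hy
    exact cut.zero_of_le_dist (by simpa [cut] using hy.le.trans (le_abs_self y))
  rw [h.deriv_eq]; simp

lemma deriv_deriv_cut_eq_zero {x : ℝ} (hx : 2 < x) : deriv (deriv cut) x = 0 := by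
  have h : deriv (cut : ℝ → ℝ) =ᶠ[𝓝 x] fun _ => 0 := by
    filter_upwards [lt_mem_nhds hx] with y hy
    exact deriv_cut_eq_zero hy
  rw [h.deriv_eq]; simp

lemma harmProfile_eq_zero (n : ℕ) {r : ℝ} (hr : 2 ≤ r) : harmProfile n r = 0 := by
  have h2 : 2 < r ^ 2 := by nlinarith
  rw [harmProfile, cut_eq_zero hr, deriv_cut_eq_zero h2, deriv_deriv_cut_eq_zero h2]; ring

lemma exists_bound_of_eq_zero {g : ℝ → ℝ} (hg : Continuous g) (hs : ∀ r, g (-r) = g r)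
    (h0 : ∀ r, 2 ≤ r → g r = 0) : ∃ B, ∀ r, |g r| ≤ B := by
  obtain ⟨B, hB⟩ := (isCompact_Icc (a := (0:ℝ)) (b := 2)).exists_bound_of_continuousOn
    hg.continuousOn
  have hpos : ∀ r, 0 ≤ r → |g r| ≤ |B| := fun r hr => by
    by_cases h : r ≤ 2
    · exact (hB r ⟨hr, h⟩).trans (le_abs_self B)
    · rw [h0 r (not_le.1 h).le, abs_zero]; positivity
  refine ⟨|B|, fun r => ?_⟩
  rcases le_total 0 r with h | h
  · exact hpos r h
  · rw [← hs]; exact hpos (-r) (by linarith)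

/-- The coefficients of a solution satisfy a scalar ordinary differential equation. -/
lemma exists_hasDerivAt_coef (n : ℕ) : ∃ κ : ℝ, ∀ (δ : ℝ) (W : ℝ → ℂ → ℝ) (u₀ : fock)
    (u : ℝ → fock), IsSolution δ W u₀ u → ∀ (t : ℝ) (v : fock),
      (v : Lp ℂ 2 (volume : Measure ℂ)) =
        proj (fun w => (W t w : ℂ) * (u t : Lp ℂ 2 (volume : Measure ℂ)) w) →
      HasDerivAt (fun τ => coef n (u τ))
        (-Complex.I * ((δ * κ : ℝ) * coef n (u t) + coef n v)) t := by
  have hs : ContDiff ℝ ∞ (cut : ℝ → ℝ) := cut.contDiff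
  have hs' : ContDiff ℝ ∞ (deriv (cut : ℝ → ℝ)) := hs.deriv'
  have hs'' : ContDiff ℝ ∞ (deriv (deriv (cut : ℝ → ℝ))) := hs'.deriv'
  have hc := hs.continuous
  have hc' := hs'.continuous
  have hc'' := hs''.continuous
  have hcont : Continuous fun r : ℝ => cut (r ^ 2) := by fun_prop
  have hcont' : Continuous (harmProfile n) := by unfold harmProfile; fun_prop
  obtain ⟨B, hB⟩ := exists_bound_of_eq_zero hcont (by simp) (fun r hr => cut_eq_zero hr)
  obtain ⟨B', hB'⟩ := exists_bound_of_eq_zero hcont' (by simp [harmProfile])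
    (fun r hr => harmProfile_eq_zero n hr)
  set c : ℝ := (Real.sqrt (nrm n))⁻¹ *
    ∫ z : ℂ, cut (‖z‖ ^ 2) * Real.exp (-‖z‖ ^ 2 / 2) * ‖z‖ ^ (2 * n) with hcdef
  set c' : ℝ := (Real.sqrt (nrm n))⁻¹ *
    ∫ z : ℂ, harmProfile n ‖z‖ * Real.exp (-‖z‖ ^ 2 / 2) * ‖z‖ ^ (2 * n) with hcdef'
  have hsupp : HasCompactSupport fun z : ℂ => cut (‖z‖ ^ 2) := by
    refine HasCompactSupport.intro (isCompact_closedBall (0 : ℂ) 2) fun z hz => ?_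
    exact cut_eq_zero (by simpa using (not_le.1 (by simpa using hz)).le)
  have hcpos : 0 < c := by
    refine mul_pos (inv_pos.2 (Real.sqrt_pos.2 (nrm_pos n))) ?_
    refine Continuous.integral_pos_of_hasCompactSupport_nonneg_nonzero (x := 1) (by fun_prop)
      (hsupp.mul_right.mul_right) (fun z => ?_) ?_
    · have := cut.nonneg (x := ‖z‖ ^ 2)
      simp only [Pi.zero_apply]
      positivity
    · have : cut 1 = 1 := cut.one_of_mem_closedBall (by simp [cut])
      simp [this]
  have hφ : ContDiff ℝ ∞ fun z : ℂ => ((cut (‖z‖ ^ 2) : ℝ) : ℂ) * conj z ^ n := by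
    have h1 : ContDiff ℝ ∞ fun z : ℂ => ‖z‖ ^ 2 := contDiff_norm_sq ℝ
    exact (Complex.ofRealCLM.contDiff.comp (hs.comp h1)).mul (Complex.conjCLE.contDiff.pow n)
  have hφc : HasCompactSupport fun z : ℂ => ((cut (‖z‖ ^ 2) : ℝ) : ℂ) * conj z ^ n :=
    HasCompactSupport.mul_right (hsupp.comp_left (g := fun x : ℝ => (x : ℂ)) (by simp))
  -- Both pairings are multiples of the same coefficient, with $c>0$, so the equation can be divided
  -- by $c$. The value of $\kappa=c'/c$ plays no role beyond its being real and independent of the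
  -- solution.
  refine ⟨c' / c, fun δ W u₀ u hu t v hv => ?_⟩
  have h := hu.equation _ hφ hφc t
  simp only [harm_cut, ← hv] at h
  simp only [integral_mul_radial (ρ := fun r => cut (r ^ 2)) hcont.measurable hB
    (fun r hr => cut_eq_zero hr) n, integral_mul_radial hcont'.measurable hB'
    (fun r hr => harmProfile_eq_zero n hr) n] at h
  have hc0 : (c : ℂ) ≠ 0 := by exact_mod_cast hcpos.ne'
  have h2 := h.const_mul ((c : ℂ)⁻¹)
  simp only [← hcdef, ← hcdef', ← mul_assoc, inv_mul_cancel₀ hc0, one_mul] at h2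
  refine h2.congr_deriv ?_
  push_cast
  field_simp

/-! ### Energy estimates -/

/-- Only termwise derivatives are available. The fundamental theorem of calculus is applied to
partial sums, and the uniform bound $D$ on the absolute sums permits passage to the limit; the final
rate involves only the bound $B$ on the full sum, which benefits from cancellation. -/
lemma abs_tsum_sub_tsum_le {x x' : ℕ → ℝ → ℝ} (hd : ∀ n t, HasDerivAt (x n) (x' n t) t)
    (hx : ∀ t, Summable fun n => x n t) {a b D B : ℝ}
    (hs : ∀ t, Summable fun n => x' n t)
    (hD : ∀ t ∈ Set.uIoc a b, ∀ N, ∑ n ∈ Finset.range N, |x' n t| ≤ D)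
    (hB : ∀ t ∈ Set.uIoc a b, |∑' n, x' n t| ≤ B) :
    |∑' n, x n b - ∑' n, x n a| ≤ B * |b - a| := by
  -- Continuity of $x_n'$ is not assumed; a derivative is measurable in any case.
  have hm (n : ℕ) : Measurable (x' n) := by
    have : x' n = deriv (x n) := funext fun t => (hd n t).deriv.symm
    rw [this]; exact measurable_deriv _
  have hmN (N : ℕ) : Measurable fun t => ∑ n ∈ Finset.range N, x' n t :=
    Finset.measurable_fun_sum _ fun n _ => hm n
  have hbd (N : ℕ) : ∀ t ∈ Set.uIoc a b, ‖∑ n ∈ Finset.range N, x' n t‖ ≤ D := fun t ht =>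
    (norm_sum_le _ _).trans (hD t ht N)
  have hint (N : ℕ) : IntervalIntegrable (fun t => ∑ n ∈ Finset.range N, x' n t) volume a b := by
    refine (intervalIntegrable_const (c := D)).mono_fun (hmN N).aestronglyMeasurable ?_
    refine (ae_restrict_iff' measurableSet_uIoc).2 (Eventually.of_forall fun t ht => ?_)
    exact (hbd N t ht).trans (le_abs_self D)
  have hftc (N : ℕ) : ∫ t in a..b, ∑ n ∈ Finset.range N, x' n t
      = ∑ n ∈ Finset.range N, x n b - ∑ n ∈ Finset.range N, x n a :=
    intervalIntegral.integral_eq_sub_of_hasDerivAt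
      (fun t _ => HasDerivAt.fun_sum fun n _ => hd n t) (hint N)
  have hlim : Tendsto (fun N => ∫ t in a..b, ∑ n ∈ Finset.range N, x' n t) atTop
      (𝓝 (∫ t in a..b, ∑' n, x' n t)) := by
    refine intervalIntegral.tendsto_integral_filter_of_dominated_convergence (fun _ => D)
      (Eventually.of_forall fun N => (hmN N).aestronglyMeasurable)
      (Eventually.of_forall fun N => Eventually.of_forall (hbd N)) intervalIntegrable_const
      (Eventually.of_forall fun t _ => (hs t).hasSum.tendsto_sum_nat)
  simp only [hftc] at hlim
  have h2 := tendsto_nhds_unique hlim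
    ((hx b).hasSum.tendsto_sum_nat.sub (hx a).hasSum.tendsto_sum_nat)
  rw [← h2, ← Real.norm_eq_abs]
  exact intervalIntegral.norm_integral_le_of_norm_le_const hB

lemma abs_weight_mul_im_le {g : ℝ} {Γ : ℝ} (hg : |g| ≤ Γ) (a b : ℂ) :
    |g * (2 * (conj a * b).im)| ≤ Γ * (‖a‖ ^ 2 + ‖b‖ ^ 2) := by
  rw [abs_mul, abs_mul, abs_two]
  have h1 : |(conj a * b).im| ≤ ‖a‖ * ‖b‖ := by
    simpa using Complex.abs_im_le_norm (conj a * b)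
  have h2 : 2 * |(conj a * b).im| ≤ ‖a‖ ^ 2 + ‖b‖ ^ 2 := by
    nlinarith [sq_nonneg (‖a‖ - ‖b‖)]
  have h0 := abs_nonneg g
  have : 0 ≤ 2 * |(conj a * b).im| := by positivity
  gcongr
  exact h0.trans hg

lemma summable_weight_mul_im {g : ℕ → ℝ} {Γ : ℝ} (hg : ∀ n, |g n| ≤ Γ) (u v : fock) :
    Summable fun n => g n * (2 * (conj (coef n u) * coef n v).im) :=
  Summable.of_norm_bounded (((hasSum_coef_sq u).summable.add
    (hasSum_coef_sq v).summable).mul_left Γ) fun n => abs_weight_mul_im_le (hg n) _ _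

lemma summable_weight_mul_sq {g : ℕ → ℝ} {Γ : ℝ} (hg : ∀ n, |g n| ≤ Γ) (u : fock) :
    Summable fun n => g n * ‖coef n u‖ ^ 2 :=
  Summable.of_norm_bounded ((hasSum_coef_sq u).summable.mul_left Γ) fun n => by
    rw [norm_mul, norm_pow, norm_norm]
    exact mul_le_mul_of_nonneg_right (hg n) (sq_nonneg _)

/-- The evolution of the weighted sums `∑ g_n |u_n|^2`. -/
lemma abs_weighted_sub_le {δ : ℝ} {W : ℝ → ℂ → ℝ} {u₀ : fock} {u : ℝ → fock}
    (hu : IsSolution δ W u₀ u) {T : ℝ → fock →L[ℂ] fock} {M : ℝ}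
    (hTM : ∀ t v, ‖T t v‖ ≤ M * ‖v‖)
    (hT : ∀ t (v : fock), (T t v : Lp ℂ 2 (volume : Measure ℂ)) =
      proj (fun w => (W t w : ℂ) * (v : Lp ℂ 2 (volume : Measure ℂ)) w))
    {g : ℕ → ℝ} {Γ : ℝ} (hg : ∀ n, |g n| ≤ Γ) {t B : ℝ}
    (hB : ∀ τ, |∑' n, g n * (2 * (conj (coef n (u τ)) * coef n (T τ (u τ))).im)| ≤ B) :
    |∑' n, g n * ‖coef n (u t)‖ ^ 2 - ∑' n, g n * ‖coef n u₀‖ ^ 2| ≤ B * |t| := by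
  have hd (n : ℕ) (τ : ℝ) : HasDerivAt (fun τ => g n * ‖coef n (u τ)‖ ^ 2)
      (g n * (2 * (conj (coef n (u τ)) * coef n (T τ (u τ))).im)) τ := by
    obtain ⟨κ, hκ⟩ := exists_hasDerivAt_coef n
    have h := hκ δ W u₀ u hu τ (T τ (u τ)) (hT τ (u τ))
    -- The real multiple $\delta\kappa$ contributes $2\,\mathrm{Re}(-i\delta\kappa|u_n|^2)=0$, so
    -- the dispersive part disappears here.
    refine (h.norm_sq.const_mul (g n)).congr_deriv ?_
    congr 2
    rw [Complex.inner]
    simp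
    ring
  obtain ⟨Q, hQ⟩ := (isCompact_uIcc (a := (0 : ℝ)) (b := t)).exists_bound_of_continuousOn
    hu.continuous.continuousOn
  have hΓ : 0 ≤ Γ := (abs_nonneg _).trans (hg 0)
  have h := abs_tsum_sub_tsum_le hd (fun τ => summable_weight_mul_sq hg (u τ)) (a := 0) (b := t)
    (D := Γ * (Q ^ 2 + (|M| * Q) ^ 2)) (B := B) (fun τ => summable_weight_mul_im hg _ _)
    (fun τ hτ N => ?_) (fun τ _ => hB τ)
  · rw [hu.initial, sub_zero] at h
    exact h
  · have hQ1 := hQ τ (Set.uIoc_subset_uIcc hτ)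
    have h1 : ‖T τ (u τ)‖ ≤ |M| * Q := (hTM τ _).trans (by
      have := le_abs_self M
      have := abs_nonneg M
      gcongr)
    calc _ ≤ ∑ n ∈ Finset.range N, Γ * (‖coef n (u τ)‖ ^ 2 + ‖coef n (T τ (u τ))‖ ^ 2) :=
          Finset.sum_le_sum fun n _ => abs_weight_mul_im_le (hg n) _ _
      _ ≤ Γ * (‖u τ‖ ^ 2 + ‖T τ (u τ)‖ ^ 2) := by
          have h2 := ((hasSum_coef_sq (u τ)).add (hasSum_coef_sq (T τ (u τ)))).mul_left Γ
          exact sum_le_hasSum _ (fun n _ => by positivity) h2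
      _ ≤ _ := by gcongr

/-- The commutator of `T` with the diagonal operator of eigenvalues `a` is bounded, in the form
sense on finite combinations of basis vectors. -/
def CommBound (T : fock →L[ℂ] fock) (a : ℕ → ℝ) (K : ℝ) : Prop :=
  ∀ (N : ℕ) (w : ℕ → ℂ), |(∑ m ∈ Finset.range N, ∑ n ∈ Finset.range N,
    conj (w m) * (a n * w n) * inner ℂ (basisVec m) (T (basisVec n))).im|
      ≤ K * ∑ n ∈ Finset.range N, ‖w n‖ ^ 2

lemma conj_double_sum (N : ℕ) (F : ℕ → ℕ → ℂ) :
    conj (∑ m ∈ Finset.range N, ∑ n ∈ Finset.range N, F m n)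
      = ∑ m ∈ Finset.range N, ∑ n ∈ Finset.range N, conj (F n m) := by
  rw [map_sum, Finset.sum_comm]
  simp only [map_sum]

lemma im_eq_zero_of_hermitian {N : ℕ} {F : ℕ → ℕ → ℂ} (hF : ∀ m n, conj (F n m) = F m n) :
    (∑ m ∈ Finset.range N, ∑ n ∈ Finset.range N, F m n).im = 0 := by
  rw [← Complex.conj_eq_iff_im, conj_double_sum]
  simp only [hF]

lemma hasSum_coef (u : fock) : HasSum (fun n => coef n u • basisVec n) u := by
  have h := fockBasis.hasSum_repr u
  simp only [fockBasis.repr_apply_apply, fockBasis_apply] at h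
  exact h

lemma fock_inner_smul_left (c : ℂ) (v w : fock) : inner ℂ (c • v) w = conj c * inner ℂ v w :=
  inner_smul_left v w c

lemma fock_inner_smul_right (c : ℂ) (v w : fock) : inner ℂ v (c • w) = c * inner ℂ v w :=
  inner_smul_right v w c

lemma norm_partial_sq (N : ℕ) (w : ℕ → ℂ) :
    ‖∑ n ∈ Finset.range N, w n • basisVec n‖ ^ 2 = ∑ n ∈ Finset.range N, ‖w n‖ ^ 2 := by
  have h := orthonormal_basisVec.inner_sum w w (Finset.range N)
  rw [inner_self_eq_norm_sq_to_K] at h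
  have h2 : ∀ n, conj (w n) * w n = ((‖w n‖ ^ 2 : ℝ) : ℂ) := fun n => by
    rw [mul_comm, Complex.mul_conj, Complex.normSq_eq_norm_sq]
  simp only [h2, ← Complex.ofReal_sum] at h
  exact Complex.ofReal_injective (by simpa using h)

lemma partial_coef_sq_le (N : ℕ) (u : fock) :
    ∑ n ∈ Finset.range N, ‖coef n u‖ ^ 2 ≤ ‖u‖ ^ 2 :=
  sum_le_hasSum _ (fun _ _ => sq_nonneg _) (hasSum_coef_sq u)

/-- Substitute $c=(a+\mu)w$. The form becomes $\langle aw,Taw\rangle+\mu\langle aw,Tw\rangle$. The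
first term is real by symmetry, the second is controlled by the commutator bound for $w$, and
$\mu^2\|w\|^2\le\|c\|^2$ supplies the factor $1/\mu$. -/
lemma CommBound.resolvent {T : fock →L[ℂ] fock} {a : ℕ → ℝ} {K : ℝ} (hK : CommBound T a K)
    (hK0 : 0 ≤ K) (hT : ∀ v w, inner ℂ v (T w) = conj (inner ℂ w (T v))) (ha : ∀ n, 0 ≤ a n)
    {μ : ℝ} (hμ : 0 < μ) (N : ℕ) (c : ℕ → ℂ) :
    |(∑ m ∈ Finset.range N, ∑ n ∈ Finset.range N,
      conj ((a m / (a m + μ) : ℝ) * c m) * c n * inner ℂ (basisVec m) (T (basisVec n))).im|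
      ≤ K / μ * ∑ n ∈ Finset.range N, ‖c n‖ ^ 2 := by
  have hpos (n) : 0 < a n + μ := by have := ha n; linarith
  set w : ℕ → ℂ := fun n => c n / (a n + μ : ℝ) with hw
  have hc (n) : c n = (a n + μ : ℝ) * w n := by
    have : ((a n + μ : ℝ) : ℂ) ≠ 0 := by exact_mod_cast (hpos n).ne'
    simp only [hw]; field_simp
  have h1 : ∑ m ∈ Finset.range N, ∑ n ∈ Finset.range N,
      conj ((a m / (a m + μ) : ℝ) * c m) * c n * inner ℂ (basisVec m) (T (basisVec n))
      = ∑ m ∈ Finset.range N, ∑ n ∈ Finset.range N, (a m * a n * (conj (w m) * w n) *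
          inner ℂ (basisVec m) (T (basisVec n)))
        + μ * ∑ m ∈ Finset.range N, ∑ n ∈ Finset.range N, (conj (a m * w m) * w n *
          inner ℂ (basisVec m) (T (basisVec n))) := by
    rw [Finset.mul_sum, ← Finset.sum_add_distrib]
    refine Finset.sum_congr rfl fun m _ => ?_
    rw [Finset.mul_sum, ← Finset.sum_add_distrib]
    refine Finset.sum_congr rfl fun n _ => ?_
    have : ((a m / (a m + μ) : ℝ) : ℂ) * c m = a m * w m := by
      have : ((a m : ℂ) + μ) ≠ 0 := by exact_mod_cast (hpos m).ne'
      rw [hc m]; push_cast; field_simp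
    rw [this, hc n]
    simp only [map_mul, Complex.conj_ofReal]
    push_cast; ring
  have h2 : (∑ m ∈ Finset.range N, ∑ n ∈ Finset.range N, (a m * a n * (conj (w m) * w n) *
      inner ℂ (basisVec m) (T (basisVec n)))).im = 0 := by
    refine im_eq_zero_of_hermitian fun m n => ?_
    simp only [map_mul, Complex.conj_ofReal, Complex.conj_conj]
    rw [hT (basisVec m)]
    ring
  have h3 : (∑ m ∈ Finset.range N, ∑ n ∈ Finset.range N, (conj (a m * w m) * w n *
      inner ℂ (basisVec m) (T (basisVec n)))).im
      = -(∑ m ∈ Finset.range N, ∑ n ∈ Finset.range N, (conj (w m) * (a n * w n) *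
      inner ℂ (basisVec m) (T (basisVec n)))).im := by
    rw [← Complex.conj_im, conj_double_sum]
    congr 1
    refine Finset.sum_congr rfl fun m _ => Finset.sum_congr rfl fun n _ => ?_
    simp only [map_mul, Complex.conj_ofReal, Complex.conj_conj]
    rw [hT (basisVec m)]
    ring
  rw [h1, Complex.add_im, h2, zero_add, Complex.im_ofReal_mul, h3, abs_mul, abs_neg,
    abs_of_pos hμ]
  have h4 : ∀ n, μ ^ 2 * ‖w n‖ ^ 2 ≤ ‖c n‖ ^ 2 := fun n => by
    rw [← mul_pow, hc n, norm_mul, Complex.norm_real, Real.norm_of_nonneg (hpos n).le]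
    have := ha n
    gcongr
    linarith
  have h5 : μ ^ 2 * ∑ n ∈ Finset.range N, ‖w n‖ ^ 2 ≤ ∑ n ∈ Finset.range N, ‖c n‖ ^ 2 := by
    rw [Finset.mul_sum]; exact Finset.sum_le_sum fun n _ => h4 n
  calc _ ≤ μ * (K * ∑ n ∈ Finset.range N, ‖w n‖ ^ 2) := by
        gcongr
        exact hK N w
    _ = K / μ * (μ ^ 2 * ∑ n ∈ Finset.range N, ‖w n‖ ^ 2) := by field_simp
    _ ≤ _ := by gcongr

/-- The finite-dimensional bound passes to the limit. With $P_N$ and $Q_N$ the truncations of $u$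
and of the weighted sequence, $\langle Q_N,TP_N\rangle$ obeys `CommBound.resolvent`, and the error
$\langle Q_N,T(u-P_N)\rangle$ tends to $0$ because $T$ is bounded and $\|Q_N\|\le\|u\|$. -/
lemma CommBound.tsum_le {T : fock →L[ℂ] fock} {a : ℕ → ℝ} {K : ℝ} (hK : CommBound T a K)
    (hK0 : 0 ≤ K) (hT : ∀ v w, inner ℂ v (T w) = conj (inner ℂ w (T v))) (ha : ∀ n, 0 ≤ a n)
    {μ : ℝ} (hμ : 0 < μ) (u : fock) :
    |∑' n, a n / (a n + μ) * (2 * (conj (coef n u) * coef n (T u)).im)| ≤ 2 * K / μ * ‖u‖ ^ 2 := by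
  set g : ℕ → ℝ := fun n => a n / (a n + μ) with hg
  have hg0 (n) : 0 ≤ g n := div_nonneg (ha n) (by have := ha n; linarith)
  have hg1 (n) : g n ≤ 1 := (div_le_one (by have := ha n; linarith)).2 (by linarith)
  have hgabs (n) : |g n| ≤ 1 := abs_le.2 ⟨by have := hg0 n; linarith, hg1 n⟩
  set P : ℕ → fock := fun N => ∑ n ∈ Finset.range N, coef n u • basisVec n with hP
  set Q : ℕ → fock := fun N => ∑ n ∈ Finset.range N, ((g n : ℂ) * coef n u) • basisVec n with hQ
  have hQn (N) : ‖Q N‖ ≤ ‖u‖ := by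
    refine (sq_le_sq₀ (norm_nonneg _) (norm_nonneg _)).1 ?_
    rw [norm_partial_sq N fun n => (g n : ℂ) * coef n u]
    refine le_trans (Finset.sum_le_sum fun n _ => ?_) (partial_coef_sq_le N u)
    rw [norm_mul, mul_pow, Complex.norm_real]
    exact mul_le_of_le_one_left (sq_nonneg _) (pow_le_one₀ (norm_nonneg _) (hgabs n))
  have hQx (N) (x : fock) : inner ℂ (Q N) x
      = ∑ n ∈ Finset.range N, (g n : ℂ) * (conj (coef n u) * coef n x) := by
    simp only [hQ, sum_inner, fock_inner_smul_left, map_mul, Complex.conj_ofReal, mul_assoc]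
    rfl
  have hsum (N) : ∑ n ∈ Finset.range N, g n * (2 * (conj (coef n u) * coef n (T u)).im)
      = 2 * (inner ℂ (Q N) (T u)).im := by
    rw [hQx, Complex.im_sum, Finset.mul_sum]
    refine Finset.sum_congr rfl fun n _ => ?_
    rw [Complex.im_ofReal_mul]; ring
  have hbound (N) : |(inner ℂ (Q N) (T (P N))).im| ≤ K / μ * ‖u‖ ^ 2 := by
    have h1 : inner ℂ (Q N) (T (P N)) = ∑ m ∈ Finset.range N, ∑ n ∈ Finset.range N,
        conj ((a m / (a m + μ) : ℝ) * coef m u) * coef n u *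
          inner ℂ (basisVec m) (T (basisVec n)) := by
      simp only [hQ, hP, map_sum, map_smul, sum_inner, inner_sum, fock_inner_smul_left,
        fock_inner_smul_right, hg]
      rw [Finset.sum_comm]
      refine Finset.sum_congr rfl fun m _ => Finset.sum_congr rfl fun n _ => ?_
      ring
    rw [h1]
    refine (hK.resolvent hK0 hT ha hμ N fun n => coef n u).trans ?_
    have := partial_coef_sq_le N u
    gcongr
  have hPlim : Tendsto (fun N => 2 * K / μ * ‖u‖ ^ 2 + 2 * (‖u‖ * ‖T (u - P N)‖)) atTop
      (𝓝 (2 * K / μ * ‖u‖ ^ 2)) := by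
    have h1 : Tendsto P atTop (𝓝 u) := (hasSum_coef u).tendsto_sum_nat
    have h2 : Tendsto (fun N => u - P N) atTop (𝓝 0) := by
      have := (tendsto_const_nhds (x := u)).sub h1
      rwa [sub_self] at this
    have h3 : Tendsto (fun N => ‖T (u - P N)‖) atTop (𝓝 0) := by
      have := ((T.continuous.norm).tendsto 0).comp h2
      simp only [map_zero, norm_zero] at this
      exact this
    simpa using ((h3.const_mul ‖u‖).const_mul 2).const_add (2 * K / μ * ‖u‖ ^ 2)
  refine le_of_tendsto_of_tendsto' ((summable_weight_mul_im hgabs u (T u)).hasSum.tendsto_sum_nat).abs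
    hPlim fun N => ?_
  rw [hsum]
  have h1 : T u = T (P N) + T (u - P N) := by rw [← map_add]; congr 1; abel
  rw [h1, inner_add_right, Complex.add_im, mul_add]
  refine (abs_add_le _ _).trans (add_le_add ?_ ?_)
  · rw [abs_mul, abs_two]
    calc _ ≤ 2 * (K / μ * ‖u‖ ^ 2) := by gcongr; exact hbound N
      _ = _ := by ring
  · rw [abs_mul, abs_two]
    gcongr
    refine (Complex.abs_im_le_norm _).trans ((norm_inner_le_norm _ _).trans ?_)
    gcongr
    exact hQn N

/-- Conservation of mass. -/
lemma norm_eq_of_isSolution {δ : ℝ} {W : ℝ → ℂ → ℝ} {u₀ : fock} {u : ℝ → fock}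
    (hu : IsSolution δ W u₀ u) {T : ℝ → fock →L[ℂ] fock} {M : ℝ}
    (hTM : ∀ t v, ‖T t v‖ ≤ M * ‖v‖)
    (hT : ∀ t (v : fock), (T t v : Lp ℂ 2 (volume : Measure ℂ)) =
      proj (fun w => (W t w : ℂ) * (v : Lp ℂ 2 (volume : Measure ℂ)) w))
    (hsymm : ∀ t v w, inner ℂ v (T t w) = conj (inner ℂ w (T t v))) (t : ℝ) :
    ‖u t‖ ^ 2 = ‖u₀‖ ^ 2 := by
  -- With constant weight $1$ the derivative is $2\,\mathrm{Im}\langle u,Tu\rangle$, which vanishes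
  -- by symmetry, so the rate is $B=0$.
  have h := abs_weighted_sub_le hu hTM hT (g := fun _ => 1) (Γ := 1) (by simp) (t := t) (B := 0)
    (fun τ => ?_)
  · simp only [one_mul, (hasSum_coef_sq _).tsum_eq, zero_mul] at h
    exact sub_eq_zero.1 (abs_nonpos_iff.1 h)
  · have h1 := fockBasis.hasSum_inner_mul_inner (u τ) (T τ (u τ))
    have h2 : (inner ℂ (u τ) (T τ (u τ))).im = 0 := by
      rw [← Complex.conj_eq_iff_im]; exact (hsymm τ _ _).symm
    have h3 := (Complex.hasSum_im h1).mul_left 2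
    rw [h2, mul_zero] at h3
    have h4 : (fun n => (1 : ℝ) * (2 * (conj (coef n (u τ)) * coef n (T τ (u τ))).im))
        = fun n => 2 * (inner ℂ (u τ) (fockBasis n) * inner ℂ (fockBasis n) (T τ (u τ))).im := by
      funext n
      rw [fockBasis_apply, ← inner_conj_symm (u τ), one_mul]
      rfl
    rw [h4, h3.tsum_eq, abs_zero]

/-- The estimate for the resolvent weights. -/
lemma tsum_resolvent_le {δ : ℝ} {W : ℝ → ℂ → ℝ} {u₀ : fock} {u : ℝ → fock}
    (hu : IsSolution δ W u₀ u) {T : ℝ → fock →L[ℂ] fock} {M : ℝ}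
    (hTM : ∀ t v, ‖T t v‖ ≤ M * ‖v‖)
    (hT : ∀ t (v : fock), (T t v : Lp ℂ 2 (volume : Measure ℂ)) =
      proj (fun w => (W t w : ℂ) * (v : Lp ℂ 2 (volume : Measure ℂ)) w))
    (hsymm : ∀ t v w, inner ℂ v (T t w) = conj (inner ℂ w (T t v)))
    {a : ℕ → ℝ} (ha : ∀ n, 0 ≤ a n) {K : ℝ} (hK0 : 0 ≤ K) (hK : ∀ t, CommBound (T t) a K)
    {μ : ℝ} (hμ : 0 < μ) (t : ℝ) :
    ∑' n, a n / (a n + μ) * ‖coef n (u t)‖ ^ 2 ≤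
      ∑' n, a n / (a n + μ) * ‖coef n u₀‖ ^ 2 + min (2 * K * |t| / μ) 1 * ‖u₀‖ ^ 2 := by
  have hg0 (n) : 0 ≤ a n / (a n + μ) := div_nonneg (ha n) (by have := ha n; linarith)
  have hg1 (n) : a n / (a n + μ) ≤ 1 := (div_le_one (by have := ha n; linarith)).2 (by linarith)
  have hgabs (n) : |a n / (a n + μ)| ≤ 1 := abs_le.2 ⟨by have := hg0 n; linarith, hg1 n⟩
  have hmass := norm_eq_of_isSolution hu hTM hT hsymm
  rw [min_mul_of_nonneg _ _ (sq_nonneg _), ← min_add_add_left]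
  refine le_min ?_ ?_
  · have h := abs_weighted_sub_le hu hTM hT hgabs (t := t) (B := 2 * K / μ * ‖u₀‖ ^ 2)
      (fun τ => by
        rw [← hmass τ]; exact (hK τ).tsum_le hK0 (hsymm τ) ha hμ (u τ))
    have := (abs_le.1 h).2
    calc _ ≤ ∑' n, a n / (a n + μ) * ‖coef n u₀‖ ^ 2 + 2 * K / μ * ‖u₀‖ ^ 2 * |t| := by linarith
      _ = _ := by ring
  · have h1 : ∑' n, a n / (a n + μ) * ‖coef n (u t)‖ ^ 2 ≤ ‖u₀‖ ^ 2 := by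
      rw [← hmass t, ← (hasSum_coef_sq (u t)).tsum_eq]
      exact (summable_weight_mul_sq hgabs _).tsum_le_tsum
        (fun n => mul_le_of_le_one_left (sq_nonneg _) (hg1 n)) (hasSum_coef_sq (u t)).summable
    have h2 : 0 ≤ ∑' n, a n / (a n + μ) * ‖coef n u₀‖ ^ 2 :=
      tsum_nonneg fun n => mul_nonneg (hg0 n) (sq_nonneg _)
    linarith

/-! ### From resolvents to fractional powers -/

lemma lintegral_rpowIntegrand {θ : ℝ} (hθ : θ ∈ Set.Ioo 0 1) {x c : ℝ} (hx : 0 ≤ x) (hc : 0 ≤ c) :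
    ∫⁻ μ in Set.Ioi (0 : ℝ), ENNReal.ofReal (Real.rpowIntegrand₀₁ θ μ x * c)
      = ENNReal.ofReal (∫ μ in Set.Ioi (0 : ℝ), Real.rpowIntegrand₀₁ θ μ 1)
        * ENNReal.ofReal (x ^ θ * c) := by
  rw [← ENNReal.ofReal_mul (Real.integral_rpowIntegrand₀₁_one_pos hθ).le,
    ← ofReal_integral_eq_lintegral_ofReal, integral_mul_const,
    Real.integral_rpowIntegrand₀₁_eq_rpow_mul_const hθ hx]
  · congr 1; ring
  · exact (Real.integrableOn_rpowIntegrand₀₁_Ioi hθ hx).mul_const c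
  · refine (ae_restrict_iff' measurableSet_Ioi).2 (Eventually.of_forall fun μ hμ => ?_)
    exact mul_nonneg (Real.rpowIntegrand₀₁_nonneg hθ.1 (le_of_lt hμ) hx) hc

/-- For $0<\theta<1$, $x^\theta$ is a constant times
$\int_0^\infty\mu^{\theta-1}\frac{x}{x+\mu}\,d\mu$. Integrating the hypothesis in $\mu$ and
exchanging sum and integral by Tonelli produces $a_n^\theta$; the same constant appears in all three
terms and cancels. -/
lemma tsum_rpow_le_of_lt_one {a p q : ℕ → ℝ} (ha : ∀ n, 0 ≤ a n) (hp : ∀ n, 0 ≤ p n)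
    (hq : ∀ n, 0 ≤ q n) (hps : Summable p) (hqs : Summable q) {R S : ℝ} (hR : 0 ≤ R) (hS : 0 ≤ S)
    (h : ∀ μ, 0 < μ → ∑' n, a n / (a n + μ) * p n ≤
      ∑' n, a n / (a n + μ) * q n + min (R / μ) 1 * S) {θ : ℝ} (hθ : θ ∈ Set.Ioo 0 1) :
    ∑' n, ENNReal.ofReal (a n ^ θ * p n) ≤
      ∑' n, ENNReal.ofReal (a n ^ θ * q n) + ENNReal.ofReal (R ^ θ * (2 * S)) := by
  have hI := Real.integral_rpowIntegrand₀₁_one_pos hθ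
  set I := ∫ μ in Set.Ioi (0 : ℝ), Real.rpowIntegrand₀₁ θ μ 1 with hIdef
  have hg1 (n) {μ : ℝ} (hμ : 0 < μ) : |a n / (a n + μ)| ≤ 1 := by
    have := ha n
    rw [abs_of_nonneg (by positivity)]
    exact (div_le_one (by linarith)).2 (by linarith)
  have hsum {p : ℕ → ℝ} (hp : ∀ n, 0 ≤ p n) (hps : Summable p) {μ : ℝ} (hμ : 0 < μ) :
      Summable fun n => a n / (a n + μ) * p n :=
    Summable.of_norm_bounded hps fun n => by
      rw [norm_mul, Real.norm_of_nonneg (hp n)]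
      exact mul_le_of_le_one_left (hp n) (hg1 n hμ)
  have hrI {μ x : ℝ} (hμ : 0 < μ) (hx : 0 ≤ x) :
      Real.rpowIntegrand₀₁ θ μ x = μ ^ (θ - 1) * (x / (x + μ)) := by
    rw [Real.rpowIntegrand₀₁_eq_pow_div hθ hμ.le hx, add_comm μ x, mul_div_assoc]
  have hconv {p : ℕ → ℝ} (hp : ∀ n, 0 ≤ p n) (hps : Summable p) {μ : ℝ} (hμ : 0 < μ) :
      ∑' n, ENNReal.ofReal (Real.rpowIntegrand₀₁ θ μ (a n) * p n)
        = ENNReal.ofReal (μ ^ (θ - 1) * ∑' n, a n / (a n + μ) * p n) := by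
    rw [← tsum_mul_left, ENNReal.ofReal_tsum_of_nonneg (fun n => by
      have := ha n; have := hp n; positivity) ((hsum hp hps hμ).mul_left _)]
    exact tsum_congr fun n => by rw [hrI hμ (ha n), mul_assoc]
  have hpt : ∀ μ ∈ Set.Ioi (0 : ℝ),
      ∑' n, ENNReal.ofReal (Real.rpowIntegrand₀₁ θ μ (a n) * p n) ≤
        ∑' n, ENNReal.ofReal (Real.rpowIntegrand₀₁ θ μ (a n) * q n)
          + ENNReal.ofReal (Real.rpowIntegrand₀₁ θ μ R * (2 * S)) := by
    intro μ hμ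
    have hμ' : 0 < μ := hμ
    -- The remainder is put in resolvent form, at the cost of a factor $2$, so that its integral is
    -- given by the same formula and equals a multiple of $R^\theta$.
    have hm : min (R / μ) 1 ≤ R / (R + μ) * 2 := by
      rcases le_total R μ with h1 | h1
      · refine (min_le_left _ _).trans ?_
        rw [div_mul_eq_mul_div, div_le_div_iff₀ hμ' (by linarith)]
        nlinarith
      · refine (min_le_right _ _).trans ?_
        rw [div_mul_eq_mul_div, le_div_iff₀ (by linarith)]
        linarith
    rw [hconv hp hps hμ', hconv hq hqs hμ', ← ENNReal.ofReal_add
      (mul_nonneg (by positivity) (tsum_nonneg fun n => by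
        have := ha n; have := hq n; positivity))
      (mul_nonneg (Real.rpowIntegrand₀₁_nonneg hθ.1 hμ'.le hR) (by positivity)), hrI hμ' hR]
    refine ENNReal.ofReal_le_ofReal ?_
    calc _ ≤ μ ^ (θ - 1) * (∑' n, a n / (a n + μ) * q n + min (R / μ) 1 * S) := by
          gcongr; exact h μ hμ'
      _ ≤ μ ^ (θ - 1) * (∑' n, a n / (a n + μ) * q n + R / (R + μ) * 2 * S) := by gcongr
      _ = _ := by ring
  have hmeas {p : ℕ → ℝ} (n : ℕ) : AEMeasurable
      (fun μ => ENNReal.ofReal (Real.rpowIntegrand₀₁ θ μ (a n) * p n))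
      (volume.restrict (Set.Ioi 0)) :=
    ((Real.aestronglyMeasurable_rpowIntegrand₀₁ hθ (ha n)).aemeasurable.mul_const _).ennreal_ofReal
  have hfin := setLIntegral_mono' (μ := volume) measurableSet_Ioi hpt
  rw [lintegral_add_left' (by exact AEMeasurable.tsum fun n => hmeas n),
    lintegral_tsum fun n => hmeas n, lintegral_tsum fun n => hmeas n] at hfin
  simp only [fun n => lintegral_rpowIntegrand hθ (ha n) (hp n),
    fun n => lintegral_rpowIntegrand hθ (ha n) (hq n),
    lintegral_rpowIntegrand hθ hR (show 0 ≤ 2 * S by positivity), ENNReal.tsum_mul_left,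
    ← mul_add] at hfin
  exact (ENNReal.mul_le_mul_iff_right (ENNReal.ofReal_pos.2 hI).ne' ENNReal.ofReal_ne_top).1 hfin

/-- This is the endpoint $\theta=1$, where the integral representation fails. Instead the inequality
is multiplied by $\mu$ and $\mu\to\infty$, using $\mu a/(a+\mu)\to a$ from below. -/
lemma tsum_le_of_resolvent_le {a p q : ℕ → ℝ} (ha : ∀ n, 0 ≤ a n) (hp : ∀ n, 0 ≤ p n)
    (hq : ∀ n, 0 ≤ q n) (hps : Summable p) (hqs : Summable q) {R S : ℝ} (hR : 0 ≤ R) (hS : 0 ≤ S)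
    (h : ∀ μ, 0 < μ → ∑' n, a n / (a n + μ) * p n ≤
      ∑' n, a n / (a n + μ) * q n + min (R / μ) 1 * S) :
    ∑' n, ENNReal.ofReal (a n * p n) ≤
      ∑' n, ENNReal.ofReal (a n * q n) + ENNReal.ofReal (R * S) := by
  have hg1 (n) {μ : ℝ} (hμ : 0 < μ) : |a n / (a n + μ)| ≤ 1 := by
    have := ha n
    rw [abs_of_nonneg (by positivity)]
    exact (div_le_one (by linarith)).2 (by linarith)
  have hsum {p : ℕ → ℝ} (hp : ∀ n, 0 ≤ p n) (hps : Summable p) {μ : ℝ} (hμ : 0 < μ) :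
      Summable fun n => μ * (a n / (a n + μ) * p n) :=
    (Summable.of_norm_bounded hps fun n => by
      rw [norm_mul, Real.norm_of_nonneg (hp n)]
      exact mul_le_of_le_one_left (hp n) (hg1 n hμ)).mul_left μ
  have hμb : ∀ μ : ℝ, 0 < μ → ∑' n, ENNReal.ofReal (μ * (a n / (a n + μ) * p n)) ≤
      ∑' n, ENNReal.ofReal (a n * q n) + ENNReal.ofReal (R * S) := by
    intro μ hμ
    rw [← ENNReal.ofReal_tsum_of_nonneg (fun n => by have := ha n; have := hp n; positivity)
      (hsum hp hps hμ), tsum_mul_left]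
    have h1 : μ * ∑' n, a n / (a n + μ) * p n ≤
        ∑' n, μ * (a n / (a n + μ) * q n) + R * S := by
      rw [tsum_mul_left]
      calc _ ≤ μ * (∑' n, a n / (a n + μ) * q n + min (R / μ) 1 * S) := by
            gcongr; exact h μ hμ
        _ ≤ μ * (∑' n, a n / (a n + μ) * q n + R / μ * S) := by gcongr; exact min_le_left _ _
        _ = _ := by field_simp
    refine (ENNReal.ofReal_le_ofReal h1).trans ?_
    rw [ENNReal.ofReal_add (tsum_nonneg fun n => by have := ha n; have := hq n; positivity)
      (by positivity), ENNReal.ofReal_tsum_of_nonneg (fun n => by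
        have := ha n; have := hq n; positivity) (hsum hq hqs hμ)]
    gcongr ?_ + _
    refine ENNReal.tsum_le_tsum fun n => ENNReal.ofReal_le_ofReal ?_
    have h1 := ha n
    have h2 := hq n
    rw [← mul_assoc]
    gcongr
    rw [mul_div_assoc', div_le_iff₀ (by linarith)]
    nlinarith
  refine ENNReal.tsum_le_of_sum_range_le fun N => ?_
  have hlim : Tendsto (fun k : ℕ => ∑ n ∈ Finset.range N,
      ENNReal.ofReal (((k : ℝ) + 1) * (a n / (a n + ((k : ℝ) + 1)) * p n))) atTop
      (𝓝 (∑ n ∈ Finset.range N, ENNReal.ofReal (a n * p n))) := by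
    refine tendsto_finsetSum _ fun n _ => ENNReal.tendsto_ofReal ?_
    have h1 : Tendsto (fun k : ℕ => 1 / ((k : ℝ) + 1)) atTop (𝓝 0) :=
      tendsto_one_div_add_atTop_nhds_zero_nat
    have h2 : Tendsto (fun k : ℕ => a n / (a n * (1 / ((k : ℝ) + 1)) + 1) * p n) atTop
        (𝓝 (a n / (a n * 0 + 1) * p n)) :=
      (tendsto_const_nhds.div ((h1.const_mul _).add_const _) (by simp)).mul_const _
    rw [mul_zero, zero_add, div_one] at h2
    refine h2.congr fun k => ?_
    have := ha n
    have h3 : a n + ((k : ℝ) + 1) ≠ 0 := by positivity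
    have h4 : a n * (1 / ((k : ℝ) + 1)) + 1 ≠ 0 := by positivity
    field_simp
  refine le_of_tendsto' hlim fun k => ?_
  exact (ENNReal.sum_le_tsum _).trans (hμb _ (by positivity))

/-- Growth of the fractional weights `∑ a_n^θ |u_n|^2` along a solution, under a commutator
bound for the weights `a_n`. -/
lemma tsum_rpow_coef_le {δ : ℝ} {W : ℝ → ℂ → ℝ} {u₀ : fock} {u : ℝ → fock}
    (hu : IsSolution δ W u₀ u) {T : ℝ → fock →L[ℂ] fock} {M : ℝ}
    (hTM : ∀ t v, ‖T t v‖ ≤ M * ‖v‖)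
    (hT : ∀ t (v : fock), (T t v : Lp ℂ 2 (volume : Measure ℂ)) =
      proj (fun w => (W t w : ℂ) * (v : Lp ℂ 2 (volume : Measure ℂ)) w))
    (hsymm : ∀ t v w, inner ℂ v (T t w) = conj (inner ℂ w (T t v)))
    {a : ℕ → ℝ} (ha : ∀ n, 0 ≤ a n) {K : ℝ} (hK0 : 0 ≤ K) (hK : ∀ t, CommBound (T t) a K)
    {θ : ℝ} (hθ : θ ∈ Set.Ioc 0 1) (t : ℝ) :
    ∑' n, ENNReal.ofReal (a n ^ θ * ‖coef n (u t)‖ ^ 2) ≤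
      ∑' n, ENNReal.ofReal (a n ^ θ * ‖coef n u₀‖ ^ 2)
        + ENNReal.ofReal ((2 * K * |t|) ^ θ * (2 * ‖u₀‖ ^ 2)) := by
  have h := fun μ (hμ : 0 < μ) => tsum_resolvent_le hu hTM hT hsymm ha hK0 hK hμ t
  rcases hθ.2.lt_or_eq with h1 | rfl
  · exact tsum_rpow_le_of_lt_one ha (fun n => sq_nonneg _) (fun n => sq_nonneg _)
      (hasSum_coef_sq _).summable (hasSum_coef_sq _).summable (by positivity) (sq_nonneg _) h
      ⟨hθ.1, h1⟩
  · simp only [Real.rpow_one]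
    refine (tsum_le_of_resolvent_le ha (fun n => sq_nonneg _) (fun n => sq_nonneg _)
      (hasSum_coef_sq _).summable (hasSum_coef_sq _).summable (by positivity) (sq_nonneg _)
      h).trans ?_
    gcongr
    have := sq_nonneg ‖u₀‖
    linarith

/-! ### Moments of the basis functions -/

lemma mom_one (m n : ℕ) : mom (fun _ => 1) m n = if m = n then (nrm n : ℂ) else 0 := by
  unfold mom
  have h : ∀ z : ℂ, (1 : ℂ) * (conj z ^ m * z ^ n * gw z)
      = (((fun r : ℝ => Real.exp (-r ^ 2)) ‖z‖ : ℝ) : ℂ) * (conj z ^ m * z ^ n) := fun z => by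
    simp only [gw]; ring
  simp only [h]
  split_ifs with hmn
  · subst hmn
    rw [nrm, ← integral_pow_mul_gw, ← integral_complex_ofReal]
    refine integral_congr_ae (Eventually.of_forall fun z => ?_)
    simp only [conj_pow_mul_pow_self, gw]
    push_cast; ring
  · exact integral_radial_mul_monomial_eq_zero (fun r : ℝ => Real.exp (-r ^ 2)) hmn

/-- A positive moment of the probability density `|e_n|^2`. -/
lemma integrable_pow_mul_basisFun (q n : ℕ) :
    Integrable fun z : ℂ => ‖z‖ ^ (2 * q) * ‖basisFun n z‖ ^ 2 := by
  refine ((integrable_pow_mul_gw (2 * (q + n))).const_mul (nrm n)⁻¹).congr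
    (Eventually.of_forall fun z => ?_)
  simp only [norm_basisFun_sq]
  ring

lemma integral_pow_mul_basisFun (q n : ℕ) :
    ∫ z : ℂ, ‖z‖ ^ (2 * q) * ‖basisFun n z‖ ^ 2 = (n + 1).ascFactorial q := by
  have h : ∀ z : ℂ, ‖z‖ ^ (2 * q) * ‖basisFun n z‖ ^ 2
      = (nrm n)⁻¹ * (‖z‖ ^ (2 * (n + q)) * gw z) := fun z => by
    rw [norm_basisFun_sq]; ring
  simp only [h]
  rw [integral_const_mul, integral_pow_mul_gw, nrm, ← Nat.factorial_mul_ascFactorial]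
  push_cast
  have : (n.factorial : ℝ) ≠ 0 := by positivity
  field_simp

lemma integral_basisFun_sq (n : ℕ) : ∫ z : ℂ, ‖basisFun n z‖ ^ 2 = 1 := by
  simpa using integral_pow_mul_basisFun 0 n

lemma integrable_basisFun_sq (n : ℕ) : Integrable fun z : ℂ => ‖basisFun n z‖ ^ 2 := by
  simpa using integrable_pow_mul_basisFun 0 n

lemma integrable_inv_pow_mul_basisFun (q n : ℕ) :
    Integrable fun z : ℂ => ((1 + ‖z‖ ^ 2) ^ q)⁻¹ * ‖basisFun n z‖ ^ 2 := by
  have hc := continuous_basisFun n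
  refine (integrable_basisFun_sq n).mono' ?_ (Eventually.of_forall fun z => ?_)
  · refine Continuous.aestronglyMeasurable (Continuous.mul (Continuous.inv₀ (by fun_prop)
      fun z => by positivity) (by fun_prop))
  · rw [Real.norm_of_nonneg (by positivity)]
    refine mul_le_of_le_one_left (by positivity) (inv_le_one_of_one_le₀ (one_le_pow₀ ?_))
    nlinarith [sq_nonneg ‖z‖]

/-- The negative moments of the probability density `|e_n|^2`. -/
lemma integral_inv_pow_mul_basisFun_le (q n : ℕ) :
    ∫ z : ℂ, ((1 + ‖z‖ ^ 2) ^ q)⁻¹ * ‖basisFun n z‖ ^ 2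
      ≤ ((q : ℝ) + 1) ^ q * (((n : ℝ) + 1) ^ q)⁻¹ := by
  rw [← div_eq_mul_inv, ← div_pow]
  -- For $n<q$ the right-hand side is at least $1$. For $n\ge q$, the bound $|z|^{2q}\le(1+|z|^2)^q$
  -- reduces the integral to the mass of the monomial of degree $n-q$, with ratio $(n-q)!/n!$.
  rcases lt_or_ge n q with h | h
  · have h1 : (1 : ℝ) ≤ (((q : ℝ) + 1) / ((n : ℝ) + 1)) ^ q := by
      refine one_le_pow₀ ((one_le_div (by positivity)).2 ?_)
      have : (n : ℝ) < q := by exact_mod_cast h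
      linarith
    refine le_trans ?_ h1
    refine (integral_mono (integrable_inv_pow_mul_basisFun q n) (integrable_basisFun_sq n)
      fun z => ?_).trans_eq (integral_basisFun_sq n)
    refine mul_le_of_le_one_left (by positivity) (inv_le_one_of_one_le₀ (one_le_pow₀ ?_))
    nlinarith [sq_nonneg ‖z‖]
  · obtain ⟨d, rfl⟩ := Nat.exists_eq_add_of_le h
    have h1 : ∫ z : ℂ, ((1 + ‖z‖ ^ 2) ^ q)⁻¹ * ‖basisFun (q + d) z‖ ^ 2
        ≤ (nrm (q + d))⁻¹ * nrm d := by
      rw [nrm, nrm, ← integral_pow_mul_gw d, ← nrm, ← integral_const_mul]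
      refine integral_mono (integrable_inv_pow_mul_basisFun q _)
        ((integrable_pow_mul_gw _).const_mul _) fun z => ?_
      simp only [norm_basisFun_sq]
      have h2 : ‖z‖ ^ (2 * q) ≤ (1 + ‖z‖ ^ 2) ^ q := by
        rw [pow_mul]; gcongr; linarith
      have h3 := gw_pos z
      have h4 := nrm_pos (q + d)
      rw [show 2 * (q + d) = 2 * q + 2 * d by ring, pow_add, inv_mul_le_iff₀ (by positivity)]
      calc _ = ‖z‖ ^ (2 * q) * ((nrm (q + d))⁻¹ * (‖z‖ ^ (2 * d) * gw z)) := by ring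
        _ ≤ _ := by gcongr
    refine h1.trans ?_
    have h5 : ((d : ℝ) + 1) ^ q * d.factorial ≤ (q + d).factorial := by
      have h6 := Nat.pow_succ_le_ascFactorial (d + 1) q
      have h7 := Nat.factorial_mul_ascFactorial d q
      rw [add_comm q d, ← h7]
      have : (d + 1) ^ q ≤ (d + 1).ascFactorial q := h6
      push_cast
      rw [mul_comm]
      gcongr
      exact_mod_cast this
    unfold nrm
    have h8 : ((q + d : ℕ) : ℝ) + 1 ≤ (q + 1) * (d + 1) := by
      push_cast
      nlinarith [q.cast_nonneg (α := ℝ), d.cast_nonneg (α := ℝ)]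
    have h9 : (0 : ℝ) < (q + d).factorial := by positivity
    have h10 : (0 : ℝ) < d.factorial := by positivity
    calc (Real.pi * (q + d).factorial)⁻¹ * (Real.pi * d.factorial)
        = d.factorial / (q + d).factorial := by field_simp
      _ ≤ 1 / ((d : ℝ) + 1) ^ q := by
          rw [div_le_div_iff₀ h9 (by positivity)]; linarith
      _ = (1 / ((d : ℝ) + 1)) ^ q := by rw [div_pow, one_pow]
      _ ≤ _ := by
          gcongr ?_ ^ q
          rw [div_le_div_iff₀ (by positivity) (by positivity)]
          linarith

/-! ### Commutator bounds from weighted bounds on the derivatives -/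

/-- One integration by parts reads
$(n+1)\,\mathrm{mom}(V)_{m,n}=\mathrm{mom}(V)_{m+1,n+1}-\mathrm{mom}(\partial_zV)_{m,n+1}$.
Iterating it $l$ times gives a binomial expansion, since raising $m$ and differentiating $V$
commute. -/
lemma ascFactorial_mul_mom {V : ℕ → ℂ → ℂ} {k : ℕ} (hs : ∀ j, ContDiff ℝ ∞ (V j))
    (hV : ∀ j, dz (V j) = V (j + 1)) (hb : ∀ j ≤ k, ∃ M, ∀ z, ‖V j z‖ ≤ M) (m n : ℕ) :
    ∀ l ≤ k, ((n + 1).ascFactorial l : ℂ) * mom (V 0) m n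
      = ∑ ij ∈ Finset.HasAntidiagonal.antidiagonal l,
        (l.choose ij.1 : ℂ) * ((-1) ^ ij.1 * mom (V ij.1) (m + ij.2) (n + l)) := by
  intro l
  induction l with
  | zero => intro _; simp
  | succ l ih =>
    intro hl
    have hrec : ∀ j < k, ∀ m n : ℕ, ((n : ℂ) + 1) * mom (V j) m n
        = mom (V j) (m + 1) (n + 1) - mom (V (j + 1)) m (n + 1) := by
      intro j hj m n
      obtain ⟨M, hM⟩ := hb j hj.le
      obtain ⟨M', hM'⟩ := hb (j + 1) hj
      have h := mom_dz (hs j) hM (M' := M') (by rw [hV]; exact hM') m (n + 1)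
      rw [hV, Nat.add_sub_cancel] at h
      push_cast at h
      linear_combination h
    -- Pascal's rule splits the sum for $l+1$ into two sums, which are matched term by term with the
    -- recursion.
    rw [Finset.sum_antidiagonal_choose_succ_mul
      (fun i j => (-1) ^ i * mom (V i) (m + j) (n + (l + 1))), ← Finset.sum_add_distrib,
      Nat.ascFactorial_succ, Nat.cast_mul, mul_assoc, ih (by omega), Finset.mul_sum]
    refine Finset.sum_congr rfl fun ij hij => ?_
    have hij' := Finset.HasAntidiagonal.mem_antidiagonal.1 hij
    have h1 := hrec ij.1 (by omega) (m + ij.2) (n + l)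
    rw [← Nat.choose_symm_of_eq_add (show l = ij.1 + ij.2 by omega)]
    push_cast at h1 ⊢
    rw [show m + (ij.2 + 1) = m + ij.2 + 1 by ring, show n + (l + 1) = n + l + 1 by ring]
    linear_combination (l.choose ij.1 : ℂ) * (-1) ^ ij.1 * h1

/-- The quadratic form is an integral against the positive density $|P|^2e^{-|z|^2}$, with $P=\sum
c_nz^n$. Pointwise bounds on the symbol thereby become bounds on the form. -/
lemma double_sum_mom {V : ℂ → ℂ} (hV : Continuous V) {M : ℝ} (hM : ∀ z, ‖V z‖ ≤ M) (N : ℕ)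
    (c : ℕ → ℂ) (l k : ℕ) :
    ∑ m ∈ Finset.range N, ∑ n ∈ Finset.range N, conj (c m) * c n * mom V (m + l) (n + k)
      = ∫ z, V z * (conj z ^ l * z ^ k) *
        ((‖∑ n ∈ Finset.range N, c n * z ^ n‖ ^ 2 * gw z : ℝ) : ℂ) := by
  have h : ∀ z : ℂ, V z * (conj z ^ l * z ^ k) *
        ((‖∑ n ∈ Finset.range N, c n * z ^ n‖ ^ 2 * gw z : ℝ) : ℂ)
      = ∑ m ∈ Finset.range N, ∑ n ∈ Finset.range N,
        conj (c m) * c n * (V z * (conj z ^ (m + l) * z ^ (n + k) * gw z)) := by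
    intro z
    have h1 : ((‖∑ n ∈ Finset.range N, c n * z ^ n‖ ^ 2 : ℝ) : ℂ)
        = ∑ m ∈ Finset.range N, ∑ n ∈ Finset.range N, conj (c m * z ^ m) * (c n * z ^ n) := by
      rw [← Complex.normSq_eq_norm_sq, ← Complex.mul_conj, mul_comm, map_sum,
        Finset.sum_mul_sum]
    rw [Complex.ofReal_mul, h1, Finset.sum_mul, Finset.mul_sum]
    refine Finset.sum_congr rfl fun m _ => ?_
    rw [Finset.sum_mul, Finset.mul_sum]
    refine Finset.sum_congr rfl fun n _ => ?_
    simp only [map_mul, map_pow]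
    ring
  simp only [h]
  have hi := fun m n => integrable_mom hV hM m n
  rw [integral_finsetSum _ fun m _ => integrable_finsetSum _ fun n _ => (hi _ _).const_mul _]
  refine Finset.sum_congr rfl fun m _ => ?_
  rw [integral_finsetSum _ fun n _ => (hi _ _).const_mul _]
  refine Finset.sum_congr rfl fun n _ => ?_
  rw [integral_const_mul, mom]

lemma integral_poly_sq (N : ℕ) (w : ℕ → ℂ) :
    ∫ z, ‖∑ n ∈ Finset.range N, w n * (((Real.sqrt (nrm n))⁻¹ : ℝ) : ℂ) * z ^ n‖ ^ 2 * gw z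
      = ∑ n ∈ Finset.range N, ‖w n‖ ^ 2 := by
  have h := double_sum_mom (V := fun _ => 1) continuous_const (M := 1) (by simp) N
    (fun n => w n * (((Real.sqrt (nrm n))⁻¹ : ℝ) : ℂ)) 0 0
  simp only [pow_zero, mul_one, one_mul, add_zero, mom_one, mul_ite, mul_zero] at h
  rw [integral_complex_ofReal] at h
  refine Complex.ofReal_injective (h.symm.trans ?_)
  rw [Complex.ofReal_sum]
  refine Finset.sum_congr rfl fun m hm => ?_
  rw [Finset.sum_ite_eq, if_pos hm]
  have h2 : ((Real.sqrt (nrm m))⁻¹ : ℝ) * (Real.sqrt (nrm m))⁻¹ * nrm m = 1 := by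
    rw [← mul_inv, Real.mul_self_sqrt (nrm_pos m).le, inv_mul_cancel₀ (nrm_pos m).ne']
  have h3 : conj (w m) * w m = ((‖w m‖ ^ 2 : ℝ) : ℂ) := by
    rw [mul_comm, Complex.mul_conj, Complex.normSq_eq_norm_sq]
  have h4 : ((((Real.sqrt (nrm m))⁻¹ : ℝ) : ℂ) * (((Real.sqrt (nrm m))⁻¹ : ℝ) : ℂ)) * nrm m = 1 := by
    exact_mod_cast h2
  rw [map_mul, Complex.conj_ofReal, ← h3]
  linear_combination (conj (w m) * w m) * h4

lemma integrable_poly_sq (N : ℕ) (c : ℕ → ℂ) :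
    Integrable fun z : ℂ => ‖∑ n ∈ Finset.range N, c n * z ^ n‖ ^ 2 * gw z := by
  have h : Integrable fun z : ℂ => ∑ m ∈ Finset.range N, ∑ n ∈ Finset.range N,
      conj (c m) * c n * ((1 : ℂ) * (conj z ^ m * z ^ n * gw z)) :=
    integrable_finsetSum _ fun m _ => integrable_finsetSum _ fun n _ =>
      (integrable_mom (V := fun _ => 1) continuous_const (M := 1) (by simp) m n).const_mul _
  refine (h.re).congr (Eventually.of_forall fun z => ?_)
  have h1 : ((‖∑ n ∈ Finset.range N, c n * z ^ n‖ ^ 2 * gw z : ℝ) : ℂ)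
      = ∑ m ∈ Finset.range N, ∑ n ∈ Finset.range N,
        conj (c m) * c n * ((1 : ℂ) * (conj z ^ m * z ^ n * gw z)) := by
    rw [Complex.ofReal_mul, ← Complex.normSq_eq_norm_sq, ← Complex.mul_conj, mul_comm _ (conj _),
      map_sum, Finset.sum_mul_sum, Finset.sum_mul]
    refine Finset.sum_congr rfl fun m _ => ?_
    rw [Finset.sum_mul]
    refine Finset.sum_congr rfl fun n _ => ?_
    simp only [map_mul, map_pow]
    ring
  simp only [← h1, RCLike.re_to_complex, Complex.ofReal_re]

/-- The commutator bound under weighted bounds on the derivatives up to order `k`. -/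
lemma commBound_ascFactorial {V : ℂ → ℝ} {T : fock →L[ℂ] fock} (hT : ∀ v w : fock,
      inner ℂ v (T w) = ∫ z, (V z : ℂ) * (conj ((v : Lp ℂ 2 (volume : Measure ℂ)) z) *
        (w : Lp ℂ 2 (volume : Measure ℂ)) z)) (hV : ContDiff ℝ ∞ V) {k : ℕ} {C : ℝ}
    (hb : ∀ j ≤ k, ∃ M, ∀ z, ‖dzIter j V z‖ ≤ M) (hC0 : 0 ≤ C)
    (hC : ∀ j, 1 ≤ j → j ≤ k → ∀ z, ‖z ^ (2 * k - j) * dzIter j V z‖ ≤ C) :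
    CommBound T (fun n => ((n + 1).ascFactorial k : ℝ))
      ((∑ ij ∈ Finset.HasAntidiagonal.antidiagonal k, (k.choose ij.1 : ℝ)) * C) := by
  intro N w
  set c : ℕ → ℂ := fun n => w n * (((Real.sqrt (nrm n))⁻¹ : ℝ) : ℂ) with hc
  set ν : ℂ → ℝ := fun z => ‖∑ n ∈ Finset.range N, c n * z ^ n‖ ^ 2 * gw z with hν
  have hν0 (z) : 0 ≤ ν z := mul_nonneg (sq_nonneg _) (gw_pos z).le
  have hs := contDiff_dzIter hV
  have hmn : ∀ m n, conj (w m) * ((((n + 1).ascFactorial k : ℝ) : ℂ) * w n) *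
      inner ℂ (basisVec m) (T (basisVec n))
      = ∑ ij ∈ Finset.HasAntidiagonal.antidiagonal k, (k.choose ij.1 : ℂ) * (-1) ^ ij.1 *
        (conj (c m) * c n * mom (dzIter ij.1 V) (m + ij.2) (n + k)) := by
    intro m n
    have h := ascFactorial_mul_mom hs (fun j => (dzIter_succ V j).symm) hb m n k le_rfl
    rw [toeplitz_basisVec hT, ← dzIter_zero]
    have h2 : conj (c m) * c n * ((((n + 1).ascFactorial k : ℕ) : ℂ) * mom (dzIter 0 V) m n)
        = ∑ ij ∈ Finset.HasAntidiagonal.antidiagonal k, (k.choose ij.1 : ℂ) * (-1) ^ ij.1 *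
        (conj (c m) * c n * mom (dzIter ij.1 V) (m + ij.2) (n + k)) := by
      rw [h, Finset.mul_sum]
      exact Finset.sum_congr rfl fun ij _ => by ring
    rw [← h2]
    simp only [hc, map_mul, Complex.conj_ofReal]
    push_cast
    ring
  have hsum : ∑ m ∈ Finset.range N, ∑ n ∈ Finset.range N,
      conj (w m) * ((((n + 1).ascFactorial k : ℝ) : ℂ) * w n) *
        inner ℂ (basisVec m) (T (basisVec n))
      = ∑ ij ∈ Finset.HasAntidiagonal.antidiagonal k, (k.choose ij.1 : ℂ) * (-1) ^ ij.1 *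
        ∫ z, dzIter ij.1 V z * (conj z ^ ij.2 * z ^ k) * (ν z : ℂ) := by
    simp only [hmn]
    rw [Finset.sum_congr rfl fun m _ => Finset.sum_comm, Finset.sum_comm]
    refine Finset.sum_congr rfl fun ij hij => ?_
    have hij' := Finset.HasAntidiagonal.mem_antidiagonal.1 hij
    obtain ⟨M, hM⟩ := hb ij.1 (by omega)
    rw [← double_sum_mom (hs ij.1).continuous hM, Finset.mul_sum]
    refine Finset.sum_congr rfl fun m _ => ?_
    rw [Finset.mul_sum]
  rw [hsum, Complex.im_sum, ← integral_poly_sq N w, mul_assoc, Finset.sum_mul]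
  refine (Finset.abs_sum_le_sum_abs _ _).trans (Finset.sum_le_sum fun ij hij => ?_)
  have hij' := Finset.HasAntidiagonal.mem_antidiagonal.1 hij
  have hνint : 0 ≤ C * ∫ z, ν z := mul_nonneg hC0 (integral_nonneg hν0)
  have hsgn : ((k.choose ij.1 : ℂ) * (-1) ^ ij.1 *
      ∫ z, dzIter ij.1 V z * (conj z ^ ij.2 * z ^ k) * (ν z : ℂ)).im
      = ((k.choose ij.1 : ℝ) * (-1) ^ ij.1) *
        (∫ z, dzIter ij.1 V z * (conj z ^ ij.2 * z ^ k) * (ν z : ℂ)).im := by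
    rw [← Complex.im_ofReal_mul]; push_cast; rfl
  rw [hsgn, abs_mul, abs_mul, abs_pow, abs_neg, abs_one, one_pow, mul_one, Nat.abs_cast]
  refine mul_le_mul_of_nonneg_left ?_ (Nat.cast_nonneg _)
  -- The undifferentiated term has the real symbol $V|z|^{2k}$ and no imaginary part. For $i\ge1$
  -- the symbol $\partial_z^iV\,\bar z^{k-i}z^k$ has modulus $|z|^{2k-i}|\partial_z^iV|\le C$.
  rcases Nat.eq_zero_or_pos ij.1 with h0 | h0
  · have h1 : ∀ z, dzIter ij.1 V z * (conj z ^ ij.2 * z ^ k) * (ν z : ℂ)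
        = ((V z * ‖z‖ ^ (2 * k) * ν z : ℝ) : ℂ) := by
      intro z
      rw [h0, show ij.2 = k by omega, conj_pow_mul_pow_self, dzIter_zero]
      push_cast; rfl
    simp only [h1]
    rw [integral_complex_ofReal, Complex.ofReal_im, abs_zero]
    exact hνint
  · refine (Complex.abs_im_le_norm _).trans ?_
    rw [← integral_const_mul]
    refine norm_integral_le_of_norm_le ((integrable_poly_sq N c).const_mul C)
      (Eventually.of_forall fun z => ?_)
    rw [norm_mul, Complex.norm_real, Real.norm_of_nonneg (hν0 z)]
    refine mul_le_mul_of_nonneg_right ?_ (hν0 z)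
    have h1 := hC ij.1 h0 (by omega) z
    rw [norm_mul, norm_pow] at h1
    rw [norm_mul, norm_mul, norm_pow, norm_pow, RCLike.norm_conj, ← pow_add, mul_comm,
      show ij.2 + k = 2 * k - ij.1 by omega]
    exact h1

/-! ### Decay of the matrix elements -/

/-- The matrix elements of the multiplication by `V` in the normalized monomials. -/
def mat (V : ℂ → ℂ) (m n : ℕ) : ℂ :=
  (((Real.sqrt (nrm m))⁻¹ * (Real.sqrt (nrm n))⁻¹ : ℝ) : ℂ) * mom V m n

lemma mat_eq_integral (V : ℂ → ℂ) (m n : ℕ) :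
    mat V m n = ∫ z, V z * (conj (basisFun m z) * basisFun n z) := by
  rw [mat, mom, ← integral_const_mul]
  refine integral_congr_ae (Eventually.of_forall fun z => ?_)
  simp only
  rw [show basisFun n z = ((((Real.sqrt (nrm n))⁻¹ : ℝ) : ℂ) * z ^ n) * gauss z from rfl,
    conj_basisFun_mul]
  push_cast; ring

/-- The density $|e_n|^2$ has negative moments $\int\langle
z\rangle^{-4q}|e_n|^2\lesssim(n+1)^{-2q}$. The weighted inequality
$p|e_m||e_n|\le\frac12(\eta|e_m|^2+\eta^{-1}p^2|e_n|^2)$ with $\eta=(n+1)^{-q}$ balances the two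
terms and gives decay in $n$ uniformly in $m$. -/
lemma norm_mat_le {V : ℂ → ℂ} {q : ℕ} {D : ℝ} (hD : 0 ≤ D)
    (hV : ∀ z, ‖V z‖ ≤ D * ((1 + ‖z‖ ^ 2) ^ q)⁻¹) (m n : ℕ) :
    ‖mat V m n‖ ≤ D * ((1 + (2 * (q : ℝ) + 1) ^ (2 * q)) / 2) * (((n : ℝ) + 1) ^ q)⁻¹ := by
  have hη : (0 : ℝ) < (((n : ℝ) + 1) ^ q)⁻¹ := by positivity
  set η : ℝ := (((n : ℝ) + 1) ^ q)⁻¹ with hηdef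
  have hn2 := integral_inv_pow_mul_basisFun_le (2 * q) n
  have hη2 : (((n : ℝ) + 1) ^ (2 * q))⁻¹ = η * η := by
    rw [hηdef, ← mul_inv, ← pow_add]; congr 2; ring
  rw [hη2] at hn2
  rw [mat_eq_integral]
  have hint : Integrable fun z : ℂ => D / 2 * (η * ‖basisFun m z‖ ^ 2
      + η⁻¹ * (((1 + ‖z‖ ^ 2) ^ (2 * q))⁻¹ * ‖basisFun n z‖ ^ 2)) :=
    (((integrable_basisFun_sq m).const_mul _).add
      ((integrable_inv_pow_mul_basisFun (2 * q) n).const_mul _)).const_mul _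
  refine (norm_integral_le_of_norm_le hint (Eventually.of_forall fun z => ?_)).trans ?_
  · rw [norm_mul, norm_mul, RCLike.norm_conj]
    set p : ℝ := ((1 + ‖z‖ ^ 2) ^ q)⁻¹ with hp
    have hp2 : ((1 + ‖z‖ ^ 2) ^ (2 * q))⁻¹ = p * p := by
      rw [hp, ← mul_inv, ← pow_add]; congr 2; ring
    have hp0 : 0 < p := by positivity
    rw [hp2]
    have h1 := sq_nonneg (η * ‖basisFun m z‖ - p * ‖basisFun n z‖)
    have h2 : p * (‖basisFun m z‖ * ‖basisFun n z‖) ≤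
        1 / 2 * (η * ‖basisFun m z‖ ^ 2 + η⁻¹ * (p * p * ‖basisFun n z‖ ^ 2)) := by
      have h3 : 1 / 2 * (η * ‖basisFun m z‖ ^ 2 + η⁻¹ * (p * p * ‖basisFun n z‖ ^ 2))
          - p * (‖basisFun m z‖ * ‖basisFun n z‖)
          = η⁻¹ / 2 * (η * ‖basisFun m z‖ - p * ‖basisFun n z‖) ^ 2 := by
        field_simp; ring
      have : 0 ≤ η⁻¹ / 2 * (η * ‖basisFun m z‖ - p * ‖basisFun n z‖) ^ 2 := by positivity
      linarith
    calc _ ≤ D * p * (‖basisFun m z‖ * ‖basisFun n z‖) := by gcongr; exact hV z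
      _ = D * (p * (‖basisFun m z‖ * ‖basisFun n z‖)) := by ring
      _ ≤ D * (1 / 2 * (η * ‖basisFun m z‖ ^ 2 + η⁻¹ * (p * p * ‖basisFun n z‖ ^ 2))) := by
          gcongr
      _ = _ := by ring
  · rw [integral_const_mul, integral_add ((integrable_basisFun_sq m).const_mul _)
      ((integrable_inv_pow_mul_basisFun (2 * q) n).const_mul _), integral_const_mul,
      integral_const_mul, integral_basisFun_sq]
    push_cast at hn2
    calc _ ≤ D / 2 * (η * 1 + η⁻¹ * ((2 * (q : ℝ) + 1) ^ (2 * q) * (η * η))) := by gcongr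
      _ = _ := by field_simp

/-- This is `mom_dz` in normalized form. Strictly above the diagonal the first coefficient is less
than $1$, so moving along a diagonal to infinity expresses an entry of $V$ through entries of
$\partial_zV$. -/
lemma mat_rec {V : ℂ → ℂ} (hV : ContDiff ℝ ∞ V) {M M' : ℝ} (hM : ∀ z, ‖V z‖ ≤ M)
    (hM' : ∀ z, ‖dz V z‖ ≤ M') (m n : ℕ) :
    mat V m n = ((Real.sqrt ((m : ℝ) + 1) / Real.sqrt ((n : ℝ) + 1) : ℝ) : ℂ)
        * mat V (m + 1) (n + 1)
      - (((Real.sqrt ((n : ℝ) + 1))⁻¹ : ℝ) : ℂ) * mat (dz V) m (n + 1) := by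
  have h := mom_dz hV hM hM' m (n + 1)
  rw [Nat.add_sub_cancel] at h
  have hnrm (n : ℕ) : nrm (n + 1) = ((n : ℝ) + 1) * nrm n := by
    unfold nrm; rw [Nat.factorial_succ]; push_cast; ring
  have hs (n : ℕ) : Real.sqrt (nrm (n + 1)) = Real.sqrt ((n : ℝ) + 1) * Real.sqrt (nrm n) := by
    rw [hnrm, Real.sqrt_mul (by positivity)]
  unfold mat
  rw [hs, hs, ← h]
  have h1 : Real.sqrt (nrm m) ≠ 0 := (Real.sqrt_pos.2 (nrm_pos m)).ne'
  have h2 : Real.sqrt (nrm n) ≠ 0 := (Real.sqrt_pos.2 (nrm_pos n)).ne'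
  have h3 : Real.sqrt ((m : ℝ) + 1) ≠ 0 := (Real.sqrt_pos.2 (by positivity)).ne'
  have h4 : Real.sqrt ((n : ℝ) + 1) ≠ 0 := (Real.sqrt_pos.2 (by positivity)).ne'
  have h5 : ((n : ℂ) + 1) = (Real.sqrt ((n : ℝ) + 1) : ℂ) * (Real.sqrt ((n : ℝ) + 1) : ℂ) := by
    rw [← Complex.ofReal_mul, Real.mul_self_sqrt (by positivity)]; push_cast; rfl
  have h1' : (Real.sqrt (nrm m) : ℂ) ≠ 0 := by exact_mod_cast h1
  have h2' : (Real.sqrt (nrm n) : ℂ) ≠ 0 := by exact_mod_cast h2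
  have h3' : (Real.sqrt ((m : ℝ) + 1) : ℂ) ≠ 0 := by exact_mod_cast h3
  have h4' : (Real.sqrt ((n : ℝ) + 1) : ℂ) ≠ 0 := by exact_mod_cast h4
  push_cast
  rw [h5]
  field_simp
  ring

/-- The error produced by one step of `mat_rec` is dominated by a telescoping difference, by
Bernoulli's inequality; this is where $\gamma\ge1$ enters. -/
lemma rpow_neg_step {x γ : ℝ} (hx : 1 ≤ x) (hγ : 1 ≤ γ) :
    (Real.sqrt x)⁻¹ * (x + 1) ^ (-(γ + 1 / 2)) ≤ x ^ (-γ) - (x + 1) ^ (-γ) := by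
  have hx0 : 0 < x := by linarith
  have h1 : 1 + γ * x⁻¹ ≤ (1 + x⁻¹) ^ γ :=
    one_add_mul_self_le_rpow_one_add (by have := inv_pos.2 hx0; linarith) hγ
  have h2 : x ^ (-γ) = (x + 1) ^ (-γ) * (1 + x⁻¹) ^ γ := by
    rw [show 1 + x⁻¹ = (x + 1) / x by field_simp, Real.div_rpow (by linarith) hx0.le,
      Real.rpow_neg hx0.le, Real.rpow_neg (by linarith)]
    have : 0 < (x + 1) ^ γ := by positivity
    field_simp
  have h3 : (x + 1) ^ (-(γ + 1 / 2)) = (x + 1) ^ (-γ) * (Real.sqrt (x + 1))⁻¹ := by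
    rw [neg_add, Real.rpow_add (by linarith), Real.sqrt_eq_rpow, ← Real.rpow_neg (by linarith)]
  have h4 : (Real.sqrt x)⁻¹ * (Real.sqrt (x + 1))⁻¹ ≤ x⁻¹ := by
    rw [← mul_inv]
    refine inv_anti₀ hx0 ?_
    calc x = Real.sqrt x * Real.sqrt x := (Real.mul_self_sqrt hx0.le).symm
      _ ≤ _ := by gcongr; linarith
  have h5 : (0 : ℝ) < (x + 1) ^ (-γ) := by positivity
  have h6 : x⁻¹ ≤ (1 + x⁻¹) ^ γ - 1 := by
    have := inv_pos.2 hx0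
    nlinarith
  calc _ = (x + 1) ^ (-γ) * ((Real.sqrt x)⁻¹ * (Real.sqrt (x + 1))⁻¹) := by rw [h3]; ring
    _ ≤ (x + 1) ^ (-γ) * ((1 + x⁻¹) ^ γ - 1) := by gcongr; exact h4.trans h6
    _ = _ := by rw [h2]; ring

/-- Decay of the strictly upper triangular matrix elements is inherited by antiderivatives. -/
lemma norm_mat_le_of_dz {V : ℂ → ℂ} (hV : ContDiff ℝ ∞ V) {M M' : ℝ} (hM : ∀ z, ‖V z‖ ≤ M)
    (hM' : ∀ z, ‖dz V z‖ ≤ M') {B γ : ℝ} (hγ : 1 ≤ γ) (hB : 0 ≤ B)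
    (h : ∀ m n, m < n → ‖mat (dz V) m n‖ ≤ B * ((n : ℝ) + 1) ^ (-(γ + 1 / 2))) {m n : ℕ}
    (hmn : m < n) : ‖mat V m n‖ ≤ B * ((n : ℝ) + 1) ^ (-γ) := by
  have hM0 : 0 ≤ M := (norm_nonneg _).trans (hM 0)
  have hbd (m n) : ‖mat V m n‖ ≤ M := by
    have := norm_mat_le (q := 0) hM0 (fun z => by simpa using hM z) m n
    norm_num at this
    exact this
  -- These numbers bound the product of the first $i$ ratios $\sqrt{(m+j+1)/(n+j+1)}$, using $m+1\le
  -- n$, and they tend to $0$.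
  set p : ℕ → ℝ := fun i => Real.sqrt (((m : ℝ) + 1) / (m + 1 + i)) with hp
  have hp0 (i) : 0 ≤ p i := Real.sqrt_nonneg _
  have hp1 (i) : p i ≤ 1 := by
    rw [hp]; refine Real.sqrt_le_one.2 ((div_le_one (by positivity)).2 ?_)
    linarith [i.cast_nonneg (α := ℝ)]
  have hpr (i : ℕ) : p i * (Real.sqrt ((m + i : ℕ) + 1) / Real.sqrt ((n + i : ℕ) + 1))
      ≤ p (i + 1) := by
    simp only [hp]
    rw [← Real.sqrt_div (by positivity), ← Real.sqrt_mul (by positivity)]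
    refine Real.sqrt_le_sqrt ?_
    have h1 : (m : ℝ) + 1 ≤ n := by exact_mod_cast hmn
    push_cast
    rw [div_mul_div_comm, div_le_div_iff₀ (by positivity) (by positivity)]
    have h2 : (0 : ℝ) ≤ (m + 1) * (m + 1 + i) := by positivity
    nlinarith
  -- The quantity $p_i|V_{m+i,n+i}|-B(n+i+1)^{-\gamma}$ is nondecreasing in $i$. Since it is at most
  -- $p_iM\to0$, its value at $i=0$ is nonpositive, which is the claim.
  have hstep (i : ℕ) : p i * ‖mat V (m + i) (n + i)‖ - B * ((n : ℝ) + i + 1) ^ (-γ)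
      ≤ p (i + 1) * ‖mat V (m + (i + 1)) (n + (i + 1))‖
        - B * ((n : ℝ) + (i + 1 : ℕ) + 1) ^ (-γ) := by
    have h1 : ‖mat V (m + i) (n + i)‖ ≤
        Real.sqrt ((m + i : ℕ) + 1) / Real.sqrt ((n + i : ℕ) + 1) *
          ‖mat V (m + (i + 1)) (n + (i + 1))‖ +
        (Real.sqrt ((n + i : ℕ) + 1))⁻¹ * (B * (((n + i + 1 : ℕ) : ℝ) + 1) ^ (-(γ + 1 / 2))) := by
      rw [mat_rec hV hM hM' (m + i) (n + i)]
      refine (norm_sub_le _ _).trans (add_le_add ?_ ?_)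
      · rw [norm_mul, Complex.norm_real, Real.norm_of_nonneg (by positivity)]
        exact le_rfl
      · rw [norm_mul, Complex.norm_real, Real.norm_of_nonneg (by positivity)]
        gcongr
        exact h _ _ (by omega)
    have h2 := rpow_neg_step (x := (n : ℝ) + i + 1) (by
      linarith [i.cast_nonneg (α := ℝ), n.cast_nonneg (α := ℝ)]) hγ
    push_cast at h1 hpr ⊢
    have h3 : p i * ((Real.sqrt ((n : ℝ) + i + 1))⁻¹ *
        (B * ((n : ℝ) + i + 1 + 1) ^ (-(γ + 1 / 2))))
        ≤ B * (((n : ℝ) + i + 1) ^ (-γ) - ((n : ℝ) + i + 1 + 1) ^ (-γ)) := by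
      calc _ ≤ 1 * ((Real.sqrt ((n : ℝ) + i + 1))⁻¹ *
            (B * ((n : ℝ) + i + 1 + 1) ^ (-(γ + 1 / 2)))) := by gcongr; exact hp1 i
        _ = B * ((Real.sqrt ((n : ℝ) + i + 1))⁻¹ * ((n : ℝ) + i + 1 + 1) ^ (-(γ + 1 / 2))) := by
            ring
        _ ≤ _ := by gcongr
    have h4 := mul_le_mul_of_nonneg_right (hpr i)
      (norm_nonneg (mat V (m + (i + 1)) (n + (i + 1))))
    have h5 := mul_le_mul_of_nonneg_left h1 (hp0 i)
    rw [show (n : ℝ) + (i + 1) + 1 = n + i + 1 + 1 by ring]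
    nlinarith
  have hall (i : ℕ) : ‖mat V m n‖ - B * ((n : ℝ) + 1) ^ (-γ) ≤ p i * M := by
    have h1 := monotone_nat_of_le_succ (f := fun i : ℕ => p i * ‖mat V (m + i) (n + i)‖
      - B * ((n : ℝ) + i + 1) ^ (-γ)) hstep (Nat.zero_le i)
    have h2 : p 0 = 1 := by
      simp only [hp, Nat.cast_zero, add_zero]
      rw [div_self (by positivity), Real.sqrt_one]
    simp only [h2, Nat.cast_zero, add_zero, one_mul] at h1
    refine h1.trans ?_
    have h3 : 0 ≤ B * ((n : ℝ) + i + 1) ^ (-γ) := by positivity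
    have h4 := mul_le_mul_of_nonneg_left (hbd (m + i) (n + i)) (hp0 i)
    linarith
  have hplim : Tendsto (fun i => p i * M) atTop (𝓝 0) := by
    have h1 : Tendsto (fun i : ℕ => ((m : ℝ) + 1) / (m + 1 + i)) atTop (𝓝 0) :=
      tendsto_const_nhds.div_atTop
        (tendsto_atTop_add_const_left _ _ tendsto_natCast_atTop_atTop)
    have h2 := ((Real.continuous_sqrt.tendsto 0).comp h1).mul_const M
    rw [Real.sqrt_zero, zero_mul] at h2
    exact h2
  have := ge_of_tendsto' hplim hall
  linarith

/-- Off-diagonal decay of the matrix elements of a real potential. -/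
lemma exists_norm_mat_le {k : ℕ} (hk : 2 ≤ k) {D : ℕ → ℝ} (hD : ∀ j, 0 ≤ D j) :
    ∃ B, 0 ≤ B ∧ ∀ V : ℂ → ℝ, ContDiff ℝ ∞ V →
      (∀ j ≤ k, ∀ z, ‖dzIter j V z‖ ≤ D j * ((1 + ‖z‖ ^ 2) ^ j)⁻¹) →
      ∀ m n, m < n → ‖mat (dzIter 0 V) m n‖ ≤ B * ((n : ℝ) + 1) ^ (-((k : ℝ) / 2)) := by
  refine ⟨D k * ((1 + (2 * (k : ℝ) + 1) ^ (2 * k)) / 2), mul_nonneg (hD k) (by positivity),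
    fun V hV hb => ?_⟩
  set B := D k * ((1 + (2 * (k : ℝ) + 1) ^ (2 * k)) / 2) with hBdef
  have hB : 0 ≤ B := mul_nonneg (hD k) (by positivity)
  have hbd : ∀ j ≤ k, ∀ z, ‖dzIter j V z‖ ≤ D j := fun j hj z => by
    refine (hb j hj z).trans (mul_le_of_le_one_right (hD j)
      (inv_le_one_of_one_le₀ (one_le_pow₀ ?_)))
    nlinarith [sq_nonneg ‖z‖]
  -- Start from $\partial_z^kV$ with decay $n^{-k}$ and undo one derivative at a time, losing half a
  -- power each time. The last exponent is $k/2\ge1$, so `norm_mat_le_of_dz` applies throughout.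
  have hind : ∀ d ≤ k, ∀ m n, m < n →
      ‖mat (dzIter (k - d) V) m n‖ ≤ B * ((n : ℝ) + 1) ^ (-((k : ℝ) - d / 2)) := by
    intro d
    induction d with
    | zero =>
      intro _ m n _
      have := norm_mat_le (hD k) (hb k le_rfl) m n
      simpa [Real.rpow_neg (show (0:ℝ) ≤ (n : ℝ) + 1 by positivity)] using this
    | succ d ih =>
      intro hd m n hmn
      have h1 : dz (dzIter (k - (d + 1)) V) = dzIter (k - d) V := by
        rw [← dzIter_succ]; congr 1; omega
      have h2 : (d : ℝ) + 1 ≤ k := by exact_mod_cast hd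
      have h3 : (2 : ℝ) ≤ k := by exact_mod_cast hk
      refine norm_mat_le_of_dz (contDiff_dzIter hV _) (hbd _ (by omega))
        (M' := D (k - d)) (by rw [h1]; exact hbd _ (by omega)) (by push_cast; linarith) hB
        (fun m n hmn => ?_) hmn
      rw [h1]
      refine (ih (by omega) m n hmn).trans_eq ?_
      congr 3
      push_cast; ring
  intro m n hmn
  have h := hind k le_rfl m n hmn
  rw [Nat.sub_self] at h
  refine h.trans_eq ?_
  congr 3
  ring

/-- The commutator bound for weights of polynomial growth, from off-diagonal decay. -/
lemma exists_commBound_of_decay (p : ℕ) {A B : ℝ} (hA : 0 ≤ A) (hB : 0 ≤ B) :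
    ∃ K, 0 ≤ K ∧ ∀ (T : fock →L[ℂ] fock) (a : ℕ → ℝ), (∀ n, 0 ≤ a n) →
      (∀ n, a n ≤ A * ((n : ℝ) + 1) ^ p) →
      (∀ v w, inner ℂ v (T w) = conj (inner ℂ w (T v))) →
      (∀ m n, m < n →
        ‖inner ℂ (basisVec m) (T (basisVec n))‖ ≤ B * (((n : ℝ) + 1) ^ (p + 4))⁻¹) →
      CommBound T a K := by
  have hsum : Summable fun n : ℕ => (((n : ℝ) + 1) ^ 4)⁻¹ := by
    have := (summable_nat_add_iff (f := fun n : ℕ => ((n : ℝ) ^ 4)⁻¹) 1).2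
      (Real.summable_nat_pow_inv.2 (by norm_num))
    simpa using this
  refine ⟨A * B * ∑' n : ℕ, (((n : ℝ) + 1) ^ 4)⁻¹, by positivity,
    fun T a ha haA hsymm hT N w => ?_⟩
  -- The weight consumes $p$ of the $p+4$ powers. The remaining four powers of the larger index are
  -- shared equally between $m$ and $n$; symmetry of $T$ handles entries below the diagonal.
  have hdecay : ∀ m n, m ≠ n → a n * ‖inner ℂ (basisVec m) (T (basisVec n))‖
      ≤ A * B * ((((m : ℝ) + 1) ^ 2)⁻¹ * (((n : ℝ) + 1) ^ 2)⁻¹) := by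
    intro m n hmn
    rcases lt_or_gt_of_ne hmn with h | h
    · have h1 : (m : ℝ) ≤ n := by exact_mod_cast h.le
      calc _ ≤ (A * ((n : ℝ) + 1) ^ p) * (B * (((n : ℝ) + 1) ^ (p + 4))⁻¹) := by
            gcongr
            · exact haA n
            · exact hT m n h
        _ = A * B * ((((n : ℝ) + 1) ^ 2)⁻¹ * (((n : ℝ) + 1) ^ 2)⁻¹) := by
            rw [pow_add]; field_simp
        _ ≤ _ := by gcongr
    · have h1 : (n : ℝ) ≤ m := by exact_mod_cast h.le
      have h2 : ‖inner ℂ (basisVec m) (T (basisVec n))‖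
          = ‖inner ℂ (basisVec n) (T (basisVec m))‖ := by
        rw [hsymm, RCLike.norm_conj]
      rw [h2]
      calc _ ≤ (A * ((n : ℝ) + 1) ^ p) * (B * (((m : ℝ) + 1) ^ (p + 4))⁻¹) := by
            gcongr
            · exact haA n
            · exact hT n m h
        _ ≤ (A * ((m : ℝ) + 1) ^ p) * (B * (((m : ℝ) + 1) ^ (p + 4))⁻¹) := by gcongr
        _ = A * B * ((((m : ℝ) + 1) ^ 2)⁻¹ * (((m : ℝ) + 1) ^ 2)⁻¹) := by
            rw [pow_add]; field_simp
        _ ≤ _ := by gcongr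
  have hterm : ∀ m n, |(conj (w m) * (a n * w n) * inner ℂ (basisVec m) (T (basisVec n))).im|
      ≤ A * B * ((‖w m‖ * (((m : ℝ) + 1) ^ 2)⁻¹) * (‖w n‖ * (((n : ℝ) + 1) ^ 2)⁻¹)) := by
    intro m n
    -- Diagonal entries are real by symmetry and contribute nothing, so no decay is required of
    -- them.
    by_cases hmn : m = n
    · subst hmn
      have h1 : (conj (w m) * (a m * w m) * inner ℂ (basisVec m) (T (basisVec m))).im = 0 := by
        rw [← Complex.conj_eq_iff_im]
        simp only [map_mul, Complex.conj_ofReal, Complex.conj_conj]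
        rw [← hsymm]; ring
      rw [h1, abs_zero]; positivity
    · refine (Complex.abs_im_le_norm _).trans ?_
      rw [norm_mul, norm_mul, norm_mul, RCLike.norm_conj, Complex.norm_real,
        Real.norm_of_nonneg (ha n)]
      calc _ = ‖w m‖ * ‖w n‖ * (a n * ‖inner ℂ (basisVec m) (T (basisVec n))‖) := by ring
        _ ≤ ‖w m‖ * ‖w n‖ * (A * B * ((((m : ℝ) + 1) ^ 2)⁻¹ * (((n : ℝ) + 1) ^ 2)⁻¹)) := by
            exact mul_le_mul_of_nonneg_left (hdecay m n hmn) (by positivity)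
        _ = _ := by ring
  have hcs : (∑ n ∈ Finset.range N, ‖w n‖ * (((n : ℝ) + 1) ^ 2)⁻¹) ^ 2
      ≤ (∑ n ∈ Finset.range N, ‖w n‖ ^ 2) * ∑' n : ℕ, (((n : ℝ) + 1) ^ 4)⁻¹ := by
    refine (Finset.sum_mul_sq_le_sq_mul_sq _ _ _).trans ?_
    gcongr
    refine (Finset.sum_le_sum fun n _ => le_of_eq ?_).trans
      (hsum.sum_le_tsum (Finset.range N) fun n _ => by positivity)
    rw [inv_pow, ← pow_mul]
  rw [Complex.im_sum]
  calc _ ≤ ∑ m ∈ Finset.range N, ∑ n ∈ Finset.range N, A * B *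
        ((‖w m‖ * (((m : ℝ) + 1) ^ 2)⁻¹) * (‖w n‖ * (((n : ℝ) + 1) ^ 2)⁻¹)) := by
        refine (Finset.abs_sum_le_sum_abs _ _).trans (Finset.sum_le_sum fun m _ => ?_)
        rw [Complex.im_sum]
        exact (Finset.abs_sum_le_sum_abs _ _).trans (Finset.sum_le_sum fun n _ => hterm m n)
    _ = A * B * (∑ n ∈ Finset.range N, ‖w n‖ * (((n : ℝ) + 1) ^ 2)⁻¹) ^ 2 := by
        rw [sq, Finset.sum_mul_sum, Finset.mul_sum]
        refine Finset.sum_congr rfl fun m _ => ?_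
        rw [Finset.mul_sum]
    _ ≤ A * B * ((∑ n ∈ Finset.range N, ‖w n‖ ^ 2) * ∑' n : ℕ, (((n : ℝ) + 1) ^ 4)⁻¹) := by
        gcongr
    _ = _ := by ring

/-! ### Growth of the weighted norms -/

/-- For a continuous function an almost everywhere bound holds everywhere. The maximum with $0$
appears because `ENNReal.ofReal` sends negative constants to $0$. -/
lemma norm_le_of_eLpNorm_top_le {f : ℂ → ℂ} (hf : Continuous f) {C : ℝ}
    (h : eLpNorm f ⊤ volume ≤ ENNReal.ofReal C) (z : ℂ) : ‖f z‖ ≤ max C 0 := by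
  have hae : ∀ᵐ z, ‖f z‖ ≤ max C 0 := by
    filter_upwards [ae_le_eLpNormEssSup (f := f) (μ := volume)] with z hz
    rw [← eLpNorm_exponent_top] at hz
    have h1 := hz.trans h
    rw [← ofReal_norm] at h1
    exact (ENNReal.ofReal_le_ofReal_iff (le_max_right _ _)).1
      (h1.trans (ENNReal.ofReal_le_ofReal (le_max_left _ _)))
  have hcl : IsClosed {z | ‖f z‖ ≤ max C 0} := isClosed_le hf.norm continuous_const
  have hd := Measure.dense_of_ae hae
  have := hd.closure_eq
  rw [hcl.closure_eq] at this
  exact this.ge (Set.mem_univ z)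

lemma one_le_bracket {E : Type*} [NormedAddCommGroup E] (z : E) : 1 ≤ bracket z :=
  Real.one_le_sqrt.2 (by nlinarith [sq_nonneg ‖z‖])

lemma norm_le_bracket {E : Type*} [NormedAddCommGroup E] (z : E) : ‖z‖ ≤ bracket z :=
  Real.le_sqrt_of_sq_le (by linarith)

lemma bracket_pow_two_mul (z : ℂ) (k : ℕ) : bracket z ^ (2 * k) = (1 + ‖z‖ ^ 2) ^ k := by
  rw [pow_mul, bracket, Real.sq_sqrt (by positivity)]

/-! ### Comparison of the weights $\langle z\rangle^{2s}$ and $(n+1)^s$ -/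

/-- The squared weighted norm of the `n`-th basis function. -/
def wgt (s : ℝ) (n : ℕ) : ℝ≥0∞ :=
  ∫⁻ z : ℂ, ENNReal.ofReal ((1 + ‖z‖ ^ 2) ^ s * ‖basisFun n z‖ ^ 2)

lemma succ_pow_le_ascFactorial (k n : ℕ) :
    ((n : ℝ) + 1) ^ k ≤ ((n + 1).ascFactorial k : ℝ) := by
  exact_mod_cast Nat.pow_succ_le_ascFactorial (n + 1) k

lemma ascFactorial_le_mul_succ_pow (k n : ℕ) :
    ((n + 1).ascFactorial k : ℝ) ≤ ((k : ℝ) + 1) ^ k * ((n : ℝ) + 1) ^ k := by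
  have h : ((n + 1).ascFactorial k : ℝ) ≤ ((n : ℝ) + k) ^ k := by
    exact_mod_cast Nat.ascFactorial_le_pow_add n k
  refine h.trans ?_
  rw [← mul_pow]
  refine pow_le_pow_left₀ (by positivity) ?_ _
  nlinarith [mul_nonneg (Nat.cast_nonneg (α := ℝ) n) (Nat.cast_nonneg (α := ℝ) k)]

/-- The integer moments of $|e_n|^2$ are explicit. With $y=1+|z|^2$, $c=n+1$ and $k=\lceil s\rceil$,
either $y\le c$ and $y^s\le c^s$, or $y\ge c$ and $y^s\le c^{s-k}y^k$, whose integral is of order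
$c^s$. -/
lemma exists_wgt_le {s : ℝ} (hs : 0 ≤ s) : ∃ C : ℝ, 0 ≤ C ∧ ∀ n : ℕ,
    wgt s n ≤ ENNReal.ofReal (C * ((n : ℝ) + 1) ^ s) := by
  set k := ⌈s⌉₊
  have hk : s ≤ k := Nat.le_ceil s
  refine ⟨2 ^ (k - 1) * (1 + ((k : ℝ) + 1) ^ k) + 1, by positivity, fun n => ?_⟩
  set c : ℝ := (n : ℝ) + 1
  have hc : 1 ≤ c := by simp [c]
  have hc0 : 0 < c := by linarith
  have hpt : ∀ z : ℂ, (1 + ‖z‖ ^ 2) ^ s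
      ≤ c ^ (s - k) * (2 ^ (k - 1) * (1 + ‖z‖ ^ (2 * k))) + c ^ s := by
    intro z
    set y : ℝ := 1 + ‖z‖ ^ 2
    have hy : 0 < y := by positivity
    rcases le_total y c with h | h
    · have : y ^ s ≤ c ^ s := Real.rpow_le_rpow hy.le h hs
      have : 0 ≤ c ^ (s - k) * (2 ^ (k - 1) * (1 + ‖z‖ ^ (2 * k))) := by positivity
      linarith
    · have h1 : y ^ k ≤ 2 ^ (k - 1) * (1 + ‖z‖ ^ (2 * k)) := by
        have := add_pow_le zero_le_one (sq_nonneg ‖z‖) k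
        rwa [one_pow, ← pow_mul] at this
      have h2 : y ^ (s - k) ≤ c ^ (s - k) :=
        Real.rpow_le_rpow_of_nonpos hc0 h (by linarith)
      have h3 : y ^ s = y ^ (s - k) * y ^ k := by
        rw [← Real.rpow_natCast, ← Real.rpow_add hy]; congr 1; ring
      have h4 : 0 ≤ c ^ s := by positivity
      rw [h3]
      have : y ^ (s - k) * y ^ k ≤ c ^ (s - k) * (2 ^ (k - 1) * (1 + ‖z‖ ^ (2 * k))) := by gcongr
      linarith
  set e : ℝ := c ^ (s - k) * 2 ^ (k - 1) with he
  have he0 : 0 ≤ e := by positivity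
  have hI1 := (integrable_basisFun_sq n).const_mul (e + c ^ s)
  have hI2 := (integrable_pow_mul_basisFun k n).const_mul e
  calc wgt s n ≤ ∫⁻ z : ℂ, ENNReal.ofReal ((e + c ^ s) * ‖basisFun n z‖ ^ 2
          + e * (‖z‖ ^ (2 * k) * ‖basisFun n z‖ ^ 2)) := by
        refine lintegral_mono fun z => ENNReal.ofReal_le_ofReal ?_
        have := mul_le_mul_of_nonneg_right (hpt z) (sq_nonneg ‖basisFun n z‖)
        refine this.trans (le_of_eq ?_)
        rw [he]; ring
    _ = ENNReal.ofReal ((e + c ^ s) + e * ((n + 1).ascFactorial k : ℝ)) := by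
        have hI : Integrable fun z : ℂ => (e + c ^ s) * ‖basisFun n z‖ ^ 2
          + e * (‖z‖ ^ (2 * k) * ‖basisFun n z‖ ^ 2) := hI1.add hI2
        rw [← ofReal_integral_eq_lintegral_ofReal hI
          (Eventually.of_forall fun z => by simp only [Pi.zero_apply]; positivity),
          integral_add hI1 hI2, integral_const_mul, integral_const_mul, integral_basisFun_sq,
          integral_pow_mul_basisFun, mul_one]
    _ ≤ _ := by
        refine ENNReal.ofReal_le_ofReal ?_
        have h1 := ascFactorial_le_mul_succ_pow k n
        have h2 : c ^ (s - k) * c ^ k = c ^ s := by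
          rw [← Real.rpow_natCast, ← Real.rpow_add hc0]; congr 1; ring
        have h3 : 1 ≤ c ^ k := one_le_pow₀ hc
        calc (e + c ^ s) + e * ((n + 1).ascFactorial k : ℝ)
            ≤ (e * c ^ k + c ^ s) + e * (((k : ℝ) + 1) ^ k * c ^ k) := by
              gcongr
              exact le_mul_of_one_le_right he0 h3
          _ = 2 ^ (k - 1) * (1 + ((k : ℝ) + 1) ^ k) * (c ^ (s - k) * c ^ k) + c ^ s := by
              rw [he]; ring
          _ = _ := by rw [h2]; ring

/-- A Markov argument: by the negative first moment, at least half the mass of $|e_n|^2$ lies where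
$1+|z|^2\ge(n+1)/4$. -/
lemma rpow_le_mul_wgt {s : ℝ} (hs : 0 ≤ s) (n : ℕ) :
    ENNReal.ofReal (((n : ℝ) + 1) ^ s) ≤ ENNReal.ofReal (2 * 4 ^ s) * wgt s n := by
  -- Since $\int(1+|z|^2)^{-1}|e_n|^2\le2/(n+1)$, the divisor $4$ makes the error exactly $c^s/2$,
  -- which is absorbed on the left.
  set c : ℝ := ((n : ℝ) + 1) / 4 with hc
  have hc0 : 0 < c := by positivity
  have hpt : ∀ z : ℂ, c ^ s ≤ (1 + ‖z‖ ^ 2) ^ s + c ^ s * (c * ((1 + ‖z‖ ^ 2) ^ 1)⁻¹) := by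
    intro z
    rw [pow_one]
    set y : ℝ := 1 + ‖z‖ ^ 2
    have hy : 0 < y := by positivity
    have hcs : 0 ≤ c ^ s := by positivity
    rcases le_total c y with h | h
    · have : c ^ s ≤ y ^ s := Real.rpow_le_rpow hc0.le h hs
      have : 0 ≤ c ^ s * (c * y⁻¹) := by positivity
      linarith
    · have h1 : 1 ≤ c * y⁻¹ := by rw [← div_eq_mul_inv, one_le_div hy]; exact h
      have : 0 ≤ y ^ s := by positivity
      nlinarith
  have hI := (integrable_inv_pow_mul_basisFun 1 n).const_mul (c ^ s * c)
  have hle : ENNReal.ofReal (c ^ s) ≤ wgt s n + ENNReal.ofReal (c ^ s / 2) := by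
    calc ENNReal.ofReal (c ^ s) = ∫⁻ z : ℂ, ENNReal.ofReal (c ^ s * ‖basisFun n z‖ ^ 2) := by
          rw [← ofReal_integral_eq_lintegral_ofReal ((integrable_basisFun_sq n).const_mul _)
            (Eventually.of_forall fun z => by simp only [Pi.zero_apply]; positivity),
            integral_const_mul, integral_basisFun_sq, mul_one]
      _ ≤ ∫⁻ z : ℂ, (ENNReal.ofReal ((1 + ‖z‖ ^ 2) ^ s * ‖basisFun n z‖ ^ 2)
            + ENNReal.ofReal (c ^ s * c * (((1 + ‖z‖ ^ 2) ^ 1)⁻¹ * ‖basisFun n z‖ ^ 2))) := by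
          refine lintegral_mono fun z => ?_
          rw [← ENNReal.ofReal_add (by positivity) (by positivity)]
          refine ENNReal.ofReal_le_ofReal ?_
          have := mul_le_mul_of_nonneg_right (hpt z) (sq_nonneg ‖basisFun n z‖)
          refine this.trans (le_of_eq ?_)
          ring
      _ = wgt s n + ENNReal.ofReal (∫ z : ℂ,
            c ^ s * c * (((1 + ‖z‖ ^ 2) ^ 1)⁻¹ * ‖basisFun n z‖ ^ 2)) := by
          rw [lintegral_add_right' _ hI.aestronglyMeasurable.aemeasurable.ennreal_ofReal,
            ofReal_integral_eq_lintegral_ofReal hI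
            (Eventually.of_forall fun z => by simp only [Pi.zero_apply]; positivity), wgt]
      _ ≤ _ := by
          gcongr
          rw [integral_const_mul]
          have h1 := integral_inv_pow_mul_basisFun_le 1 n
          calc _ ≤ c ^ s * c * (((1 : ℕ) + 1 : ℝ) ^ 1 * (((n : ℝ) + 1) ^ 1)⁻¹) := by gcongr
            _ = c ^ s / 2 := by
              rw [hc]; push_cast; field_simp; ring
  have hhalf : ENNReal.ofReal (c ^ s / 2) ≤ wgt s n := by
    rw [← add_halves (c ^ s), ENNReal.ofReal_add (by positivity) (by positivity)] at hle
    rw [add_halves] at hle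
    exact (ENNReal.add_le_add_iff_right ENNReal.ofReal_ne_top).1 hle
  calc ENNReal.ofReal (((n : ℝ) + 1) ^ s) = ENNReal.ofReal (2 * 4 ^ s) *
        ENNReal.ofReal (c ^ s / 2) := by
        rw [← ENNReal.ofReal_mul (by positivity), hc, Real.div_rpow (by positivity) (by norm_num)]
        congr 1; field_simp
    _ ≤ _ := by gcongr

/-- The weighted norm, squared, in terms of the coefficients on the monomial basis. -/
def seqNormSq (s : ℝ) (v : fock) : ℝ≥0∞ :=
  ∑' n : ℕ, ENNReal.ofReal (((n : ℝ) + 1) ^ s * ‖coef n v‖ ^ 2)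

lemma exists_wnorm_sq_le_seqNormSq {s : ℝ} (hs : 0 ≤ s) : ∃ C : ℝ, 0 ≤ C ∧ ∀ v : fock,
    wnorm s v ^ 2 ≤ ENNReal.ofReal C * seqNormSq s v := by
  obtain ⟨C, hC0, hC⟩ := exists_wgt_le hs
  refine ⟨C, hC0, fun v => ?_⟩
  rw [wnorm_sq, seqNormSq, ← ENNReal.tsum_mul_left]
  refine ENNReal.tsum_le_tsum fun n => ?_
  calc _ ≤ ENNReal.ofReal (‖coef n v‖ ^ 2) * ENNReal.ofReal (C * ((n : ℝ) + 1) ^ s) :=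
        mul_le_mul_right (hC n) _
    _ = _ := by
        rw [← ENNReal.ofReal_mul (by positivity), ← ENNReal.ofReal_mul hC0]
        congr 1; ring

lemma seqNormSq_le_wnorm_sq {s : ℝ} (hs : 0 ≤ s) (v : fock) :
    seqNormSq s v ≤ ENNReal.ofReal (2 * 4 ^ s) * wnorm s v ^ 2 := by
  rw [wnorm_sq, seqNormSq, ← ENNReal.tsum_mul_left]
  refine ENNReal.tsum_le_tsum fun n => ?_
  rw [ENNReal.ofReal_mul (by positivity), mul_comm (ENNReal.ofReal (2 * 4 ^ s)), mul_assoc, mul_comm]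
  refine mul_le_mul_right ?_ _
  rw [mul_comm]
  exact rpow_le_mul_wgt hs n

lemma seqNormSq_zero (v : fock) : seqNormSq 0 v = ENNReal.ofReal (‖v‖ ^ 2) := by
  have h := hasSum_coef_sq v
  rw [← h.tsum_eq, ENNReal.ofReal_tsum_of_nonneg (fun n => sq_nonneg _) h.summable]
  simp [seqNormSq]

lemma ofReal_norm_sq_le_seqNormSq {s : ℝ} (hs : 0 ≤ s) (v : fock) :
    ENNReal.ofReal (‖v‖ ^ 2) ≤ seqNormSq s v := by
  rw [← seqNormSq_zero]
  refine ENNReal.tsum_le_tsum fun n => ENNReal.ofReal_le_ofReal ?_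
  gcongr
  · linarith [Nat.cast_nonneg (α := ℝ) n]

/-! ### Growth along a solution -/

lemma exists_toeplitz_family {W : ℝ → ℂ → ℝ} (hW : IsPotential W) :
    ∃ (T : ℝ → fock →L[ℂ] fock) (M : ℝ), (∀ t (v : fock), ‖T t v‖ ≤ M * ‖v‖) ∧
      (∀ t (v : fock), (T t v : Lp ℂ 2 (volume : Measure ℂ)) =
        proj fun w => (W t w : ℂ) * (v : Lp ℂ 2 (volume : Measure ℂ)) w) ∧
      ∀ t (v w : fock), inner ℂ v (T t w) = ∫ z, (W t z : ℂ) *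
        (conj ((v : Lp ℂ 2 (volume : Measure ℂ)) z) * (w : Lp ℂ 2 (volume : Measure ℂ)) z) := by
  obtain ⟨M, hM⟩ := hW.bounded
  choose T h1 h2 h3 using fun t => exists_toeplitz hW hM t
  exact ⟨T, M, h1, h2, h3⟩

lemma wnorm_zero_sq_le : ∃ C : ℝ, 0 ≤ C ∧ ∀ {δ : ℝ} {W : ℝ → ℂ → ℝ}, IsPotential W →
    ∀ {u₀ : fock} {u : ℝ → fock}, IsSolution δ W u₀ u → ∀ t : ℝ,
      wnorm 0 (u t) ^ 2 ≤ ENNReal.ofReal C * wnorm 0 u₀ ^ 2 := by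
  obtain ⟨C, hC0, hC⟩ := exists_wnorm_sq_le_seqNormSq le_rfl
  refine ⟨C * (2 * 4 ^ (0 : ℝ)), by positivity, fun {δ W} hW {u₀ u} hu t => ?_⟩
  obtain ⟨T, M, hTM, hT, hTi⟩ := exists_toeplitz_family hW
  refine (hC _).trans ?_
  rw [seqNormSq_zero, norm_eq_of_isSolution hu hTM hT (fun t => toeplitz_symm (hTi t)) t,
    ← seqNormSq_zero, ENNReal.ofReal_mul hC0, mul_assoc]
  exact mul_le_mul_right (seqNormSq_le_wnorm_sq le_rfl _) _

/-- This is the abstract growth estimate behind both parts: with $\theta=s/k$, the weights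
$((n+1)\cdots(n+k))^\theta$ are comparable to $(n+1)^s$. The constant depends only on $s$ and $k$;
the potential enters through the commutator bound $K$ alone. -/
lemma exists_wnorm_sq_le {s : ℝ} (hs : 0 < s) {k : ℕ} (hk : s ≤ k) : ∃ C : ℝ, 0 ≤ C ∧
    ∀ {δ : ℝ} {W : ℝ → ℂ → ℝ} {u₀ : fock} {u : ℝ → fock}, IsSolution δ W u₀ u →
    ∀ {T : ℝ → fock →L[ℂ] fock} {M : ℝ}, (∀ t (v : fock), ‖T t v‖ ≤ M * ‖v‖) →
    (∀ t (v : fock), (T t v : Lp ℂ 2 (volume : Measure ℂ)) =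
      proj fun w => (W t w : ℂ) * (v : Lp ℂ 2 (volume : Measure ℂ)) w) →
    (∀ t (v w : fock), inner ℂ v (T t w) = conj (inner ℂ w (T t v))) →
    ∀ {K : ℝ}, 0 ≤ K →
    (∀ t, CommBound (T t) (fun n => ((n + 1).ascFactorial k : ℝ)) K) → ∀ t : ℝ,
      wnorm s (u t) ^ 2 ≤
        ENNReal.ofReal (C * (1 + (2 * K * |t|) ^ (s / k))) * wnorm s u₀ ^ 2 := by
  obtain ⟨C, hC0, hC⟩ := exists_wnorm_sq_le_seqNormSq hs.le
  have hk0 : 0 < (k : ℝ) := hs.trans_le hk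
  set θ : ℝ := s / k with hθ
  have hθ0 : 0 < θ := by positivity
  have hθ1 : θ ≤ 1 := (div_le_one hk0).2 hk
  have hpow : ∀ n : ℕ, (((n : ℝ) + 1) ^ k) ^ θ = ((n : ℝ) + 1) ^ s := by
    intro n
    rw [← Real.rpow_natCast, ← Real.rpow_mul (by positivity), hθ, mul_div_cancel₀ _ hk0.ne']
  set b : ℝ := (((k : ℝ) + 1) ^ k) ^ θ
  have hb0 : 0 ≤ b := by positivity
  refine ⟨C * (b + 2) * (2 * 4 ^ s), by positivity, ?_⟩
  intro δ W u₀ u hu T M hTM hT hsymm K hK0 hK t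
  have h := tsum_rpow_coef_le hu hTM hT hsymm (fun n => Nat.cast_nonneg _) hK0 hK ⟨hθ0, hθ1⟩ t
  set r : ℝ := (2 * K * |t|) ^ θ
  have hr0 : 0 ≤ r := by positivity
  have hlow : seqNormSq s (u t) ≤
      ∑' n : ℕ, ENNReal.ofReal (((n + 1).ascFactorial k : ℝ) ^ θ * ‖coef n (u t)‖ ^ 2) := by
    refine ENNReal.tsum_le_tsum fun n => ENNReal.ofReal_le_ofReal ?_
    rw [← hpow]
    gcongr
    exact succ_pow_le_ascFactorial k n
  have hupp : ∑' n : ℕ, ENNReal.ofReal (((n + 1).ascFactorial k : ℝ) ^ θ * ‖coef n u₀‖ ^ 2)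
      ≤ ENNReal.ofReal b * seqNormSq s u₀ := by
    rw [seqNormSq, ← ENNReal.tsum_mul_left]
    refine ENNReal.tsum_le_tsum fun n => ?_
    rw [← ENNReal.ofReal_mul hb0, ← mul_assoc, ← hpow, ← Real.mul_rpow (by positivity) (by positivity)]
    refine ENNReal.ofReal_le_ofReal ?_
    gcongr
    exact ascFactorial_le_mul_succ_pow k n
  have hrem : ENNReal.ofReal (r * (2 * ‖u₀‖ ^ 2)) ≤ ENNReal.ofReal (r * 2) * seqNormSq s u₀ := by
    rw [← mul_assoc, ENNReal.ofReal_mul (by positivity)]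
    exact mul_le_mul_right (ofReal_norm_sq_le_seqNormSq hs.le u₀) _
  have hY : seqNormSq s (u t) ≤ ENNReal.ofReal ((b + 2) * (1 + r)) * seqNormSq s u₀ := by
    refine (hlow.trans (h.trans (add_le_add hupp hrem))).trans ?_
    rw [← add_mul, ← ENNReal.ofReal_add hb0 (by positivity)]
    refine mul_le_mul_left (ENNReal.ofReal_le_ofReal ?_) _
    nlinarith [mul_nonneg hb0 hr0]
  calc wnorm s (u t) ^ 2 ≤ ENNReal.ofReal C * (ENNReal.ofReal ((b + 2) * (1 + r)) *
        (ENNReal.ofReal (2 * 4 ^ s) * wnorm s u₀ ^ 2)) := by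
        refine (hC _).trans (mul_le_mul_right (hY.trans ?_) _)
        exact mul_le_mul_right (seqNormSq_le_wnorm_sq hs.le u₀) _
    _ = _ := by
        rw [← mul_assoc, ← mul_assoc, ← ENNReal.ofReal_mul hC0,
          ← ENNReal.ofReal_mul (by positivity)]
        congr 2; ring

lemma le_ofReal_mul_of_sq_le {x y : ℝ≥0∞} {A B : ℝ} (hB : 0 ≤ B) (hAB : A ≤ B ^ 2)
    (h : x ^ 2 ≤ ENNReal.ofReal A * y ^ 2) : x ≤ ENNReal.ofReal B * y := by
  refine (ENNReal.pow_le_pow_left_iff two_ne_zero).1 (h.trans ?_)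
  rw [mul_pow, ← ENNReal.ofReal_pow hB]
  gcongr

/-- On the unit disc compactness gives a bound; outside it $|z|^{2k-j}\ge1$. The resulting bounds
only justify the integrations by parts, so their size does not affect the final constant. -/
lemma exists_norm_dzIter_le {V : ℂ → ℝ} (hV : ContDiff ℝ ∞ V) {M : ℝ} (hM : ∀ z, |V z| ≤ M)
    {k : ℕ} {C : ℝ} (hC : ∀ j, 1 ≤ j → j ≤ k → ∀ z : ℂ, ‖z ^ (2 * k - j) * dzIter j V z‖ ≤ C) :
    ∀ j ≤ k, ∃ M, ∀ z, ‖dzIter j V z‖ ≤ M := by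
  intro j hj
  rcases Nat.eq_zero_or_pos j with rfl | hj0
  · exact ⟨M, fun z => by simpa [dzIter_zero] using hM z⟩
  · obtain ⟨B, hB⟩ := (isCompact_closedBall (0 : ℂ) 1).exists_bound_of_continuousOn
      (contDiff_dzIter hV j).continuous.continuousOn
    refine ⟨max B C, fun z => ?_⟩
    rcases le_total ‖z‖ 1 with h | h
    · exact (hB z (by simpa using h)).trans (le_max_left _ _)
    · refine le_trans ?_ ((hC j hj0 hj z).trans (le_max_right _ _))
      rw [norm_mul, norm_pow]
      exact le_mul_of_one_le_left (norm_nonneg _) (one_le_pow₀ h)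

theorem exists_wnorm_le_of_bounded {s : ℝ} (hs : 0 ≤ s) : ∃ C : ℝ, 0 < C ∧
    ∀ (δ : ℝ) (W : ℝ → ℂ → ℝ), IsPotential W → ∀ C₁ : ℝ,
      (∀ j k : ℕ, 1 ≤ j → j ≤ k → k ≤ ⌈s⌉₊ → ∀ t : ℝ,
        eLpNorm (fun z : ℂ => z ^ (2 * k - j) * dzIter j (W t) z) ⊤ volume
          ≤ ENNReal.ofReal C₁) →
      ∀ (u₀ : fock) (u : ℝ → fock), IsSolution δ W u₀ u → ∀ t : ℝ,
        wnorm s (u t) ≤ ENNReal.ofReal (C * bracket (C₁ * t) ^ (1 / 2 : ℝ)) * wnorm s u₀ := by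
  -- For $s=0$ the exponent $s/\lceil s\rceil$ is meaningless, and conservation of mass suffices.
  rcases hs.eq_or_lt with rfl | hs
  · obtain ⟨C, hC0, hC⟩ := wnorm_zero_sq_le
    refine ⟨√C + 1, by positivity, fun δ W hW C₁ _ u₀ u hu t => ?_⟩
    have hb := one_le_bracket (C₁ * t)
    have hb1 : 1 ≤ bracket (C₁ * t) ^ (1 / 2 : ℝ) := Real.one_le_rpow hb (by norm_num)
    refine le_ofReal_mul_of_sq_le (by positivity) ?_ (hC hW hu t)
    have h1 : √C ≤ (√C + 1) * bracket (C₁ * t) ^ (1 / 2 : ℝ) := by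
      nlinarith [Real.sqrt_nonneg C]
    calc C = √C ^ 2 := (Real.sq_sqrt hC0).symm
      _ ≤ _ := by gcongr
  · set k := ⌈s⌉₊ with hk
    have hk1 : s ≤ k := Nat.le_ceil s
    have hk0 : 0 < (k : ℝ) := hs.trans_le hk1
    obtain ⟨C, hC0, hC⟩ := exists_wnorm_sq_le hs hk1
    set S : ℝ := ∑ ij ∈ Finset.HasAntidiagonal.antidiagonal k, (k.choose ij.1 : ℝ)
    have hS : 0 ≤ S := by positivity
    refine ⟨√(C * (2 + 2 * S)) + 1, by positivity, fun δ W hW C₁ hC₁ u₀ u hu t => ?_⟩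
    obtain ⟨T, M, hTM, hT, hTi⟩ := exists_toeplitz_family hW
    obtain ⟨M', hM'⟩ := hW.bounded
    have hbound : ∀ t j, 1 ≤ j → j ≤ k → ∀ z : ℂ,
        ‖z ^ (2 * k - j) * dzIter j (W t) z‖ ≤ max C₁ 0 := fun t j h1 h2 z =>
      norm_le_of_eLpNorm_top_le ((continuous_pow _).mul
        (contDiff_dzIter (hW.smooth_space t) j).continuous) (hC₁ j k h1 h2 le_rfl t) z
    have hmain := hC hu hTM hT (fun t => toeplitz_symm (hTi t))
      (K := S * max C₁ 0) (mul_nonneg hS (le_max_right _ _)) (fun t =>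
        commBound_ascFactorial (hTi t) (hW.smooth_space t)
          (exists_norm_dzIter_le (hW.smooth_space t) (hM' t) (hbound t)) (le_max_right _ _)
          (hbound t)) t
    have hb := one_le_bracket (C₁ * t)
    have hb0 : 0 ≤ bracket (C₁ * t) := by linarith
    refine le_ofReal_mul_of_sq_le (by positivity) ?_ hmain
    have hx : 2 * (S * max C₁ 0) * |t| ≤ 2 * S * bracket (C₁ * t) := by
      have h1 : max C₁ 0 * |t| ≤ bracket (C₁ * t) := by
        refine le_trans ?_ (norm_le_bracket _)
        rw [Real.norm_eq_abs, abs_mul]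
        gcongr
        exact max_le (le_abs_self _) (abs_nonneg _)
      nlinarith
    have hx0 : 0 ≤ 2 * (S * max C₁ 0) * |t| := by
      have := le_max_right C₁ 0
      positivity
    -- Since $s/\lceil s\rceil\le1$, the square of the norm grows at most linearly in $C_1t$; the
    -- exponent $1/2$ appears on taking the square root.
    have hpow : (2 * (S * max C₁ 0) * |t|) ^ (s / k) ≤ 1 + 2 * S * bracket (C₁ * t) := by
      refine le_trans ?_ (add_le_add le_rfl hx)
      set x := 2 * (S * max C₁ 0) * |t|
      calc x ^ (s / k) ≤ (1 + x) ^ (s / k) := by gcongr; linarith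
        _ ≤ (1 + x) ^ (1 : ℝ) :=
          Real.rpow_le_rpow_of_exponent_le (by linarith) ((div_le_one hk0).2 hk1)
        _ = _ := Real.rpow_one _
    calc C * (1 + (2 * (S * max C₁ 0) * |t|) ^ (s / k))
        ≤ C * ((2 + 2 * S) * bracket (C₁ * t)) := by
          gcongr
          nlinarith
      _ = (√(C * (2 + 2 * S)) * bracket (C₁ * t) ^ (1 / 2 : ℝ)) ^ 2 := by
          rw [mul_pow, Real.sq_sqrt (by positivity), ← Real.rpow_natCast (_ ^ (1 / 2 : ℝ)),
            ← Real.rpow_mul hb0]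
          norm_num
          ring
      _ ≤ _ := by gcongr; linarith

/-- Here $k$ is unrelated to $s$. All derivatives decay uniformly in time, so the matrix entries do
too, and one constant $K$ serves every $t$. -/
lemma exists_commBound_ascFactorial {W : ℝ → ℂ → ℝ} (hW : IsPotential W)
    (hdec : ∀ k : ℕ, 1 ≤ k → ∃ Ck : ℝ, ∀ t : ℝ,
      eLpNorm (fun z : ℂ => ((bracket z ^ (2 * k) : ℝ) : ℂ) * dzIter k (W t) z) ⊤ volume
        ≤ ENNReal.ofReal Ck) (k : ℕ) : ∃ K : ℝ, 0 ≤ K ∧ ∀ T : ℝ → fock →L[ℂ] fock,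
      (∀ t (v w : fock), inner ℂ v (T t w) = ∫ z, (W t z : ℂ) *
        (conj ((v : Lp ℂ 2 (volume : Measure ℂ)) z) * (w : Lp ℂ 2 (volume : Measure ℂ)) z)) →
      ∀ t, CommBound (T t) (fun n => ((n + 1).ascFactorial k : ℝ)) K := by
  have hD : ∀ j : ℕ, ∃ D : ℝ, 0 ≤ D ∧ ∀ t (z : ℂ),
      ‖dzIter j (W t) z‖ ≤ D * ((1 + ‖z‖ ^ 2) ^ j)⁻¹ := by
    intro j
    rcases Nat.eq_zero_or_pos j with rfl | hj
    · obtain ⟨M, hM⟩ := hW.bounded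
      exact ⟨M, (abs_nonneg _).trans (hM 0 0), fun t z => by simpa [dzIter_zero] using hM t z⟩
    · obtain ⟨C, hC⟩ := hdec j hj
      refine ⟨max C 0, le_max_right _ _, fun t z => ?_⟩
      have hcont : Continuous fun z : ℂ =>
          ((bracket z ^ (2 * j) : ℝ) : ℂ) * dzIter j (W t) z := by
        have := (contDiff_dzIter (hW.smooth_space t) j).continuous
        simp only [bracket_pow_two_mul]
        fun_prop
      have h := norm_le_of_eLpNorm_top_le hcont (hC t) z
      rw [norm_mul, Complex.norm_real, bracket_pow_two_mul, Real.norm_of_nonneg (by positivity),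
        mul_comm] at h
      rwa [← div_eq_mul_inv, le_div_iff₀ (by positivity)]
  choose D hD0 hD using hD
  -- Half the number of derivatives is the decay exponent of the entries; $k+4$ is what the weight
  -- of degree $k$ requires.
  obtain ⟨B, hB0, hB⟩ := exists_norm_mat_le (k := 2 * (k + 4)) (by omega) hD0
  obtain ⟨K, hK0, hK⟩ := exists_commBound_of_decay k (A := ((k : ℝ) + 1) ^ k) (B := B)
    (by positivity) hB0
  refine ⟨K, hK0, fun T hT t => hK (T t) _ (fun n => Nat.cast_nonneg _)
    (ascFactorial_le_mul_succ_pow k) (toeplitz_symm (hT t)) fun m n hmn => ?_⟩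
  rw [toeplitz_basisVec (hT t)]
  refine (hB (W t) (hW.smooth_space t) (fun j _ z => hD j t z) m n hmn).trans (le_of_eq ?_)
  rw [show -(((2 * (k + 4) : ℕ) : ℝ) / 2) = -((k + 4 : ℕ) : ℝ) by push_cast; ring,
    Real.rpow_neg (by positivity), Real.rpow_natCast]

theorem exists_wnorm_le_of_decay {s : ℝ} (hs : 0 ≤ s) {ε : ℝ} (hε : 0 < ε) {W : ℝ → ℂ → ℝ}
    (hW : IsPotential W) (hdec : ∀ k : ℕ, 1 ≤ k → ∃ Ck : ℝ, ∀ t : ℝ,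
      eLpNorm (fun z : ℂ => ((bracket z ^ (2 * k) : ℝ) : ℂ) * dzIter k (W t) z) ⊤ volume
        ≤ ENNReal.ofReal Ck) : ∃ C : ℝ, 0 < C ∧
    ∀ (δ : ℝ) (u₀ : fock) (u : ℝ → fock), IsSolution δ W u₀ u → ∀ t : ℝ,
      wnorm s (u t) ≤ ENNReal.ofReal (C * bracket t ^ ε) * wnorm s u₀ := by
  rcases hs.eq_or_lt with rfl | hs
  · obtain ⟨C, hC0, hC⟩ := wnorm_zero_sq_le
    refine ⟨√C + 1, by positivity, fun δ u₀ u hu t => ?_⟩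
    have hb1 : 1 ≤ bracket t ^ ε := Real.one_le_rpow (one_le_bracket t) hε.le
    refine le_ofReal_mul_of_sq_le (by positivity) ?_ (hC hW hu t)
    have h1 : √C ≤ (√C + 1) * bracket t ^ ε := by
      nlinarith [Real.sqrt_nonneg C]
    calc C = √C ^ 2 := (Real.sq_sqrt hC0).symm
      _ ≤ _ := by gcongr
  · obtain ⟨k, hk⟩ := exists_nat_ge (max s (s / (2 * ε)))
    have hk1 : s ≤ k := (le_max_left _ _).trans hk
    have hk0 : 0 < (k : ℝ) := hs.trans_le hk1
    have hθ : s / k ≤ 2 * ε := by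
      have := (le_max_right _ _).trans hk
      rw [div_le_iff₀ (by positivity)] at this ⊢
      linarith
    have hθ0 : 0 ≤ s / k := by positivity
    obtain ⟨C, hC0, hC⟩ := exists_wnorm_sq_le hs hk1
    obtain ⟨K, hK0, hK⟩ := exists_commBound_ascFactorial hW hdec k
    set b : ℝ := (2 * K) ^ (s / k)
    refine ⟨√(C * (1 + b)) + 1, by positivity, fun δ u₀ u hu t => ?_⟩
    obtain ⟨T, M, hTM, hT, hTi⟩ := exists_toeplitz_family hW
    have hmain := hC hu hTM hT (fun t => toeplitz_symm (hTi t)) hK0 (hK T hTi) t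
    have hb := one_le_bracket t
    have hb0 : 0 ≤ bracket t := by linarith
    refine le_ofReal_mul_of_sq_le (by positivity) ?_ hmain
    have hpow : (2 * K * |t|) ^ (s / k) ≤ b * bracket t ^ (2 * ε) := by
      rw [Real.mul_rpow (by positivity) (abs_nonneg _)]
      gcongr
      calc |t| ^ (s / k) ≤ bracket t ^ (s / k) := by gcongr; exact norm_le_bracket t
        _ ≤ _ := Real.rpow_le_rpow_of_exponent_le hb hθ
    have h1 : 1 ≤ bracket t ^ (2 * ε) := Real.one_le_rpow hb (by positivity)
    calc C * (1 + (2 * K * |t|) ^ (s / k))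
        ≤ C * ((1 + b) * bracket t ^ (2 * ε)) := by
          gcongr
          nlinarith
      _ = (√(C * (1 + b)) * bracket t ^ ε) ^ 2 := by
          rw [mul_pow, Real.sq_sqrt (by positivity), ← Real.rpow_natCast (_ ^ ε),
            ← Real.rpow_mul hb0, mul_comm ε]
          push_cast
          ring
      _ ≤ _ := by gcongr; linarith

end LLL

end

theorem theorem2p4 (s : ℝ) (hs : 0 ≤ s) :
    (∃ C : ℝ, 0 < C ∧
      ∀ (δ : ℝ) (W : ℝ → ℂ → ℝ), LLL.IsPotential W →
      ∀ C₁ : ℝ,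
        (∀ j k : ℕ, 1 ≤ j → j ≤ k → k ≤ ⌈s⌉₊ → ∀ t : ℝ,
          eLpNorm (fun z : ℂ => z ^ (2 * k - j) * LLL.dzIter j (W t) z) ⊤ volume
            ≤ ENNReal.ofReal C₁) →
      ∀ (u₀ : LLL.fock) (u : ℝ → LLL.fock),
        LLL.wnorm s u₀ < ⊤ → LLL.IsSolution δ W u₀ u →
        ∀ t : ℝ, LLL.wnorm s (u t) ≤
          ENNReal.ofReal (C * LLL.bracket (C₁ * t) ^ (1 / 2 : ℝ)) * LLL.wnorm s u₀) ∧
    (∀ ε : ℝ, 0 < ε →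
      ∀ W : ℝ → ℂ → ℝ, LLL.IsPotential W →
        (∀ k : ℕ, 1 ≤ k → ∃ Ck : ℝ, ∀ t : ℝ,
          eLpNorm (fun z : ℂ => ((LLL.bracket z ^ (2 * k) : ℝ) : ℂ) * LLL.dzIter k (W t) z)
            ⊤ volume ≤ ENNReal.ofReal Ck) →
        ∃ C : ℝ, 0 < C ∧
          ∀ (δ : ℝ) (u₀ : LLL.fock) (u : ℝ → LLL.fock),
            LLL.wnorm s u₀ < ⊤ → LLL.IsSolution δ W u₀ u →
            ∀ t : ℝ, LLL.wnorm s (u t) ≤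
              ENNReal.ofReal (C * LLL.bracket t ^ ε) * LLL.wnorm s u₀) := by
  refine ⟨?_, fun ε hε W hW hdec => ?_⟩
  · obtain ⟨C, hC0, hC⟩ := LLL.exists_wnorm_le_of_bounded hs
    exact ⟨C, hC0, fun δ W hW C₁ hC₁ u₀ u _ hu t => hC δ W hW C₁ hC₁ u₀ u hu t⟩
  · obtain ⟨C, hC0, hC⟩ := LLL.exists_wnorm_le_of_decay hs hε hW hdec
    exact ⟨C, hC0, fun δ u₀ u _ hu t => hC δ u₀ u hu t⟩
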